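/- Let $M$ be a (Hausdorff) smooth surface with a smooth Riemannian metric, let $P_0\in M$, let an orientation of an open neighbourhood of $P_0$ be chosen, and let $(u,v)$ be a right-handed orthonormal basis of $T_{P_0}M$. For a real number $s$ close to $0$, start at $P_0$ and follow the geodesic with initial velocity $u$ up to the parameter value $s$, arriving at $P_1(s)$; turn the velocity left by $\pi/2$ and follow the geodesic with that initial velocity up to the parameter value $s$, arriving at $P_2(s)$; repeat this twice more to obtain $P_3(s)$ and $P_4(s)$. Likewise, start at $P_0$ and follow the geodesic with initial velocity $v$ up to the parameter value $s$, arriving at $Q_1(s)$; turn the velocity right by $\pi/2$ and follow the geodesic with that initial velocity up to the parameter value $s$, arriving at $Q_2(s)$. For all sufficiently small $|s|$ these points exist and are uniquely determined. Let $\kappa$ be the Gaussian curvature of $M$. Then $$\lim_{s\to 0}\frac{P_4(s)-P_0}{s^3}=\lim_{s\to 0}\frac{Q_2(s)-P_2(s)}{s^3}=\frac{\kappa(P_0)}{2}(u-v)\in T_{P_0}M,$$ in the sense that, for every smooth map $f$ from a neighbourhood of $P_0$ to a real normed space, $$\lim_{s\to 0}\frac{f(P_4(s))-f(P_0)}{s^3}=\lim_{s\to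 0}\frac{f(Q_2(s))-f(P_2(s))}{s^3}=df_{P_0}\Bigl(\frac{\kappa(P_0)}{2}(u-v)\Bigr).$$ Consequently, the Riemannian distances satisfy $$d(P_0,P_4(s))=\frac{|\kappa(P_0)|}{\sqrt2}|s|^3+O(s^4),\qquad d(P_2(s),Q_2(s))=\frac{|\kappa(P_0)|}{\sqrt2}|s|^3+O(s^4)\qquad(s\to0),$$ and, as $s\to 0^+$, the oriented angle from $u$ (the direction of the first leg) to either gap $P_4(s)-P_0$, $Q_2(s)-P_2(s)$ tends to $-\pi/4$ if $\kappa(P_0)>0$ and to $3\pi/4$ if $\kappa(P_0)<0$. Here the gap is read as the vector $L\bigl(f(P_4(s))-f(P_0)\bigr)$, respectively $L\bigl(f(Q_2(s))-f(P_2(s))\bigr)$, of $T_{P_0}M$, for any smooth map $f$ from a neighbourhood of $P_0$ to a real normed space and any continuous linear left inverse $L$ of $df_{P_0}$ (for instance a chart $f$ and $L=(df_{P_0})^{-1}$). -/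

import Mathlib

open Bundle Manifold Filter Topology Asymptotics
open scoped ContDiff

noncomputable section

namespace GeodesicGap

/-- The model plane of a surface. -/
abbrev Plane : Type := EuclideanSpace ℝ (Fin 2)

section Surface

variable {M : Type*} [TopologicalSpace M] [ChartedSpace Plane M]

instance factFinrankTangent (x : M) : Fact (Module.finrank ℝ (TangentSpace (𝓡 2) x) = 2) :=
  ⟨by
    have h : Module.finrank ℝ Plane = 2 := by simp
    exact h⟩

/-- The `i`-th coordinate vector `∂ᵢ` of the chart around `x`, at the point with coordinates `y`. -/
def coordVec (x : M) (y : Plane) (i : Fin 2) :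
    TangentSpace (𝓡 2) ((extChartAt (𝓡 2) x).symm y) :=
  mfderiv 𝓘(ℝ, Plane) (𝓡 2) (extChartAt (𝓡 2) x).symm y (EuclideanSpace.single i (1 : ℝ))

/-- The partial derivative `∂f/∂yⁱ` of a function of two real variables. -/
def pderiv (i : Fin 2) (f : Plane → ℝ) (y : Plane) : ℝ :=
  fderiv ℝ f y (EuclideanSpace.single i (1 : ℝ))

section Metric

variable [RiemannianBundle (fun x : M ↦ TangentSpace (𝓡 2) x)]

/-- The coefficients `gᵢⱼ = ⟨∂ᵢ, ∂ⱼ⟩` of the metric in the chart around `x`. -/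
def metricCoeff (x : M) (i j : Fin 2) (y : Plane) : ℝ :=
  inner ℝ (coordVec x y i) (coordVec x y j)

/-- The matrix `(gᵢⱼ)` of the metric in the chart around `x`. -/
def metricMatrix (x : M) (y : Plane) : Matrix (Fin 2) (Fin 2) ℝ :=
  Matrix.of fun i j ↦ metricCoeff x i j y

/-- The Christoffel symbols `Γᵏᵢⱼ` of the Riemannian connection in the chart around `x`:
`Γᵏᵢⱼ = ½ ∑ₗ gᵏˡ (∂ᵢ gⱼₗ + ∂ⱼ gᵢₗ - ∂ₗ gᵢⱼ)`. -/
def christoffel (x : M) (k i j : Fin 2) (y : Plane) : ℝ :=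
  (1 / 2 : ℝ) * ∑ l, (metricMatrix x y)⁻¹ k l *
    (pderiv i (metricCoeff x j l) y + pderiv j (metricCoeff x i l) y
      - pderiv l (metricCoeff x i j) y)

/-- The coefficients of the curvature tensor `R(X, Y) = ∇_X ∇_Y - ∇_Y ∇_X - ∇_[X, Y]` in the
chart around `x`: the `l`-th coordinate of `R(∂ᵢ, ∂ⱼ) ∂ₖ`. -/
def curvatureCoeff (x : M) (l k i j : Fin 2) (y : Plane) : ℝ :=
  pderiv i (christoffel x l j k) y - pderiv j (christoffel x l i k) y
    + ∑ m, (christoffel x l i m y * christoffel x m j k y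
        - christoffel x l j m y * christoffel x m i k y)

/-- The Gaussian curvature `⟨R(∂₁, ∂₂) ∂₂, ∂₁⟩ / (g₁₁ g₂₂ - g₁₂²)` at the point `p`. -/
def gaussCurvature (p : M) : ℝ :=
  (∑ l, metricCoeff p 0 l (extChartAt (𝓡 2) p p) *
      curvatureCoeff p l 1 0 1 (extChartAt (𝓡 2) p p)) /
    (metricMatrix p (extChartAt (𝓡 2) p p)).det

/-- `γ` is a (`C²`, affinely parametrized) geodesic on the open set `J` of parameters: it solves
`c̈ᵏ + ∑ᵢⱼ Γᵏᵢⱼ(c) ċⁱ ċʲ = 0` in the coordinates of every chart it meets. -/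
def IsGeodesicOn (γ : ℝ → M) (J : Set ℝ) : Prop :=
  ContMDiffOn 𝓘(ℝ, ℝ) (𝓡 2) 2 γ J ∧
    ∀ t ∈ J, ∀ x : M, γ t ∈ (chartAt Plane x).source → ∀ k : Fin 2,
      deriv (deriv fun τ ↦ extChartAt (𝓡 2) x (γ τ) k) t =
        -∑ i, ∑ j, christoffel x k i j (extChartAt (𝓡 2) x (γ t)) *
          deriv (fun τ ↦ extChartAt (𝓡 2) x (γ τ) i) t *
          deriv (fun τ ↦ extChartAt (𝓡 2) x (γ τ) j) t

/-- The velocity `γ'(t)`, as a point of the tangent bundle. -/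
def velocity (γ : ℝ → M) (t : ℝ) : TangentBundle (𝓡 2) M :=
  ⟨γ t, mfderiv 𝓘(ℝ, ℝ) (𝓡 2) γ t (1 : ℝ)⟩

/-- The geodesic with initial velocity `ξ` is defined up to the parameter value `s`, where its
velocity is `η`. -/
def IsLeg (s : ℝ) (ξ η : TangentBundle (𝓡 2) M) : Prop :=
  ∃ (γ : ℝ → M) (a b : ℝ), (0 : ℝ) ∈ Set.Ioo a b ∧ s ∈ Set.Ioo a b ∧
    IsGeodesicOn γ (Set.Ioo a b) ∧ velocity γ 0 = ξ ∧ velocity γ s = η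

/-- `(a, b)` is a right-handed basis of an oriented Euclidean plane. -/
def RightHanded {x : M} (o : Orientation ℝ (TangentSpace (𝓡 2) x) (Fin 2))
    (a b : TangentSpace (𝓡 2) x) : Prop :=
  0 < o.areaForm a b

/-- A family of orientations of the tangent planes is an orientation of the open set `U` of the
surface: around each point of `U`, the handedness of the coordinate frame does not change. -/
def IsOrientationOn (o : ∀ x : M, Orientation ℝ (TangentSpace (𝓡 2) x) (Fin 2))
    (U : Set M) : Prop :=
  IsOpen U ∧ ∀ x ∈ U, ∀ᶠ y in 𝓝 (extChartAt (𝓡 2) x x),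
    (RightHanded (o ((extChartAt (𝓡 2) x).symm y)) (coordVec x y 0) (coordVec x y 1) ↔
      RightHanded (o ((extChartAt (𝓡 2) x).symm (extChartAt (𝓡 2) x x)))
        (coordVec x (extChartAt (𝓡 2) x x) 0) (coordVec x (extChartAt (𝓡 2) x x) 1))

/-- Turning left by `π / 2`. -/
def leftTurn (o : ∀ x : M, Orientation ℝ (TangentSpace (𝓡 2) x) (Fin 2))
    (ξ : TangentBundle (𝓡 2) M) : TangentBundle (𝓡 2) M :=
  ⟨ξ.proj, (o ξ.proj).rightAngleRotation ξ.snd⟩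

/-- Turning right by `π / 2`. -/
def rightTurn (o : ∀ x : M, Orientation ℝ (TangentSpace (𝓡 2) x) (Fin 2))
    (ξ : TangentBundle (𝓡 2) M) : TangentBundle (𝓡 2) M :=
  ⟨ξ.proj, (o ξ.proj).rightAngleRotation.symm ξ.snd⟩

/-- The journey of four geodesic legs of length `s`, with initial velocity `ξ` and with a left turn
by `π / 2` between consecutive legs, which ends its legs at `p₁`, `p₂`, `p₃`, `p₄`. -/
def IsLeftJourney (o : ∀ x : M, Orientation ℝ (TangentSpace (𝓡 2) x) (Fin 2)) (s : ℝ)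
    (ξ : TangentBundle (𝓡 2) M) (p₁ p₂ p₃ p₄ : M) : Prop :=
  ∃ η₁ η₂ η₃ η₄ : TangentBundle (𝓡 2) M,
    IsLeg s ξ η₁ ∧ IsLeg s (leftTurn o η₁) η₂ ∧ IsLeg s (leftTurn o η₂) η₃ ∧
      IsLeg s (leftTurn o η₃) η₄ ∧
      η₁.proj = p₁ ∧ η₂.proj = p₂ ∧ η₃.proj = p₃ ∧ η₄.proj = p₄

/-- The journey of two geodesic legs of length `s`, with initial velocity `ξ` and with a right turn
by `π / 2` between them, which ends its legs at `q₁`, `q₂`. -/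
def IsRightJourney (o : ∀ x : M, Orientation ℝ (TangentSpace (𝓡 2) x) (Fin 2)) (s : ℝ)
    (ξ : TangentBundle (𝓡 2) M) (q₁ q₂ : M) : Prop :=
  ∃ η₁ η₂ : TangentBundle (𝓡 2) M,
    IsLeg s ξ η₁ ∧ IsLeg s (rightTurn o η₁) η₂ ∧ η₁.proj = q₁ ∧ η₂.proj = q₂

end Metric

end Surface

end GeodesicGap

end

/-! Read a leg in the chart around `P₀` together with a frame. The position x, the velocity a and a
parallel field b solve (x, a, b)' = (a, -Γ(a, a), -Γ(a, b)), which is `frameField`. The quarter turn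
J is parallel along geodesics (`IsSprayCurveOn.hasDerivAt_rotationFrame`), so b may be taken to be J
a. A left turn then becomes the constant linear map (x, a, b) ↦ (x, b, -a), the same at every
corner. A journey is thus an alternation of time-s flows of a single vector field with constant
linear maps, and its end can be expanded in powers of s.

The position is needed to third order. Since x' = a is linear in the state, knowing the state to
second order is enough; `HasJet` records this pair of orders and `HasJet.flow` propagates it along a
leg. For every torsion-free Γ, the terms below s³ cancel both in P₄ - P₀ and in Q₂ - P₂, and both
cubic coefficients equal ½(R(u, v)v + R(u, v)u) (`left_journey_four`, `two_journeys`). Compatibility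
with the metric makes R(u, v) skew. In dimension two, with u, v orthonormal, this forces R(u, v)v =
κu and R(u, v)u = -κv (`curvature_orthonormal`), so the coefficient is (κ/2)(u - v), of length
|κ|/√2.

Two geometric facts link this computation to the surface. Short geodesics exist, are unique and stay
in the chart (`exists_legs`); since a geodesic must satisfy its equation in every chart, this uses
the transformation law `christoffelForm_chartChange`. Near `P₀`, the Riemannian distance of two
points differs from the length of their coordinate difference, measured by the metric at `P₀`, by at
most a constant times (distance of the points to the centre) × (size of the difference), by
`exists_abs_riemannianEDist_sub_speed_le`. For points at distance O(s) with a gap O(s³), this error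
is O(s⁴). -/

noncomputable section

namespace GeodesicGap

/-! ### Taylor expansion of flows, and jets of curves of states -/

section Taylor

variable {N : Type*} [NormedAddCommGroup N] [NormedSpace ℝ N]

/-- Integrating a bound on the derivative by a power of the parameter. -/
theorem norm_sub_le_mul_pow {f f' : ℝ → N} {s C : ℝ} {n : ℕ} (hC : 0 ≤ C)
    (hf : ∀ t ∈ Set.uIcc 0 s, HasDerivAt f (f' t) t)
    (hb : ∀ t ∈ Set.uIcc 0 s, ‖f' t‖ ≤ C * |t| ^ n) :
    ‖f s - f 0‖ ≤ C * |s| ^ (n + 1) := by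
  have h := (convex_uIcc (0 : ℝ) s).norm_image_sub_le_of_norm_hasDerivWithin_le
    (f := f) (f' := f') (C := C * |s| ^ n)
    (fun t ht ↦ (hf t ht).hasDerivWithinAt)
    (fun t ht ↦ (hb t ht).trans (by
      have : |t| ≤ |s| := by
        have := Set.abs_sub_left_of_mem_uIcc ht
        simpa using this
      gcongr)) Set.left_mem_uIcc Set.right_mem_uIcc
  simpa [pow_succ, mul_assoc] using h

/-- The derivative of a C² map is locally Lipschitz, so on the segment from `z₀` to `z` it differs
from its value at `z₀` by at most K‖z - z₀‖; the mean value inequality supplies the second factor.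
-/
theorem isBigO_sub_sub_fderiv {N' : Type*} [NormedAddCommGroup N'] [NormedSpace ℝ N']
    {V : N → N'} {z₀ : N} (hV : ContDiffAt ℝ 2 V z₀) :
    (fun z ↦ V z - V z₀ - fderiv ℝ V z₀ (z - z₀)) =O[𝓝 z₀] fun z ↦ ‖z - z₀‖ ^ 2 := by
  obtain ⟨K, S, hS, hK⟩ :=
    (hV.fderiv_right (m := 1) (by norm_num)).exists_lipschitzOnWith
  have hd : ∀ᶠ z in 𝓝 z₀, DifferentiableAt ℝ V z := by
    filter_upwards [hV.eventually (by simp)] with z hz using hz.differentiableAt (by simp)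
  obtain ⟨r, hr, hball⟩ := Metric.mem_nhds_iff.1 (inter_mem hS hd)
  refine IsBigO.of_bound K ?_
  filter_upwards [Metric.ball_mem_nhds z₀ hr] with z hz
  have h := (convex_segment (𝕜 := ℝ) z₀ z).norm_image_sub_le_of_norm_hasFDerivWithin_le'
    (f := V) (f' := fderiv ℝ V) (φ := fderiv ℝ V z₀) (C := K * ‖z - z₀‖) ?_ ?_
    (left_mem_segment ℝ z₀ z) (right_mem_segment ℝ z₀ z)
  · rw [Real.norm_of_nonneg (by positivity)]
    calc _ ≤ K * ‖z - z₀‖ * ‖z - z₀‖ := h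
      _ = _ := by ring
  · intro w hw
    have hw' : w ∈ Metric.ball z₀ r :=
      (convex_ball z₀ r).segment_subset (Metric.mem_ball_self hr) hz hw
    exact (hball hw').2.hasFDerivAt.hasFDerivWithinAt
  · intro w hw
    have hw' : w ∈ Metric.ball z₀ r :=
      (convex_ball z₀ r).segment_subset (Metric.mem_ball_self hr) hz hw
    have h1 := hK.norm_sub_le (hball hw').1 (hball (Metric.mem_ball_self hr)).1
    have h2 : ‖w - z₀‖ ≤ ‖z - z₀‖ := norm_sub_le_of_mem_segment hw
    refine h1.trans (by gcongr)

variable {E : Type*} [NormedAddCommGroup E] [NormedSpace ℝ E]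

/-- Along an integral curve the successive derivatives are V, V₁ = DV·V and V₂ = DV₁·V, and V₂ is
bounded near `z₀`. The constant depends on the neighbourhood only, so the estimate is uniform in the
starting point, which itself moves with s. Where q ∘ V is the linear map ρ, integrating ρ of the
second-order expansion gives one more order for q ∘ ζ. -/
theorem flow_taylor {V : N → N} {z₀ : N} (hV : ContDiffAt ℝ 3 V z₀) (q ρ : N →L[ℝ] E) :
    ∃ U ∈ 𝓝 z₀, ∃ C : ℝ, ∀ (ζ : ℝ → N) (s : ℝ),
      (∀ t ∈ Set.uIcc 0 s, HasDerivAt ζ (V (ζ t)) t ∧ ζ t ∈ U ∧ q (V (ζ t)) = ρ (ζ t)) →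
      ‖ζ s - (ζ 0 + s • V (ζ 0) + (s ^ 2 / 2) • fderiv ℝ V (ζ 0) (V (ζ 0)))‖ ≤ C * |s| ^ 3 ∧
      ‖q (ζ s) - (q (ζ 0) + s • ρ (ζ 0) + (s ^ 2 / 2) • ρ (V (ζ 0))
        + (s ^ 3 / 6) • ρ (fderiv ℝ V (ζ 0) (V (ζ 0))))‖ ≤ C * |s| ^ 4 := by
  set V₁ : N → N := fun z ↦ fderiv ℝ V z (V z) with hV₁
  have hV₁c : ContDiffAt ℝ 2 V₁ z₀ :=
    (hV.fderiv_right (m := 2) (by norm_num)).clm_apply (hV.of_le (by norm_num))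
  set V₂ : N → N := fun z ↦ fderiv ℝ V₁ z (V z) with hV₂
  have hV₂c : ContinuousAt V₂ z₀ :=
    ((hV₁c.fderiv_right (m := 1) (by norm_num)).clm_apply
      (hV.of_le (by norm_num))).continuousAt
  have hd : ∀ᶠ z in 𝓝 z₀, DifferentiableAt ℝ V z := by
    filter_upwards [hV.eventually (by simp)] with z hz using hz.differentiableAt (by simp)
  have hd₁ : ∀ᶠ z in 𝓝 z₀, DifferentiableAt ℝ V₁ z := by
    filter_upwards [hV₁c.eventually (by simp)] with z hz using hz.differentiableAt (by simp)
  have hb : ∀ᶠ z in 𝓝 z₀, ‖V₂ z‖ < ‖V₂ z₀‖ + 1 :=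
    hV₂c.norm.eventually_lt_const (by simp)
  -- The third derivative is bounded by ‖V₂ z₀‖ + 1; the factor 1 + ‖ρ‖ makes one constant serve
  -- both estimates.
  refine ⟨_, inter_mem hd (inter_mem hd₁ hb), (1 + ‖ρ‖) * (‖V₂ z₀‖ + 1), fun ζ s h ↦ ?_⟩
  set C := ‖V₂ z₀‖ + 1 with hC
  have hC0 : 0 ≤ C := by positivity
  have sub : ∀ {t}, t ∈ Set.uIcc 0 s → Set.uIcc 0 t ⊆ Set.uIcc 0 s := fun ht ↦
    Set.uIcc_subset_uIcc_left ht
  have e₁ : ∀ t ∈ Set.uIcc 0 s, ‖V₁ (ζ t) - V₁ (ζ 0)‖ ≤ C * |t| ^ 1 := by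
    intro t ht
    refine norm_sub_le_mul_pow (f := fun t ↦ V₁ (ζ t)) (f' := fun t ↦ V₂ (ζ t)) (n := 0) hC0
      (fun τ hτ ↦ ?_) (fun τ hτ ↦ ?_)
    · have := h τ (sub ht hτ)
      exact this.2.1.2.1.hasFDerivAt.comp_hasDerivAt τ this.1
    · have := h τ (sub ht hτ)
      simpa using (this.2.1.2.2 : ‖V₂ (ζ τ)‖ < C).le
  have e₂ : ∀ t ∈ Set.uIcc 0 s, ‖V (ζ t) - V (ζ 0) - t • V₁ (ζ 0)‖ ≤ C * |t| ^ 2 := by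
    intro t ht
    have := norm_sub_le_mul_pow (f := fun t ↦ V (ζ t) - t • V₁ (ζ 0))
      (f' := fun t ↦ V₁ (ζ t) - V₁ (ζ 0)) (s := t) (n := 1) hC0
      (fun τ hτ ↦ ?_) (fun τ hτ ↦ e₁ τ (sub ht hτ))
    · refine le_trans (le_of_eq ?_) this
      congr 1; simp; abel
    · have := h τ (sub ht hτ)
      have h2 := (hasDerivAt_id τ).smul_const (V₁ (ζ 0))
      simp only [one_smul] at h2
      exact (this.2.1.1.hasFDerivAt.comp_hasDerivAt τ this.1).sub h2
  have e₃ : ∀ t ∈ Set.uIcc 0 s,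
      ‖ζ t - (ζ 0 + t • V (ζ 0) + (t ^ 2 / 2) • V₁ (ζ 0))‖ ≤ C * |t| ^ 3 := by
    intro t ht
    have := norm_sub_le_mul_pow
      (f := fun t ↦ ζ t - (ζ 0 + t • V (ζ 0) + (t ^ 2 / 2) • V₁ (ζ 0)))
      (f' := fun t ↦ V (ζ t) - V (ζ 0) - t • V₁ (ζ 0)) (s := t) (n := 2) hC0
      (fun τ hτ ↦ ?_) (fun τ hτ ↦ e₂ τ (sub ht hτ))
    · simpa using this
    · have := h τ (sub ht hτ)
      have h2 := (hasDerivAt_id τ).smul_const (V (ζ 0))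
      have h3 := (((hasDerivAt_id τ).pow 2).div_const 2).smul_const (V₁ (ζ 0))
      refine (this.1.sub ((h2.const_add (ζ 0)).add h3)).congr_deriv ?_
      simp; abel
  have hnn : 0 ≤ ‖ρ‖ := norm_nonneg _
  refine ⟨(e₃ s Set.right_mem_uIcc).trans ?_, ?_⟩
  · gcongr
    nlinarith
  · have := norm_sub_le_mul_pow
      (f := fun t ↦ q (ζ t) - (q (ζ 0) + t • ρ (ζ 0) + (t ^ 2 / 2) • ρ (V (ζ 0))
        + (t ^ 3 / 6) • ρ (V₁ (ζ 0))))
      (f' := fun t ↦ ρ (ζ t - (ζ 0 + t • V (ζ 0) + (t ^ 2 / 2) • V₁ (ζ 0))))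
      (s := s) (C := ‖ρ‖ * C) (n := 3) (by positivity)
      (fun τ hτ ↦ ?_) (fun τ hτ ↦ ?_)
    · simp only [ne_eq, OfNat.ofNat_ne_zero, not_false_eq_true, zero_pow, zero_div, zero_smul,
        add_zero, sub_self, sub_zero] at this
      refine this.trans ?_
      gcongr
      linarith
    · have := h τ hτ
      have h2 := (hasDerivAt_id τ).smul_const (ρ (ζ 0))
      have h3 := (((hasDerivAt_id τ).pow 2).div_const 2).smul_const (ρ (V (ζ 0)))
      have h4 := (((hasDerivAt_id τ).pow 3).div_const 6).smul_const (ρ (V₁ (ζ 0)))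
      have h5 : HasDerivAt (fun t ↦ q (ζ t)) (ρ (ζ τ)) τ := by
        rw [← this.2.2]; exact q.hasFDerivAt.comp_hasDerivAt τ this.1
      refine (h5.sub (((h2.const_add (q (ζ 0))).add h3).add h4)).congr_deriv ?_
      simp only [map_sub, map_add, map_smul]
      have e1 : (3 * τ ^ 2 / 6 : ℝ) = τ ^ 2 / 2 := by ring
      simp [e1]
    · refine (ρ.le_opNorm _).trans ?_
      rw [mul_assoc]
      gcongr
      exact e₃ τ hτ

/-- Second-order expansion of a curve `z` at `0`, and third-order expansion of `q ∘ z`. -/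
structure HasJet (q : N →L[ℝ] E) (z : ℝ → N) (z₀ z₁ z₂ : N) (p₃ : E) : Prop where
  isBigO : (fun s ↦ z s - (z₀ + s • z₁ + s ^ 2 • z₂)) =O[𝓝 0] fun s ↦ s ^ 3
  isBigO_proj : (fun s ↦ q (z s) - (q z₀ + s • q z₁ + s ^ 2 • q z₂ + s ^ 3 • p₃))
    =O[𝓝 0] fun s ↦ s ^ 4

theorem isBigO_pow_pow_zero {m n : ℕ} (h : m ≤ n) :
    (fun s : ℝ ↦ s ^ n) =O[𝓝 0] fun s ↦ s ^ m := by
  obtain ⟨k, rfl⟩ := Nat.exists_eq_add_of_le h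
  have : (fun s : ℝ ↦ s ^ k) =O[𝓝 0] fun _ ↦ (1 : ℝ) :=
    ((continuous_pow k).continuousAt (x := (0 : ℝ))).isBigO_one ℝ
  simpa [pow_add] using (isBigO_refl (fun s : ℝ ↦ s ^ m) (𝓝 0)).mul this

theorem isBigO_smul_const {f : ℝ → ℝ} (c : N) : (fun s ↦ f s • c) =O[𝓝 0] f :=
  IsBigO.of_bound ‖c‖ (by simp [norm_smul, mul_comm])

namespace HasJet

variable {q ρ : N →L[ℝ] E} {z z' : ℝ → N} {z₀ z₁ z₂ : N} {p₃ : E}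

theorem isBigO_two (h : HasJet q z z₀ z₁ z₂ p₃) :
    (fun s ↦ z s - z₀ - s • z₁) =O[𝓝 0] fun s ↦ s ^ 2 := by
  have := (h.isBigO.trans (isBigO_pow_pow_zero (m := 2) (by norm_num))).add
    (isBigO_smul_const (f := fun s ↦ s ^ 2) z₂)
  refine this.congr_left fun s ↦ ?_
  abel

theorem isBigO_one (h : HasJet q z z₀ z₁ z₂ p₃) :
    (fun s ↦ z s - z₀) =O[𝓝 0] fun s ↦ s := by
  have := (h.isBigO_two.trans (isBigO_pow_pow_zero (m := 1) (by norm_num))).add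
    (isBigO_smul_const (f := fun s ↦ s ^ 1) z₁)
  simpa using this

theorem tendsto (h : HasJet q z z₀ z₁ z₂ p₃) : Tendsto z (𝓝 0) (𝓝 z₀) := by
  have := h.isBigO_one.trans_tendsto (tendsto_id (α := ℝ))
  simpa using this.add_const z₀

/-- The Taylor formula of the flow is applied at the moving point z(s), and its coefficients are
expanded at `z₀`: V(z s) to first order and DV·V(z s) to order zero suffice, because they come with
factors s and s²/2. -/
theorem flow (h : HasJet q z z₀ z₁ z₂ p₃) {V : N → N} (hV : ContDiffAt ℝ 3 V z₀)
    (hq : ∀ z, q (V z) = ρ z)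
    (hz : ∀ U ∈ 𝓝 z₀, ∀ᶠ s in 𝓝 (0 : ℝ), ∃ ζ : ℝ → N, ζ 0 = z s ∧ ζ s = z' s ∧
      ∀ t ∈ Set.uIcc 0 s, HasDerivAt ζ (V (ζ t)) t ∧ ζ t ∈ U) :
    HasJet q z' z₀ (z₁ + V z₀)
      (z₂ + fderiv ℝ V z₀ z₁ + (1 / 2 : ℝ) • fderiv ℝ V z₀ (V z₀))
      (p₃ + ρ z₂ + (1 / 2 : ℝ) • ρ (fderiv ℝ V z₀ z₁)
        + (1 / 6 : ℝ) • ρ (fderiv ℝ V z₀ (V z₀))) := by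
  obtain ⟨U, hU, C, hC⟩ := flow_taylor hV q ρ
  set L := fderiv ℝ V z₀ with hL
  -- Differentiating q ∘ V = ρ gives q ∘ DV = ρ, which converts the projected second-order jet into
  -- terms in ρ.
  have hqL : ∀ w, q (L w) = ρ w := by
    have h1 : HasFDerivAt (fun z ↦ q (V z)) (q.comp L) z₀ :=
      q.hasFDerivAt.comp z₀ (hV.differentiableAt (by norm_num)).hasFDerivAt
    simp only [hq] at h1
    exact fun w ↦ congr($(h1.unique ρ.hasFDerivAt) w)
  have b₁ : (fun s ↦ z' s - (z s + s • V (z s) + (s ^ 2 / 2) • fderiv ℝ V (z s) (V (z s))))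
      =O[𝓝 0] fun s ↦ s ^ 3 := by
    refine IsBigO.of_bound C ?_
    filter_upwards [hz U hU] with s ⟨ζ, h0, h1, h2⟩
    have := (hC ζ s fun t ht ↦ ⟨(h2 t ht).1, (h2 t ht).2, hq _⟩).1
    simpa [h0, h1] using this
  have b₂ : (fun s ↦ q (z' s) - (q (z s) + s • ρ (z s) + (s ^ 2 / 2) • ρ (V (z s))
        + (s ^ 3 / 6) • ρ (fderiv ℝ V (z s) (V (z s))))) =O[𝓝 0] fun s ↦ s ^ 4 := by
    refine IsBigO.of_bound C ?_
    filter_upwards [hz U hU] with s ⟨ζ, h0, h1, h2⟩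
    have := (hC ζ s fun t ht ↦ ⟨(h2 t ht).1, (h2 t ht).2, hq _⟩).2
    simpa [h0, h1] using this
  have c₁ : (fun s ↦ V (z s) - V z₀ - s • L z₁) =O[𝓝 0] fun s ↦ s ^ 2 := by
    have h1 := (isBigO_sub_sub_fderiv (hV.of_le (by norm_num))).comp_tendsto h.tendsto
    have h2 := h1.trans ((h.isBigO_one.norm_left.pow 2))
    have h3 := (L.isBigO_comp (fun s ↦ z s - z₀ - s • z₁) (𝓝 0)).trans h.isBigO_two
    refine (h2.add h3).congr_left fun s ↦ ?_
    simp only [Function.comp, map_sub, map_smul, ← hL]; abel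
  have c₂ : (fun s ↦ fderiv ℝ V (z s) (V (z s)) - L (V z₀)) =O[𝓝 0] fun s ↦ s := by
    have hd : DifferentiableAt ℝ (fun z ↦ fderiv ℝ V z (V z)) z₀ :=
      ((hV.fderiv_right (m := 2) (by norm_num)).clm_apply
        (hV.of_le (by norm_num))).differentiableAt (by norm_num)
    exact (hd.hasFDerivAt.isBigO_sub.comp_tendsto h.tendsto).trans h.isBigO_one
  have s1 : (fun s : ℝ ↦ s) =O[𝓝 0] fun s : ℝ ↦ s := isBigO_refl _ _
  have s2 : (fun s : ℝ ↦ s ^ 2 / 2) =O[𝓝 0] fun s : ℝ ↦ s ^ 2 := by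
    simpa [div_eq_inv_mul] using (isBigO_refl (fun s : ℝ ↦ s ^ 2) (𝓝 0)).const_mul_left (2⁻¹)
  have s3 : (fun s : ℝ ↦ s ^ 3 / 6) =O[𝓝 0] fun s : ℝ ↦ s ^ 3 := by
    simpa [div_eq_inv_mul] using (isBigO_refl (fun s : ℝ ↦ s ^ 3) (𝓝 0)).const_mul_left (6⁻¹)
  refine ⟨?_, ?_⟩
  · have d1 := (s1.smul c₁).congr_right (g₂ := fun s ↦ s ^ 3) fun s ↦ by simp; ring
    have d2 := (s2.smul c₂).congr_right (g₂ := fun s ↦ s ^ 3) fun s ↦ by simp; ring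
    refine (((b₁.add h.isBigO).add d1).add d2).congr_left fun s ↦ ?_
    module
  · have r : ∀ {g : ℝ → N} {k : ℕ}, (g =O[𝓝 0] fun s ↦ s ^ k) →
        (fun s ↦ ρ (g s)) =O[𝓝 0] fun s ↦ s ^ k := fun hg ↦ (ρ.isBigO_comp _ _).trans hg
    have d1 := (s1.smul (r h.isBigO)).congr_right (g₂ := fun s ↦ s ^ 4) fun s ↦ by simp; ring
    have d2 := (s2.smul (r c₁)).congr_right (g₂ := fun s ↦ s ^ 4) fun s ↦ by simp; ring
    have d3 := (s3.smul ((ρ.isBigO_comp _ _).trans c₂)).congr_right (g₂ := fun s ↦ s ^ 4)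
      fun s ↦ by simp; ring
    refine ((((b₂.add h.isBigO_proj).add d1).add d2).add d3).congr_left fun s ↦ ?_
    simp only [map_add, map_sub, map_smul, hq, hqL]
    module

end HasJet

end Taylor

/-! ### Jets of the journeys for an arbitrary torsion-free connection -/

section Frame

set_option linter.unusedSimpArgs false

variable {E : Type*} [NormedAddCommGroup E] [NormedSpace ℝ E]

local instance : NormedAddCommGroup (E →L[ℝ] E →L[ℝ] E) := ContinuousLinearMap.toNormedAddCommGroup

local instance : NormedSpace ℝ (E →L[ℝ] E →L[ℝ] E) := ContinuousLinearMap.toNormedSpace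

/-- The vector field on the space of triples `(x, a, b)` whose integral curves are the geodesics
`x` of the connection `Γ`, with velocity `a` and with a parallel field `b`. -/
def frameField (Γ : E → E →L[ℝ] E →L[ℝ] E) (z : E × E × E) : E × E × E :=
  (z.2.1, -Γ z.1 z.2.1 z.2.1, -Γ z.1 z.2.1 z.2.2)

/-- The curvature tensor of the connection `Γ`. -/
def curvature (Γ : E → E →L[ℝ] E →L[ℝ] E) (x a b c : E) : E :=
  fderiv ℝ Γ x a b c - fderiv ℝ Γ x b a c + Γ x a (Γ x b c) - Γ x b (Γ x a c)

theorem contDiffAt_frameField {Γ : E → E →L[ℝ] E →L[ℝ] E} {z : E × E × E} {n : ℕ∞ω}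
    (hΓ : ContDiffAt ℝ n Γ z.1) : ContDiffAt ℝ n (frameField Γ) z := by
  have h1 : ContDiffAt ℝ n (fun z : E × E × E ↦ Γ z.1) z := hΓ.comp z contDiffAt_fst
  have h2 : ContDiffAt ℝ n (fun z : E × E × E ↦ z.2.1) z := contDiffAt_fst.comp z contDiffAt_snd
  have h3 : ContDiffAt ℝ n (fun z : E × E × E ↦ z.2.2) z := contDiffAt_snd.comp z contDiffAt_snd
  exact h2.prodMk (((h1.clm_apply h2).clm_apply h2).neg.prodMk
    ((h1.clm_apply h2).clm_apply h3).neg)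

theorem fderiv_frameField_apply {Γ : E → E →L[ℝ] E →L[ℝ] E} {z : E × E × E}
    (hΓ : DifferentiableAt ℝ Γ z.1) (w : E × E × E) :
    fderiv ℝ (frameField Γ) z w = (w.2.1,
      -(fderiv ℝ Γ z.1 w.1 z.2.1 z.2.1 + Γ z.1 w.2.1 z.2.1 + Γ z.1 z.2.1 w.2.1),
      -(fderiv ℝ Γ z.1 w.1 z.2.1 z.2.2 + Γ z.1 w.2.1 z.2.2 + Γ z.1 z.2.1 w.2.2)) := by
  have h1 : HasFDerivAt (fun z : E × E × E ↦ Γ z.1)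
      ((fderiv ℝ Γ z.1).comp (ContinuousLinearMap.fst ℝ E (E × E))) z :=
    hΓ.hasFDerivAt.comp z hasFDerivAt_fst
  have h2 : HasFDerivAt (fun z : E × E × E ↦ z.2.1) _ z :=
    (ContinuousLinearMap.fst ℝ E E).hasFDerivAt.comp z
      (ContinuousLinearMap.snd ℝ E (E × E)).hasFDerivAt
  have h3 : HasFDerivAt (fun z : E × E × E ↦ z.2.2) _ z :=
    (ContinuousLinearMap.snd ℝ E E).hasFDerivAt.comp z
      (ContinuousLinearMap.snd ℝ E (E × E)).hasFDerivAt
  have h4 := h2.prodMk (((h1.clm_apply h2).clm_apply h2).neg.prodMk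
    ((h1.clm_apply h2).clm_apply h3).neg)
  rw [HasFDerivAt.fderiv (f := frameField Γ) h4]
  simp
  constructor <;> abel

/-- The states `z' s` are reached from the states `z s` by following the field `V` during the time
`s`, without leaving the neighbourhoods of `z₀`. -/
def FlowsTo {N : Type*} [NormedAddCommGroup N] [NormedSpace ℝ N] (V : N → N) (z₀ : N)
    (z z' : ℝ → N) : Prop :=
  ∀ U ∈ 𝓝 z₀, ∀ᶠ s in 𝓝 (0 : ℝ), ∃ ζ : ℝ → N, ζ 0 = z s ∧ ζ s = z' s ∧
      ∀ t ∈ Set.uIcc 0 s, HasDerivAt ζ (V (ζ t)) t ∧ ζ t ∈ U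

/-- The base point of a frame. -/
abbrev basePoint : E × E × E →L[ℝ] E := ContinuousLinearMap.fst ℝ E (E × E)

/-- Turning the frame `(a, b)` to `(b, -a)`. -/
def turnLeft : E × E × E →L[ℝ] E × E × E :=
  (ContinuousLinearMap.fst ℝ E (E × E)).prod
    (((ContinuousLinearMap.snd ℝ E E).comp (ContinuousLinearMap.snd ℝ E (E × E))).prod
      (-(ContinuousLinearMap.fst ℝ E E).comp (ContinuousLinearMap.snd ℝ E (E × E))))

/-- Turning the frame `(a, b)` to `(-b, a)`. -/
def turnRight : E × E × E →L[ℝ] E × E × E :=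
  (ContinuousLinearMap.fst ℝ E (E × E)).prod
    ((-(ContinuousLinearMap.snd ℝ E E).comp (ContinuousLinearMap.snd ℝ E (E × E))).prod
      ((ContinuousLinearMap.fst ℝ E E).comp (ContinuousLinearMap.snd ℝ E (E × E))))

@[simp] theorem turnLeft_apply (x a b : E) : turnLeft (x, a, b) = (x, b, -a) := rfl

@[simp] theorem turnRight_apply (x a b : E) : turnRight (x, a, b) = (x, -b, a) := rfl

/-- Used for the turns: they are linear and fix the base point, so the projected third-order
coefficient is unchanged. -/
theorem HasJet.map {N F : Type*} [NormedAddCommGroup N] [NormedSpace ℝ N]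
    [NormedAddCommGroup F] [NormedSpace ℝ F] {q : N →L[ℝ] F} {z : ℝ → N} {z₀ z₁ z₂ : N} {p₃ : F}
    (h : HasJet q z z₀ z₁ z₂ p₃) (A : N →L[ℝ] N) (hA : ∀ w, q (A w) = q w) :
    HasJet q (fun s ↦ A (z s)) (A z₀) (A z₁) (A z₂) p₃ := by
  refine ⟨?_, by simpa only [hA] using h.isBigO_proj⟩
  simpa using (A.isBigO_comp _ _).trans h.isBigO

/-- The expansion of the state at the end of a leg in terms of the expansion at its start. -/
theorem HasJet.leg {Γ : E → E →L[ℝ] E →L[ℝ] E} {z z' : ℝ → E × E × E}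
    {x a b x₁ a₁ b₁ x₂ a₂ b₂ x₃ : E}
    (h : HasJet basePoint z (x, a, b) (x₁, a₁, b₁) (x₂, a₂, b₂) x₃)
    (hΓ : ContDiffAt ℝ 3 Γ x) (hz : FlowsTo (frameField Γ) (x, a, b) z z')
    {x₁' a₁' b₁' x₂' a₂' b₂' x₃' : E}
    (hx₁ : x₁' = x₁ + a) (ha₁ : a₁' = a₁ - Γ x a a) (hb₁ : b₁' = b₁ - Γ x a b)
    (hx₂ : x₂' = x₂ + a₁ - (1 / 2 : ℝ) • Γ x a a)
    (ha₂ : a₂' = a₂ - (fderiv ℝ Γ x x₁ a a + Γ x a₁ a + Γ x a a₁)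
      - (1 / 2 : ℝ) • (fderiv ℝ Γ x a a a - Γ x (Γ x a a) a - Γ x a (Γ x a a)))
    (hb₂ : b₂' = b₂ - (fderiv ℝ Γ x x₁ a b + Γ x a₁ b + Γ x a b₁)
      - (1 / 2 : ℝ) • (fderiv ℝ Γ x a a b - Γ x (Γ x a a) b - Γ x a (Γ x a b)))
    (hx₃ : x₃' = x₃ + a₂ - (1 / 2 : ℝ) • (fderiv ℝ Γ x x₁ a a + Γ x a₁ a + Γ x a a₁)
      - (1 / 6 : ℝ) • (fderiv ℝ Γ x a a a - Γ x (Γ x a a) a - Γ x a (Γ x a a))) :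
    HasJet basePoint z' (x, a, b) (x₁', a₁', b₁') (x₂', a₂', b₂') x₃' := by
  have hd : DifferentiableAt ℝ Γ x := hΓ.differentiableAt (by norm_num)
  have := h.flow (ρ := (ContinuousLinearMap.fst ℝ E E).comp (ContinuousLinearMap.snd ℝ E (E × E)))
    (contDiffAt_frameField (z := (x, a, b)) hΓ) (fun z ↦ rfl) hz
  rw [fderiv_frameField_apply (z := (x, a, b)) hd,
    fderiv_frameField_apply (z := (x, a, b)) hd] at this
  convert! this using 1
  · simp [frameField, hx₁, ha₁, hb₁, sub_eq_add_neg]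
  · simp only [frameField, Prod.mk_add_mk, Prod.smul_mk, Prod.mk.injEq]
    refine ⟨?_, ?_, ?_⟩
    · rw [hx₂]; module
    · rw [ha₂]; simp only [map_neg, neg_apply]; module
    · rw [hb₂]; simp only [map_neg, neg_apply]; module
  · rw [hx₃]
    simp only [frameField, ContinuousLinearMap.comp_apply, ContinuousLinearMap.coe_fst',
      ContinuousLinearMap.coe_snd', map_neg, neg_apply]
    module

/-- The whole jet is stated, not only the position: the frame coefficients feed the third leg, and
the cubic term of the position is compared with that of the right journey. -/
theorem left_journey_two {Γ : E → E →L[ℝ] E →L[ℝ] E} {x u v : E}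
    (hΓ : ContDiffAt ℝ 3 Γ x) (hs : ∀ a b, Γ x a b = Γ x b a)
    (hs' : ∀ c a b, fderiv ℝ Γ x c a b = fderiv ℝ Γ x c b a)
    {w₁ w₂ : ℝ → E × E × E}
    (h₁ : FlowsTo (frameField Γ) (x, u, v) (fun _ ↦ (x, u, v)) w₁)
    (h₂ : FlowsTo (frameField Γ) (x, v, -u) (fun s ↦ turnLeft (w₁ s)) w₂) :
    HasJet basePoint w₂ (x, v, -u) (u + v, -Γ x u v - Γ x v v, Γ x u u + Γ x u v)
      (-(1/2 : ℝ) • Γ x u u - Γ x u v - (1/2 : ℝ) • Γ x v v,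
        (1/2 : ℝ) • Γ x u (Γ x u v) + (1/2 : ℝ) • Γ x v (Γ x u u) + (2 : ℝ) • Γ x v (Γ x u v) +
        Γ x v (Γ x v v) - (1/2 : ℝ) • fderiv ℝ Γ x u u v - fderiv ℝ Γ x u v v - (1/2 : ℝ) •
        fderiv ℝ Γ x v v v,
        -Γ x u (Γ x u u) - Γ x u (Γ x u v) - (1/2 : ℝ) • Γ x u (Γ x v v) - Γ x v (Γ x u u) -
        (1/2 : ℝ) • Γ x v (Γ x u v) + (1/2 : ℝ) • fderiv ℝ Γ x u u u + fderiv ℝ Γ x u u v + (1/2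
        : ℝ) • fderiv ℝ Γ x v u v)
      ((1/3 : ℝ) • Γ x u (Γ x u u) + (1/2 : ℝ) • Γ x u (Γ x u v) + (1/2 : ℝ) • Γ x v (Γ x u u)
        + Γ x v (Γ x u v) + (1/3 : ℝ) • Γ x v (Γ x v v) - (1/6 : ℝ) • fderiv ℝ Γ x u u u - (1/2
        : ℝ) • fderiv ℝ Γ x u u v - (1/2 : ℝ) • fderiv ℝ Γ x u v v - (1/6 : ℝ) • fderiv ℝ Γ x v
        v v) := by
  -- Torsion-freeness puts every monomial in a normal form, with nested Γ in the second slot and u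
  -- before v; `module` then compares coefficients.
  have sym₁ : Γ x v u = Γ x u v := hs v u
  have sym₂ : ∀ a b, Γ x (Γ x a b) u = Γ x u (Γ x a b) := fun a b ↦ hs _ u
  have sym₃ : ∀ a b, Γ x (Γ x a b) v = Γ x v (Γ x a b) := fun a b ↦ hs _ v
  have sym₄ : ∀ c, fderiv ℝ Γ x c v u = fderiv ℝ Γ x c u v := fun c ↦ hs' c v u
  have j₀ : HasJet basePoint (fun _ ↦ (x, u, v)) (x, u, v) (0, 0, 0) (0, 0, 0) (0 : E) :=
    ⟨by simp [isBigO_zero], by simp [isBigO_zero]⟩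
  have j₁ : HasJet basePoint w₁ (x, u, v) (u, -Γ x u u, -Γ x u v)
      (-(1/2 : ℝ) • Γ x u u,
        Γ x u (Γ x u u) - (1/2 : ℝ) • fderiv ℝ Γ x u u u,
        (1/2 : ℝ) • Γ x u (Γ x u v) + (1/2 : ℝ) • Γ x v (Γ x u u) - (1/2 : ℝ) • fderiv ℝ Γ x u u
        v)
      ((1/3 : ℝ) • Γ x u (Γ x u u) - (1/6 : ℝ) • fderiv ℝ Γ x u u u) := by
    refine j₀.leg hΓ h₁ ?_ ?_ ?_ ?_ ?_ ?_ ?_ <;>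
    · try simp only [map_add, map_sub, map_neg, map_smul, map_zero, add_apply, sub_apply, neg_apply,
        smul_apply, zero_apply, sym₁, sym₂, sym₃, sym₄]
      try module
  have j₁' := j₁.map turnLeft fun _ ↦ rfl
  simp only [turnLeft_apply, neg_neg] at j₁'
  have j₂ : HasJet basePoint w₂ (x, v, -u) (u + v, -Γ x u v - Γ x v v, Γ x u u + Γ x u v)
      (-(1/2 : ℝ) • Γ x u u - Γ x u v - (1/2 : ℝ) • Γ x v v,
        (1/2 : ℝ) • Γ x u (Γ x u v) + (1/2 : ℝ) • Γ x v (Γ x u u) + (2 : ℝ) • Γ x v (Γ x u v) +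
        Γ x v (Γ x v v) - (1/2 : ℝ) • fderiv ℝ Γ x u u v - fderiv ℝ Γ x u v v - (1/2 : ℝ) •
        fderiv ℝ Γ x v v v,
        -Γ x u (Γ x u u) - Γ x u (Γ x u v) - (1/2 : ℝ) • Γ x u (Γ x v v) - Γ x v (Γ x u u) -
        (1/2 : ℝ) • Γ x v (Γ x u v) + (1/2 : ℝ) • fderiv ℝ Γ x u u u + fderiv ℝ Γ x u u v + (1/2
        : ℝ) • fderiv ℝ Γ x v u v)
      ((1/3 : ℝ) • Γ x u (Γ x u u) + (1/2 : ℝ) • Γ x u (Γ x u v) + (1/2 : ℝ) • Γ x v (Γ x u u)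
        + Γ x v (Γ x u v) + (1/3 : ℝ) • Γ x v (Γ x v v) - (1/6 : ℝ) • fderiv ℝ Γ x u u u - (1/2
        : ℝ) • fderiv ℝ Γ x u u v - (1/2 : ℝ) • fderiv ℝ Γ x u v v - (1/6 : ℝ) • fderiv ℝ Γ x v
        v v) := by
    refine j₁'.leg hΓ h₂ ?_ ?_ ?_ ?_ ?_ ?_ ?_ <;>
    · try simp only [map_add, map_sub, map_neg, map_smul, map_zero, add_apply, sub_apply, neg_apply,
        smul_apply, zero_apply, sym₁, sym₂, sym₃, sym₄]
      try module
  exact j₂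

/-- Around the square the first- and second-order displacements cancel, and the cubic remainder is
assembled from the curvature. -/
theorem left_journey_four {Γ : E → E →L[ℝ] E →L[ℝ] E} {x u v : E}
    (hΓ : ContDiffAt ℝ 3 Γ x) (hs : ∀ a b, Γ x a b = Γ x b a)
    (hs' : ∀ c a b, fderiv ℝ Γ x c a b = fderiv ℝ Γ x c b a)
    {w₁ w₂ w₃ w₄ : ℝ → E × E × E}
    (h₁ : FlowsTo (frameField Γ) (x, u, v) (fun _ ↦ (x, u, v)) w₁)
    (h₂ : FlowsTo (frameField Γ) (x, v, -u) (fun s ↦ turnLeft (w₁ s)) w₂)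
    (h₃ : FlowsTo (frameField Γ) (x, -u, -v) (fun s ↦ turnLeft (w₂ s)) w₃)
    (h₄ : FlowsTo (frameField Γ) (x, -v, u) (fun s ↦ turnLeft (w₃ s)) w₄) :
    (fun s ↦ (w₄ s).1 - x
      - s ^ 3 • (1 / 2 : ℝ) • (curvature Γ x u v v + curvature Γ x u v u))
      =O[𝓝 0] fun s ↦ s ^ 4 := by
  have sym₁ : Γ x v u = Γ x u v := hs v u
  have sym₂ : ∀ a b, Γ x (Γ x a b) u = Γ x u (Γ x a b) := fun a b ↦ hs _ u
  have sym₃ : ∀ a b, Γ x (Γ x a b) v = Γ x v (Γ x a b) := fun a b ↦ hs _ v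
  have sym₄ : ∀ c, fderiv ℝ Γ x c v u = fderiv ℝ Γ x c u v := fun c ↦ hs' c v u
  have j₂ := left_journey_two hΓ hs hs' h₁ h₂
  have j₂' := j₂.map turnLeft fun _ ↦ rfl
  simp only [turnLeft_apply, neg_neg] at j₂'
  have j₃ : HasJet basePoint w₃ (x, -u, -v) (v, Γ x u v, Γ x v v)
      (-(1/2 : ℝ) • Γ x v v,
        Γ x u (Γ x u v) - (1/2 : ℝ) • Γ x u (Γ x v v) - Γ x v (Γ x u u) - (1/2 : ℝ) • Γ x v (Γ x
        u v) + fderiv ℝ Γ x u u v - fderiv ℝ Γ x v u u + (1/2 : ℝ) • fderiv ℝ Γ x v u v,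
        Γ x u (Γ x v v) - Γ x v (Γ x u v) - Γ x v (Γ x v v) + fderiv ℝ Γ x u v v - fderiv ℝ Γ x
        v u v + (1/2 : ℝ) • fderiv ℝ Γ x v v v)
      ((1/2 : ℝ) • Γ x u (Γ x u v) - (1/2 : ℝ) • Γ x u (Γ x v v) - (1/2 : ℝ) • Γ x v (Γ x u u)
        + (1/2 : ℝ) • Γ x v (Γ x u v) + (1/3 : ℝ) • Γ x v (Γ x v v) + (1/2 : ℝ) • fderiv ℝ Γ x u
        u v - (1/2 : ℝ) • fderiv ℝ Γ x u v v - (1/2 : ℝ) • fderiv ℝ Γ x v u u + (1/2 : ℝ) •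
        fderiv ℝ Γ x v u v - (1/6 : ℝ) • fderiv ℝ Γ x v v v) := by
    refine j₂'.leg hΓ h₃ ?_ ?_ ?_ ?_ ?_ ?_ ?_ <;>
    · try simp only [map_add, map_sub, map_neg, map_smul, map_zero, add_apply, sub_apply, neg_apply,
        smul_apply, zero_apply, sym₁, sym₂, sym₃, sym₄]
      try module
  have j₃' := j₃.map turnLeft fun _ ↦ rfl
  simp only [turnLeft_apply, neg_neg] at j₃'
  -- The quadratic frame coefficients are R(u, v)v and -R(u, v)u: the frame (-v, u) has been
  -- transported around the loop by the holonomy 1 - s²R(u, v).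
  have j₄ : HasJet basePoint w₄ (x, -v, u) (0, 0, 0)
      (0,
        Γ x u (Γ x v v) - Γ x v (Γ x u v) + fderiv ℝ Γ x u v v - fderiv ℝ Γ x v u v,
        -Γ x u (Γ x u v) + Γ x v (Γ x u u) - fderiv ℝ Γ x u u v + fderiv ℝ Γ x v u u)
      ((1/2 : ℝ) • Γ x u (Γ x u v) + (1/2 : ℝ) • Γ x u (Γ x v v) - (1/2 : ℝ) • Γ x v (Γ x u u)
        - (1/2 : ℝ) • Γ x v (Γ x u v) + (1/2 : ℝ) • fderiv ℝ Γ x u u v + (1/2 : ℝ) • fderiv ℝ Γ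
        x u v v - (1/2 : ℝ) • fderiv ℝ Γ x v u u - (1/2 : ℝ) • fderiv ℝ Γ x v u v) := by
    refine j₃'.leg hΓ h₄ ?_ ?_ ?_ ?_ ?_ ?_ ?_ <;>
    · try simp only [map_add, map_sub, map_neg, map_smul, map_zero, add_apply, sub_apply, neg_apply,
        smul_apply, zero_apply, sym₁, sym₂, sym₃, sym₄]
      try module
  refine j₄.isBigO_proj.congr_left fun s ↦ ?_
  simp only [curvature, sym₁, sym₄, ContinuousLinearMap.coe_fst']
  module

/-- The second vector of the frame is again the left quarter turn of the first, so the journey along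
v starts with the frame (v, -u), and the right turn leads to (u, v). -/
theorem right_journey_two {Γ : E → E →L[ℝ] E →L[ℝ] E} {x u v : E}
    (hΓ : ContDiffAt ℝ 3 Γ x) (hs : ∀ a b, Γ x a b = Γ x b a)
    (hs' : ∀ c a b, fderiv ℝ Γ x c a b = fderiv ℝ Γ x c b a)
    {r₁ r₂ : ℝ → E × E × E}
    (h₁ : FlowsTo (frameField Γ) (x, v, -u) (fun _ ↦ (x, v, -u)) r₁)
    (h₂ : FlowsTo (frameField Γ) (x, u, v) (fun s ↦ turnRight (r₁ s)) r₂) :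
    HasJet basePoint r₂ (x, u, v) (u + v, -Γ x u u - Γ x u v, -Γ x u v - Γ x v v)
      (-(1/2 : ℝ) • Γ x u u - Γ x u v - (1/2 : ℝ) • Γ x v v,
        Γ x u (Γ x u u) + (2 : ℝ) • Γ x u (Γ x u v) + (1/2 : ℝ) • Γ x u (Γ x v v) + (1/2 : ℝ) •
        Γ x v (Γ x u v) - (1/2 : ℝ) • fderiv ℝ Γ x u u u - fderiv ℝ Γ x v u u - (1/2 : ℝ) •
        fderiv ℝ Γ x v u v,
        (1/2 : ℝ) • Γ x u (Γ x u v) + Γ x u (Γ x v v) + (1/2 : ℝ) • Γ x v (Γ x u u) + Γ x v (Γ x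
        u v) + Γ x v (Γ x v v) - (1/2 : ℝ) • fderiv ℝ Γ x u u v - fderiv ℝ Γ x v u v - (1/2 : ℝ)
        • fderiv ℝ Γ x v v v)
      ((1/3 : ℝ) • Γ x u (Γ x u u) + Γ x u (Γ x u v) + (1/2 : ℝ) • Γ x u (Γ x v v) + (1/2 : ℝ)
        • Γ x v (Γ x u v) + (1/3 : ℝ) • Γ x v (Γ x v v) - (1/6 : ℝ) • fderiv ℝ Γ x u u u - (1/2
        : ℝ) • fderiv ℝ Γ x v u u - (1/2 : ℝ) • fderiv ℝ Γ x v u v - (1/6 : ℝ) • fderiv ℝ Γ x v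
        v v) := by
  have sym₁ : Γ x v u = Γ x u v := hs v u
  have sym₂ : ∀ a b, Γ x (Γ x a b) u = Γ x u (Γ x a b) := fun a b ↦ hs _ u
  have sym₃ : ∀ a b, Γ x (Γ x a b) v = Γ x v (Γ x a b) := fun a b ↦ hs _ v
  have sym₄ : ∀ c, fderiv ℝ Γ x c v u = fderiv ℝ Γ x c u v := fun c ↦ hs' c v u
  have j₀ : HasJet basePoint (fun _ ↦ (x, v, -u)) (x, v, -u) (0, 0, 0) (0, 0, 0) (0 : E) :=
    ⟨by simp [isBigO_zero], by simp [isBigO_zero]⟩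
  have j₁ : HasJet basePoint r₁ (x, v, -u) (v, -Γ x v v, Γ x u v)
      (-(1/2 : ℝ) • Γ x v v,
        Γ x v (Γ x v v) - (1/2 : ℝ) • fderiv ℝ Γ x v v v,
        -(1/2 : ℝ) • Γ x u (Γ x v v) - (1/2 : ℝ) • Γ x v (Γ x u v) + (1/2 : ℝ) • fderiv ℝ Γ x v
        u v)
      ((1/3 : ℝ) • Γ x v (Γ x v v) - (1/6 : ℝ) • fderiv ℝ Γ x v v v) := by
    refine j₀.leg hΓ h₁ ?_ ?_ ?_ ?_ ?_ ?_ ?_ <;>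
    · try simp only [map_add, map_sub, map_neg, map_smul, map_zero, add_apply, sub_apply, neg_apply,
        smul_apply, zero_apply, sym₁, sym₂, sym₃, sym₄]
      try module
  have j₁' := j₁.map turnRight fun _ ↦ rfl
  simp only [turnRight_apply, neg_neg] at j₁'
  have j₂ : HasJet basePoint r₂ (x, u, v) (u + v, -Γ x u u - Γ x u v, -Γ x u v - Γ x v v)
      (-(1/2 : ℝ) • Γ x u u - Γ x u v - (1/2 : ℝ) • Γ x v v,
        Γ x u (Γ x u u) + (2 : ℝ) • Γ x u (Γ x u v) + (1/2 : ℝ) • Γ x u (Γ x v v) + (1/2 : ℝ) •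
        Γ x v (Γ x u v) - (1/2 : ℝ) • fderiv ℝ Γ x u u u - fderiv ℝ Γ x v u u - (1/2 : ℝ) •
        fderiv ℝ Γ x v u v,
        (1/2 : ℝ) • Γ x u (Γ x u v) + Γ x u (Γ x v v) + (1/2 : ℝ) • Γ x v (Γ x u u) + Γ x v (Γ x
        u v) + Γ x v (Γ x v v) - (1/2 : ℝ) • fderiv ℝ Γ x u u v - fderiv ℝ Γ x v u v - (1/2 : ℝ)
        • fderiv ℝ Γ x v v v)
      ((1/3 : ℝ) • Γ x u (Γ x u u) + Γ x u (Γ x u v) + (1/2 : ℝ) • Γ x u (Γ x v v) + (1/2 : ℝ)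
        • Γ x v (Γ x u v) + (1/3 : ℝ) • Γ x v (Γ x v v) - (1/6 : ℝ) • fderiv ℝ Γ x u u u - (1/2
        : ℝ) • fderiv ℝ Γ x v u u - (1/2 : ℝ) • fderiv ℝ Γ x v u v - (1/6 : ℝ) • fderiv ℝ Γ x v
        v v) := by
    refine j₁'.leg hΓ h₂ ?_ ?_ ?_ ?_ ?_ ?_ ?_ <;>
    · try simp only [map_add, map_sub, map_neg, map_smul, map_zero, add_apply, sub_apply, neg_apply,
        smul_apply, zero_apply, sym₁, sym₂, sym₃, sym₄]
      try module
  exact j₂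

/-- The two positions have the same jet up to order two, so only the difference of the cubic
coefficients remains, and it is the same curvature expression as for the closed square. -/
theorem two_journeys {Γ : E → E →L[ℝ] E →L[ℝ] E} {x u v : E}
    (hΓ : ContDiffAt ℝ 3 Γ x) (hs : ∀ a b, Γ x a b = Γ x b a)
    (hs' : ∀ c a b, fderiv ℝ Γ x c a b = fderiv ℝ Γ x c b a)
    {w₁ w₂ r₁ r₂ : ℝ → E × E × E}
    (h₁ : FlowsTo (frameField Γ) (x, u, v) (fun _ ↦ (x, u, v)) w₁)
    (h₂ : FlowsTo (frameField Γ) (x, v, -u) (fun s ↦ turnLeft (w₁ s)) w₂)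
    (k₁ : FlowsTo (frameField Γ) (x, v, -u) (fun _ ↦ (x, v, -u)) r₁)
    (k₂ : FlowsTo (frameField Γ) (x, u, v) (fun s ↦ turnRight (r₁ s)) r₂) :
    (fun s ↦ (r₂ s).1 - (w₂ s).1
      - s ^ 3 • (1 / 2 : ℝ) • (curvature Γ x u v v + curvature Γ x u v u))
      =O[𝓝 0] fun s ↦ s ^ 4 := by
  have sym₁ : Γ x v u = Γ x u v := hs v u
  have sym₂ : ∀ a b, Γ x (Γ x a b) u = Γ x u (Γ x a b) := fun a b ↦ hs _ u
  have sym₃ : ∀ a b, Γ x (Γ x a b) v = Γ x v (Γ x a b) := fun a b ↦ hs _ v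
  have sym₄ : ∀ c, fderiv ℝ Γ x c v u = fderiv ℝ Γ x c u v := fun c ↦ hs' c v u
  refine ((right_journey_two hΓ hs hs' k₁ k₂).isBigO_proj.sub
    (left_journey_two hΓ hs hs' h₁ h₂).isBigO_proj).congr_left fun s ↦ ?_
  simp only [curvature, sym₁, sym₄, ContinuousLinearMap.coe_fst']
  module

end Frame

/-! ### Charts, tangent vectors in coordinates, and the metric coefficients -/

section Coordinates

variable {M : Type*} [TopologicalSpace M] [ChartedSpace Plane M]

/-- The derivative of the inverse of the chart around `x`, at the point with coordinates `y`. -/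
def chartFrame (x : M) (y : Plane) : Plane →L[ℝ] Plane :=
  mfderiv 𝓘(ℝ, Plane) (𝓡 2) (extChartAt (𝓡 2) x).symm y

/-- The tangent vector with coordinates `y` in the chart around `x`. -/
def tangentPoint (x : M) (y : Plane × Plane) : TangentBundle (𝓡 2) M :=
  ⟨(extChartAt (𝓡 2) x).symm y.1, chartFrame x y.1 y.2⟩

/-- The change of coordinates from the chart around `x` to the chart around `x'`. -/
def chartChange (x x' : M) (y : Plane) : Plane :=
  extChartAt (𝓡 2) x' ((extChartAt (𝓡 2) x).symm y)

/-- The domain of the change of coordinates. -/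
def changeDomain (x x' : M) : Set Plane :=
  (extChartAt (𝓡 2) x).target ∩ (extChartAt (𝓡 2) x).symm ⁻¹' (extChartAt (𝓡 2) x').source

theorem isOpen_changeDomain (x x' : M) : IsOpen (changeDomain x x') :=
  (continuousOn_extChartAt_symm x).isOpen_inter_preimage (isOpen_extChartAt_target x)
    (isOpen_extChartAt_source x')

theorem chartChange_mem {x x' : M} {y : Plane} (hy : y ∈ changeDomain x x') :
    chartChange x x' y ∈ (extChartAt (𝓡 2) x').target :=
  (extChartAt (𝓡 2) x').map_source hy.2

theorem symm_chartChange {x x' : M} {y : Plane} (hy : y ∈ changeDomain x x') :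
    (extChartAt (𝓡 2) x').symm (chartChange x x' y) = (extChartAt (𝓡 2) x).symm y :=
  (extChartAt (𝓡 2) x').left_inv hy.2

section Smooth

variable [IsManifold (𝓡 2) ∞ M]

theorem contDiffOn_chartChange (x x' : M) :
    ContDiffOn ℝ ∞ (chartChange x x') (changeDomain x x') := by
  rw [← contMDiffOn_iff_contDiffOn]
  have h1 : ContMDiffOn (𝓡 2) 𝓘(ℝ, Plane) ∞ (extChartAt (𝓡 2) x') (chartAt Plane x').source :=
    contMDiffOn_extChartAt
  have h2 : ContMDiffOn 𝓘(ℝ, Plane) (𝓡 2) ∞ (extChartAt (𝓡 2) x).symm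
    (extChartAt (𝓡 2) x).target := contMDiffOn_extChartAt_symm x
  exact h1.comp (h2.mono Set.inter_subset_left) fun y hy ↦ by simpa using hy.2

theorem mdifferentiableAt_symm {x : M} {y : Plane} (hy : y ∈ (extChartAt (𝓡 2) x).target) :
    MDifferentiableAt 𝓘(ℝ, Plane) (𝓡 2) (extChartAt (𝓡 2) x).symm y := by
  have h2 : ContMDiffOn 𝓘(ℝ, Plane) (𝓡 2) ∞ (extChartAt (𝓡 2) x).symm
    (extChartAt (𝓡 2) x).target := contMDiffOn_extChartAt_symm x
  exact (h2.contMDiffAt ((isOpen_extChartAt_target x).mem_nhds hy)).mdifferentiableAt (by simp)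

theorem mdifferentiableAt_chart {x p : M} (hp : p ∈ (extChartAt (𝓡 2) x).source) :
    MDifferentiableAt (𝓡 2) 𝓘(ℝ, Plane) (extChartAt (𝓡 2) x) p := by
  have h2 : ContMDiffOn (𝓡 2) 𝓘(ℝ, Plane) ∞ (extChartAt (𝓡 2) x) (chartAt Plane x).source :=
    contMDiffOn_extChartAt
  exact (h2.contMDiffAt
    ((chartAt Plane x).open_source.mem_nhds (by simpa using hp))).mdifferentiableAt (by simp)

/-- Chain rule for the factorization of one inverse chart through the other. -/
theorem chartFrame_chartChange {x x' : M} {y : Plane} (hy : y ∈ changeDomain x x') (a : Plane) :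
    chartFrame x' (chartChange x x' y) (fderiv ℝ (chartChange x x') y a) = chartFrame x y a := by
  have h1 : MDifferentiableAt 𝓘(ℝ, Plane) 𝓘(ℝ, Plane) (chartChange x x') y :=
    ((contDiffOn_chartChange x x').contDiffAt
      ((isOpen_changeDomain x x').mem_nhds hy)).differentiableAt (by simp) |>.mdifferentiableAt
  have h2 := mdifferentiableAt_symm (chartChange_mem hy)
  have h3 : (extChartAt (𝓡 2) x).symm =ᶠ[𝓝 y]
      (extChartAt (𝓡 2) x').symm ∘ chartChange x x' := by
    filter_upwards [(isOpen_changeDomain x x').mem_nhds hy] with w hw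
    exact (symm_chartChange hw).symm
  have h4 := mfderiv_comp y h2 h1
  have h5 := h3.mfderiv_eq (I := 𝓘(ℝ, Plane)) (I' := 𝓡 2)
  rw [chartFrame, chartFrame]
  have h6 := h5.trans h4
  rw [mfderiv_eq_fderiv] at h6
  exact congr($h6 a).symm

/-- The coordinates of the derivative of the chart. -/
theorem mfderiv_chart_chartFrame {x : M} {y : Plane} (hy : y ∈ (extChartAt (𝓡 2) x).target)
    (a : Plane) :
    (mfderiv (𝓡 2) 𝓘(ℝ, Plane) (extChartAt (𝓡 2) x) ((extChartAt (𝓡 2) x).symm y)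
      (chartFrame x y a) : Plane) = a := by
  have h1 := mdifferentiableAt_symm hy
  have h2 := mdifferentiableAt_chart ((extChartAt (𝓡 2) x).map_target hy)
  have h3 := mfderiv_comp y h2 h1
  have h4 : extChartAt (𝓡 2) x ∘ (extChartAt (𝓡 2) x).symm =ᶠ[𝓝 y] id := by
    filter_upwards [(isOpen_extChartAt_target x).mem_nhds hy] with w hw
    exact (extChartAt (𝓡 2) x).right_inv hw
  have h5 := h4.mfderiv_eq (I := 𝓘(ℝ, Plane)) (I' := 𝓘(ℝ, Plane))
  rw [mfderiv_id] at h5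
  exact congr($(h3.symm.trans h5) a)

theorem chartFrame_injective {x : M} {y : Plane} (hy : y ∈ (extChartAt (𝓡 2) x).target) :
    Function.Injective (chartFrame x y) :=
  Function.LeftInverse.injective (mfderiv_chart_chartFrame hy)

theorem chartFrame_surjective {x : M} {y : Plane} (hy : y ∈ (extChartAt (𝓡 2) x).target) :
    Function.Surjective (chartFrame x y) :=
  (LinearMap.injective_iff_surjective (f := (chartFrame x y : Plane →ₗ[ℝ] Plane))).1
    (chartFrame_injective hy)

theorem fderiv_chartChange_surjective {x x' : M} {y : Plane} (hy : y ∈ changeDomain x x') :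
    Function.Surjective (fderiv ℝ (chartChange x x') y) := by
  intro b
  obtain ⟨a, ha⟩ := chartFrame_surjective hy.1 (chartFrame x' (chartChange x x' y) b)
  refine ⟨a, chartFrame_injective (chartChange_mem hy) ?_⟩
  rw [chartFrame_chartChange hy, ha]

theorem tangentPoint_injOn {x : M} {y y' : Plane × Plane}
    (hy : y.1 ∈ (extChartAt (𝓡 2) x).target) (hy' : y'.1 ∈ (extChartAt (𝓡 2) x).target)
    (h : tangentPoint x y = tangentPoint x y') : y = y' := by
  obtain ⟨y, a⟩ := y
  obtain ⟨y', a'⟩ := y'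
  have h1 : y = y' := (extChartAt (𝓡 2) x).symm.injOn hy hy' congr($(h).proj)
  subst h1
  have h2 : chartFrame x y a = chartFrame x y a' := eq_of_heq (TotalSpace.mk.inj h).2
  rw [chartFrame_injective hy h2]

end Smooth

section Metric

variable [RiemannianBundle (fun x : M ↦ TangentSpace (𝓡 2) x)]

/-- The inner product of the tangent plane at `p`, on the model plane. -/
def fiberInner (p : M) (a b : Plane) : ℝ :=
  inner ℝ (show TangentSpace (𝓡 2) p from a) (show TangentSpace (𝓡 2) p from b)

theorem fiberInner_add_left (p : M) (a a' b : Plane) :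
    fiberInner p (a + a') b = fiberInner p a b + fiberInner p a' b :=
  inner_add_left (𝕜 := ℝ) (E := TangentSpace (𝓡 2) p) a a' b

theorem fiberInner_add_right (p : M) (a b b' : Plane) :
    fiberInner p a (b + b') = fiberInner p a b + fiberInner p a b' :=
  inner_add_right (𝕜 := ℝ) (E := TangentSpace (𝓡 2) p) a b b'

theorem fiberInner_smul_left (p : M) (r : ℝ) (a b : Plane) :
    fiberInner p (r • a) b = r * fiberInner p a b :=
  real_inner_smul_left (F := TangentSpace (𝓡 2) p) a b r

theorem fiberInner_smul_right (p : M) (r : ℝ) (a b : Plane) :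
    fiberInner p a (r • b) = r * fiberInner p a b :=
  real_inner_smul_right (F := TangentSpace (𝓡 2) p) a b r

theorem fiberInner_comm (p : M) (a b : Plane) : fiberInner p a b = fiberInner p b a :=
  real_inner_comm (F := TangentSpace (𝓡 2) p) _ _

theorem fiberInner_self_pos (p : M) {a : Plane} (ha : a ≠ 0) : 0 < fiberInner p a a :=
  real_inner_self_pos (F := TangentSpace (𝓡 2) p).2 ha

theorem metricCoeff_eq (x : M) (i j : Fin 2) (y : Plane) : metricCoeff x i j y =
    fiberInner ((extChartAt (𝓡 2) x).symm y) (chartFrame x y (EuclideanSpace.single i 1))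
      (chartFrame x y (EuclideanSpace.single j 1)) := rfl

/-- The metric in the chart around `x`, as a bilinear form. -/
def metricForm (x : M) (y : Plane) : Plane →L[ℝ] Plane →L[ℝ] ℝ :=
  ∑ i, ∑ j, metricCoeff x i j y • (EuclideanSpace.proj (𝕜 := ℝ) i : Plane →L[ℝ] ℝ).smulRight
    (EuclideanSpace.proj (𝕜 := ℝ) j : Plane →L[ℝ] ℝ)

/-- The Christoffel symbols in the chart around `x`, as a bilinear map. -/
def christoffelForm (x : M) (y : Plane) : Plane →L[ℝ] Plane →L[ℝ] Plane :=
  ∑ i, ∑ j, ∑ k, christoffel x k i j y •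
    (EuclideanSpace.proj (𝕜 := ℝ) i : Plane →L[ℝ] ℝ).smulRight
    ((EuclideanSpace.proj (𝕜 := ℝ) j : Plane →L[ℝ] ℝ).smulRight
      (EuclideanSpace.single k (1 : ℝ) : Plane))

theorem metricForm_eq_sum (x : M) (y a b : Plane) :
    metricForm x y a b = ∑ i, ∑ j, metricCoeff x i j y * (a i * b j) := by
  simp [metricForm]

theorem christoffelForm_apply (x : M) (y a b : Plane) (k : Fin 2) :
    christoffelForm x y a b k = ∑ i, ∑ j, christoffel x k i j y * (a i * b j) := by
  fin_cases k <;> simp [christoffelForm]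

theorem plane_eq (a : Plane) : a = a 0 • EuclideanSpace.single 0 (1 : ℝ)
    + a 1 • EuclideanSpace.single 1 (1 : ℝ) := by
  ext i; fin_cases i <;> simp

theorem metricForm_apply (x : M) (y a b : Plane) : metricForm x y a b =
    fiberInner ((extChartAt (𝓡 2) x).symm y) (chartFrame x y a) (chartFrame x y b) := by
  rw [metricForm_eq_sum]
  conv_rhs => rw [plane_eq a, plane_eq b]
  simp only [map_add, map_smul, fiberInner_add_left, fiberInner_add_right, fiberInner_smul_left,
    fiberInner_smul_right, ← metricCoeff_eq, Fin.sum_univ_two]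
  ring

theorem metricForm_comm (x : M) (y a b : Plane) : metricForm x y a b = metricForm x y b a := by
  rw [metricForm_apply, metricForm_apply, fiberInner_comm]

theorem metricCoeff_comm (x : M) (i j : Fin 2) (y : Plane) :
    metricCoeff x i j y = metricCoeff x j i y := by
  rw [metricCoeff_eq, metricCoeff_eq, fiberInner_comm]

theorem christoffel_comm (x : M) (k i j : Fin 2) (y : Plane) :
    christoffel x k i j y = christoffel x k j i y := by
  have h : metricCoeff x i j = metricCoeff x j i := funext (metricCoeff_comm x i j)
  unfold christoffel
  rw [h]
  congr 1
  refine Finset.sum_congr rfl fun l _ ↦ ?_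
  ring

theorem christoffelForm_comm (x : M) (y a b : Plane) :
    christoffelForm x y a b = christoffelForm x y b a := by
  ext k
  simp only [christoffelForm_apply, Fin.sum_univ_two, christoffel_comm x k 1 0]
  ring

theorem det_metricMatrix (x : M) (y : Plane) : (metricMatrix x y).det =
    metricCoeff x 0 0 y * metricCoeff x 1 1 y - metricCoeff x 0 1 y ^ 2 := by
  rw [Matrix.det_fin_two]
  simp [metricMatrix, metricCoeff_comm x 1 0, sq]

theorem metricCoeff_eq_metricForm (x : M) (i j : Fin 2) (y : Plane) : metricCoeff x i j y =
    metricForm x y (EuclideanSpace.single i 1) (EuclideanSpace.single j 1) := by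
  rw [metricForm_apply, metricCoeff_eq]

variable [IsManifold (𝓡 2) ∞ M]

theorem metricForm_self_pos {x : M} {y a : Plane} (hy : y ∈ (extChartAt (𝓡 2) x).target)
    (ha : a ≠ 0) : 0 < metricForm x y a a := by
  rw [metricForm_apply]
  exact fiberInner_self_pos _ fun h ↦ ha (chartFrame_injective hy (by simpa using h))

theorem metricForm_chartChange {x x' : M} {y : Plane} (hy : y ∈ changeDomain x x') (a b : Plane) :
    metricForm x' (chartChange x x' y) (fderiv ℝ (chartChange x x') y a)
      (fderiv ℝ (chartChange x x') y b) = metricForm x y a b := by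
  rw [metricForm_apply, metricForm_apply, chartFrame_chartChange hy, chartFrame_chartChange hy,
    symm_chartChange hy]

theorem det_metricMatrix_pos {x : M} {y : Plane} (hy : y ∈ (extChartAt (𝓡 2) x).target) :
    0 < (metricMatrix x y).det := by
  rw [det_metricMatrix]
  have h0 : 0 < metricCoeff x 0 0 y := by
    rw [metricCoeff_eq_metricForm]; exact metricForm_self_pos hy (by simp)
  -- This is a multiple of the component of ∂₁ orthogonal to ∂₀; its squared length is g₀₀ · det g.
  set w : Plane := metricCoeff x 0 0 y • EuclideanSpace.single 1 1
    - metricCoeff x 0 1 y • EuclideanSpace.single 0 1 with hw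
  have hw0 : w ≠ 0 := fun h ↦ by
    have := congr($h 1)
    simp [hw] at this
    exact h0.ne' this
  have h1 := metricForm_self_pos hy hw0
  simp only [hw, map_sub, map_smul, sub_apply, smul_apply, ← metricCoeff_eq_metricForm,
    metricCoeff_comm x 1 0, smul_eq_mul] at h1
  nlinarith

variable [IsContMDiffRiemannianBundle (𝓡 2) ∞ Plane (fun x : M ↦ TangentSpace (𝓡 2) x)]

/-- The coordinate fields are smooth as images of constant fields under the tangent map of the
inverse chart, and the inner product of smooth fields is smooth. -/
theorem contDiffOn_metricCoeff (x : M) (i j : Fin 2) :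
    ContDiffOn ℝ ∞ (metricCoeff x i j) (extChartAt (𝓡 2) x).target := by
  rw [← contMDiffOn_iff_contDiffOn]
  have h2 : ContMDiffOn 𝓘(ℝ, Plane) (𝓡 2) ∞ (extChartAt (𝓡 2) x).symm
    (extChartAt (𝓡 2) x).target := contMDiffOn_extChartAt_symm x
  have ho := isOpen_extChartAt_target (I := 𝓡 2) x
  have h3 := h2.contMDiffOn_tangentMapWithin (m := ∞) (by simp) ho.uniqueMDiffOn
  have h4 : ∀ i : Fin 2, ContMDiffOn 𝓘(ℝ, Plane) (𝓡 2).tangent ∞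
      (fun y ↦ (⟨(extChartAt (𝓡 2) x).symm y, coordVec x y i⟩ : TangentBundle (𝓡 2) M))
      (extChartAt (𝓡 2) x).target := by
    intro i
    have h5 : ContMDiff 𝓘(ℝ, Plane) 𝓘(ℝ, Plane).tangent ∞
      (fun y : Plane ↦ (⟨y, EuclideanSpace.single i (1 : ℝ)⟩ : TangentBundle 𝓘(ℝ, Plane) Plane)) :=
      contMDiff_vectorSpace_iff_contDiff.2 contDiff_const
    refine (h3.comp (t := _) h5.contMDiffOn (s := (extChartAt (𝓡 2) x).target)
      (fun y hy ↦ hy)).congr fun y hy ↦ ?_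
    simp only [tangentMapWithin, Function.comp, coordVec]
    rw [mfderivWithin_of_isOpen ho hy]
  exact ContMDiffOn.inner_bundle (h4 i) (h4 j)

end Metric

end Coordinates

/-! ### The Levi-Civita connection: metric compatibility and change of charts -/

section LeviCivita

local instance : NormedAddCommGroup (Plane →L[ℝ] Plane →L[ℝ] Plane) :=
  ContinuousLinearMap.toNormedAddCommGroup

local instance : NormedSpace ℝ (Plane →L[ℝ] Plane →L[ℝ] Plane) :=
  ContinuousLinearMap.toNormedSpace

local instance : NormedAddCommGroup (Plane →L[ℝ] Plane →L[ℝ] ℝ) :=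
  ContinuousLinearMap.toNormedAddCommGroup

local instance : NormedSpace ℝ (Plane →L[ℝ] Plane →L[ℝ] ℝ) :=
  ContinuousLinearMap.toNormedSpace

variable {M : Type*} [TopologicalSpace M] [ChartedSpace Plane M]
  [RiemannianBundle (fun x : M ↦ TangentSpace (𝓡 2) x)]

theorem two_le_infty : (2 : ℕ∞ω) ≤ ∞ := WithTop.coe_le_coe.2 le_top

theorem fderiv_eq_sum_pderiv (f : Plane → ℝ) (y a : Plane) :
    fderiv ℝ f y a = a 0 * pderiv 0 f y + a 1 * pderiv 1 f y := by
  conv_lhs => rw [plane_eq a]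
  simp [pderiv]

variable [IsManifold (𝓡 2) ∞ M]

/-- The Christoffel symbols of the first kind. -/
theorem sum_metricCoeff_mul_christoffel {x : M} {y : Plane}
    (hy : y ∈ (extChartAt (𝓡 2) x).target) (i j l : Fin 2) :
    ∑ k, metricCoeff x l k y * christoffel x k i j y = (1 / 2 : ℝ) *
      (pderiv i (metricCoeff x j l) y + pderiv j (metricCoeff x i l) y
        - pderiv l (metricCoeff x i j) y) := by
  have hM : metricMatrix x y * (metricMatrix x y)⁻¹ = 1 :=
    Matrix.mul_nonsing_inv _ (det_metricMatrix_pos hy).ne'.isUnit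
  have h : ∀ m, metricCoeff x l 0 y * (metricMatrix x y)⁻¹ 0 m
      + metricCoeff x l 1 y * (metricMatrix x y)⁻¹ 1 m = (1 : Matrix (Fin 2) (Fin 2) ℝ) l m := by
    intro m
    rw [← hM, Matrix.mul_apply, Fin.sum_univ_two]
    rfl
  have h0 := h 0
  have h1 := h 1
  simp only [christoffel, Fin.sum_univ_two]
  set A := pderiv i (metricCoeff x j 0) y + pderiv j (metricCoeff x i 0) y
        - pderiv 0 (metricCoeff x i j) y
  set B := pderiv i (metricCoeff x j 1) y + pderiv j (metricCoeff x i 1) y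
        - pderiv 1 (metricCoeff x i j) y
  have : (1 / 2 : ℝ) * ((1 : Matrix (Fin 2) (Fin 2) ℝ) l 0 * A
      + (1 : Matrix (Fin 2) (Fin 2) ℝ) l 1 * B) = (1 / 2 : ℝ) *
      (pderiv i (metricCoeff x j l) y + pderiv j (metricCoeff x i l) y
        - pderiv l (metricCoeff x i j) y) := by
    obtain rfl | rfl : l = 0 ∨ l = 1 := by omega
    all_goals simp [A, B]
  rw [← this, ← h0, ← h1]
  ring

variable
  [IsContMDiffRiemannianBundle (𝓡 2) ∞ Plane (fun x : M ↦ TangentSpace (𝓡 2) x)]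

theorem contDiffOn_pderiv {S : Set Plane} (hS : IsOpen S) {f : Plane → ℝ} (hf : ContDiffOn ℝ ∞ f S)
    (i : Fin 2) : ContDiffOn ℝ ∞ (pderiv i f) S :=
  (hf.fderiv_of_isOpen hS (by simp)).clm_apply contDiffOn_const

theorem contDiffOn_metricForm (x : M) :
    ContDiffOn ℝ ∞ (metricForm x) (extChartAt (𝓡 2) x).target := by
  unfold metricForm
  exact ContDiffOn.sum fun i _ ↦ ContDiffOn.sum fun j _ ↦
    (contDiffOn_metricCoeff x i j).smul contDiffOn_const

theorem contDiffOn_metricMatrix_inv (x : M) (k l : Fin 2) :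
    ContDiffOn ℝ ∞ (fun y ↦ (metricMatrix x y)⁻¹ k l) (extChartAt (𝓡 2) x).target := by
  have h := contDiffOn_metricCoeff (M := M) x
  have hd : ContDiffOn ℝ ∞ (fun y ↦ ((metricMatrix x y).det)⁻¹) (extChartAt (𝓡 2) x).target := by
    refine ContDiffOn.inv ?_ fun y hy ↦ (det_metricMatrix_pos hy).ne'
    simp only [det_metricMatrix]
    exact ((h 0 0).mul (h 1 1)).sub ((h 0 1).pow 2)
  simp only [Matrix.inv_def, Matrix.adjugate_fin_two, Ring.inverse_eq_inv', Matrix.smul_apply,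
    smul_eq_mul]
  refine hd.mul ?_
  fin_cases k <;> fin_cases l
  exacts [h 1 1, (h 0 1).neg, (h 1 0).neg, h 0 0]

theorem contDiffOn_christoffel (x : M) (k i j : Fin 2) :
    ContDiffOn ℝ ∞ (christoffel x k i j) (extChartAt (𝓡 2) x).target := by
  unfold christoffel
  have h := contDiffOn_metricCoeff (M := M) x
  have h' := fun i j l ↦ contDiffOn_pderiv (isOpen_extChartAt_target x) (h i j) l
  exact contDiffOn_const.mul (ContDiffOn.sum fun l _ ↦ (contDiffOn_metricMatrix_inv x k l).mul
    (((h' j l i).add (h' i l j)).sub (h' i j l)))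

theorem contDiffOn_christoffelForm (x : M) :
    ContDiffOn ℝ ∞ (christoffelForm x) (extChartAt (𝓡 2) x).target := by
  unfold christoffelForm
  exact ContDiffOn.sum fun i _ ↦ ContDiffOn.sum fun j _ ↦ ContDiffOn.sum fun k _ ↦
    (contDiffOn_christoffel x k i j).smul contDiffOn_const

variable {x : M} {y : Plane}

theorem differentiableAt_metricCoeff (hy : y ∈ (extChartAt (𝓡 2) x).target) (i j : Fin 2) :
    DifferentiableAt ℝ (metricCoeff x i j) y :=
  ((contDiffOn_metricCoeff x i j).contDiffAt
    ((isOpen_extChartAt_target x).mem_nhds hy)).differentiableAt (by simp)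

theorem contDiffAt_metricForm (hy : y ∈ (extChartAt (𝓡 2) x).target) :
    ContDiffAt ℝ ∞ (metricForm x) y :=
  (contDiffOn_metricForm x).contDiffAt ((isOpen_extChartAt_target x).mem_nhds hy)

theorem differentiableAt_metricForm (hy : y ∈ (extChartAt (𝓡 2) x).target) :
    DifferentiableAt ℝ (metricForm x) y :=
  (contDiffAt_metricForm hy).differentiableAt (by simp)

theorem contDiffAt_christoffelForm (hy : y ∈ (extChartAt (𝓡 2) x).target) :
    ContDiffAt ℝ ∞ (christoffelForm x) y :=
  (contDiffOn_christoffelForm x).contDiffAt ((isOpen_extChartAt_target x).mem_nhds hy)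

theorem differentiableAt_christoffelForm (hy : y ∈ (extChartAt (𝓡 2) x).target) :
    DifferentiableAt ℝ (christoffelForm x) y :=
  (contDiffAt_christoffelForm hy).differentiableAt (by simp)

theorem fderiv_apply_apply {F : Type*} [NormedAddCommGroup F] [NormedSpace ℝ F]
    {B : Plane → Plane →L[ℝ] Plane →L[ℝ] F} (hB : DifferentiableAt ℝ B y) (a b c : Plane) :
    fderiv ℝ (fun z ↦ B z b c) y a = fderiv ℝ B y a b c := by
  have h := (hB.hasFDerivAt.clm_apply (hasFDerivAt_const b y)).clm_apply (hasFDerivAt_const c y)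
  rw [h.fderiv]
  simp

theorem fderiv_metricForm_apply (hy : y ∈ (extChartAt (𝓡 2) x).target) (a b c : Plane) :
    fderiv ℝ (metricForm x) y a b c =
      ∑ i, ∑ j, fderiv ℝ (metricCoeff x i j) y a * (b i * c j) := by
  rw [← fderiv_apply_apply (differentiableAt_metricForm hy)]
  simp only [metricForm_eq_sum]
  have h : HasFDerivAt (fun z ↦ ∑ i, ∑ j, metricCoeff x i j z * (b i * c j))
      (∑ i, ∑ j, (b i * c j) • fderiv ℝ (metricCoeff x i j) y) y :=
    HasFDerivAt.fun_sum fun i _ ↦ HasFDerivAt.fun_sum fun j _ ↦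
      (differentiableAt_metricCoeff hy i j).hasFDerivAt.mul_const _
  rw [h.fderiv]
  simp [mul_comm]

/-- The Levi-Civita connection is compatible with the metric. -/
theorem fderiv_metricForm (hy : y ∈ (extChartAt (𝓡 2) x).target) (a b c : Plane) :
    fderiv ℝ (metricForm x) y a b c = metricForm x y (christoffelForm x y a b) c
      + metricForm x y b (christoffelForm x y a c) := by
  rw [fderiv_metricForm_apply hy]
  simp only [metricForm_eq_sum, christoffelForm_apply, fderiv_eq_sum_pderiv, Fin.sum_univ_two]
  have h := sum_metricCoeff_mul_christoffel hy
  simp only [Fin.sum_univ_two] at h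
  have e : metricCoeff x 1 0 = metricCoeff x 0 1 := funext (metricCoeff_comm x 1 0)
  have e' : ∀ k, christoffel x k 1 0 = christoffel x k 0 1 := fun k ↦
    funext (christoffel_comm x k 1 0)
  have h000 := h 0 0 0
  have h001 := h 0 0 1
  have h010 := h 0 1 0
  have h011 := h 0 1 1
  have h110 := h 1 1 0
  have h111 := h 1 1 1
  simp only [e, e'] at *
  -- With [ij, l] the symbols of the first kind, the right side is [ab, c] + [ac, b]; the weights
  -- are the total coefficients of each [ij, l] in this sum.
  linear_combination (-1) * ((2 * a 0 * b 0 * c 0) * h000 + (a 0 * b 0 * c 1 + a 0 * b 1 * c 0) *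
    h001
    + (a 0 * b 1 * c 0 + a 0 * b 0 * c 1 + 2 * a 1 * b 0 * c 0) * h010
    + (2 * a 0 * b 1 * c 1 + a 1 * b 0 * c 1 + a 1 * b 1 * c 0) * h011
    + (a 1 * b 1 * c 0 + a 1 * b 0 * c 1) * h110 + (2 * a 1 * b 1 * c 1) * h111)

/-- The transformation law of the Christoffel symbols. -/
theorem christoffelForm_chartChange {x x' : M} (hy : y ∈ changeDomain x x') (a b : Plane) :
    fderiv ℝ (fderiv ℝ (chartChange x x')) y a b
      + christoffelForm x' (chartChange x x' y) (fderiv ℝ (chartChange x x') y a)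
        (fderiv ℝ (chartChange x x') y b)
      = fderiv ℝ (chartChange x x') y (christoffelForm x y a b) := by
  set τ := chartChange x x' with hτ
  have hτc : ContDiffAt ℝ ∞ τ y := (contDiffOn_chartChange x x').contDiffAt
    ((isOpen_changeDomain x x').mem_nhds hy)
  have hd : HasFDerivAt τ (fderiv ℝ τ y) y := (hτc.differentiableAt (by simp)).hasFDerivAt
  have hd' : HasFDerivAt (fderiv ℝ τ) (fderiv ℝ (fderiv ℝ τ) y) y :=
    ((hτc.fderiv_right (m := 1)
      (by simpa [one_add_one_eq_two] using two_le_infty)).differentiableAt (by simp)).hasFDerivAt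
  have hs : ∀ a b, fderiv ℝ (fderiv ℝ τ) y a b = fderiv ℝ (fderiv ℝ τ) y b a := fun a b ↦
    (hτc.isSymmSndFDerivAt (by simpa using two_le_infty)).eq a b
  have hy' : τ y ∈ (extChartAt (𝓡 2) x').target := chartChange_mem hy
  -- Derivative of the identity saying that the metric of one chart is the pullback of the metric of
  -- the other.
  have key : ∀ a b c, fderiv ℝ (metricForm x) y a b c =
      fderiv ℝ (metricForm x') (τ y) (fderiv ℝ τ y a) (fderiv ℝ τ y b) (fderiv ℝ τ y c)
      + metricForm x' (τ y) (fderiv ℝ (fderiv ℝ τ) y a b) (fderiv ℝ τ y c)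
      + metricForm x' (τ y) (fderiv ℝ τ y b) (fderiv ℝ (fderiv ℝ τ) y a c) := by
    intro a b c
    rw [← fderiv_apply_apply (differentiableAt_metricForm hy.1)]
    have h1 : HasFDerivAt (fun z ↦ metricForm x' (τ z))
      ((fderiv ℝ (metricForm x') (τ y)).comp (fderiv ℝ τ y)) y :=
      (differentiableAt_metricForm hy').hasFDerivAt.comp y hd
    have h2 := (h1.clm_apply (hd'.clm_apply (hasFDerivAt_const b y))).clm_apply
      (hd'.clm_apply (hasFDerivAt_const c y))
    have h3 : (fun z ↦ metricForm x z b c) =ᶠ[𝓝 y]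
        fun z ↦ metricForm x' (τ z) (fderiv ℝ τ z b) (fderiv ℝ τ z c) := by
      filter_upwards [(isOpen_changeDomain x x').mem_nhds hy] with z hz
      exact (metricForm_chartChange hz b c).symm
    rw [h3.fderiv_eq, h2.fderiv]
    simp
    ring
  -- `d` is the defect of the transformation law and `β` is `d` with its index lowered. Vanishing
  -- torsion makes β symmetric in its first two arguments, compatibility with both metrics makes it
  -- skew in the last two, and a trilinear form with both symmetries is zero.
  set d : Plane → Plane → Plane := fun a b ↦ fderiv ℝ (fderiv ℝ τ) y a b
      + christoffelForm x' (τ y) (fderiv ℝ τ y a) (fderiv ℝ τ y b)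
      - fderiv ℝ τ y (christoffelForm x y a b) with hd
  set β : Plane → Plane → Plane → ℝ := fun a b c ↦ metricForm x' (τ y) (d a b) (fderiv ℝ τ y c)
    with hβ
  have β₁ : ∀ a b c, β a b c = β b a c := by
    intro a b c
    simp only [hβ, hd]
    rw [hs, christoffelForm_comm x', christoffelForm_comm x]
  have β₂ : ∀ a b c, β a b c = -β a c b := by
    intro a b c
    have h1 := key a b c
    rw [fderiv_metricForm hy.1, fderiv_metricForm hy'] at h1
    rw [← metricForm_chartChange hy, ← metricForm_chartChange hy] at h1
    simp only [hβ, hd, map_add, map_sub, add_apply, sub_apply]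
    rw [metricForm_comm x' (τ y) (fderiv ℝ (fderiv ℝ τ) y a c),
      metricForm_comm x' (τ y) (christoffelForm x' (τ y) (fderiv ℝ τ y a) (fderiv ℝ τ y c)),
      metricForm_comm x' (τ y) (fderiv ℝ τ y (christoffelForm x y a c))]
    linarith
  have β₀ : ∀ a b c, β a b c = 0 := by
    intro a b c
    have h1 := β₂ a b c
    have h2 := β₁ a c b
    have h3 := β₂ c a b
    have h4 := β₁ c b a
    have h5 := β₂ b c a
    have h6 := β₁ b a c
    linarith
  by_contra hne
  have hd0 : d a b ≠ 0 := fun h ↦ hne (sub_eq_zero.1 h)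
  -- The last argument of β ranges over images of the derivative of the chart change, hence may be
  -- chosen so that β is the squared length of the defect.
  obtain ⟨c, hc⟩ := fderiv_chartChange_surjective hy (d a b)
  have h1 := β₀ a b c
  simp only [hβ] at h1
  rw [← hτ] at hc
  rw [hc] at h1
  exact (metricForm_self_pos hy' hd0).ne' h1

end LeviCivita

/-! ### Symmetries of the curvature in dimension two -/

section GaussCurvature

local instance : NormedAddCommGroup (Plane →L[ℝ] Plane →L[ℝ] Plane) :=
  ContinuousLinearMap.toNormedAddCommGroup

local instance : NormedSpace ℝ (Plane →L[ℝ] Plane →L[ℝ] Plane) :=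
  ContinuousLinearMap.toNormedSpace

local instance : NormedAddCommGroup (Plane →L[ℝ] Plane →L[ℝ] ℝ) :=
  ContinuousLinearMap.toNormedAddCommGroup

local instance : NormedSpace ℝ (Plane →L[ℝ] Plane →L[ℝ] ℝ) :=
  ContinuousLinearMap.toNormedSpace

variable {M : Type*} [TopologicalSpace M] [ChartedSpace Plane M]
  [RiemannianBundle (fun x : M ↦ TangentSpace (𝓡 2) x)] {x : M} {y : Plane}

/-- R is alternating in its first two arguments, so in the plane it depends on u and v only through
their coordinate determinant. -/
theorem curvature_eq_smul (u v c : Plane) : curvature (christoffelForm x) y u v c =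
    (u 0 * v 1 - u 1 * v 0) • curvature (christoffelForm x) y (EuclideanSpace.single 0 1)
      (EuclideanSpace.single 1 1) c := by
  conv_lhs => rw [plane_eq u, plane_eq v]
  simp only [curvature, map_add, map_smul, add_apply, smul_apply]
  module

theorem gram_det (u v : Plane) : metricForm x y u u * metricForm x y v v - metricForm x y u v ^ 2
    = (u 0 * v 1 - u 1 * v 0) ^ 2 * (metricMatrix x y).det := by
  rw [det_metricMatrix]
  simp only [metricForm_eq_sum, Fin.sum_univ_two, metricCoeff_comm x 1 0]
  ring

variable [IsManifold (𝓡 2) ∞ M]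

/-- A nonzero Gram determinant makes u, v a basis, and a vector orthogonal to a basis vanishes. -/
theorem eq_zero_of_metricForm_eq_zero (hy : y ∈ (extChartAt (𝓡 2) x).target) {u v w : Plane}
    (huv : metricForm x y u u * metricForm x y v v - metricForm x y u v ^ 2 ≠ 0)
    (h1 : metricForm x y w u = 0) (h2 : metricForm x y w v = 0) : w = 0 := by
  rw [gram_det] at huv
  have hd : u 0 * v 1 - u 1 * v 0 ≠ 0 := fun h0 ↦ huv (by rw [h0]; simp)
  by_contra hw
  refine (metricForm_self_pos hy hw).ne' ?_
  -- Cramer's rule for `w` in the basis u, v, multiplied by the determinant.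
  have hw' : (u 0 * v 1 - u 1 * v 0) • w =
      (w 0 * v 1 - w 1 * v 0) • u + (u 0 * w 1 - u 1 * w 0) • v := by
    ext i
    obtain rfl | rfl : i = 0 ∨ i = 1 := by omega
    all_goals simp; ring
  have h3 := congr(metricForm x y w $hw')
  simp only [map_add, map_smul, smul_eq_mul, h1, h2, mul_zero, add_zero] at h3
  exact (mul_eq_zero.1 h3).resolve_left hd

variable [IsContMDiffRiemannianBundle (𝓡 2) ∞ Plane (fun x : M ↦ TangentSpace (𝓡 2) x)]

theorem fderiv_christoffelForm_comm (hy : y ∈ (extChartAt (𝓡 2) x).target) (c a b : Plane) :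
    fderiv ℝ (christoffelForm x) y c a b = fderiv ℝ (christoffelForm x) y c b a := by
  rw [← fderiv_apply_apply (differentiableAt_christoffelForm hy),
    ← fderiv_apply_apply (differentiableAt_christoffelForm hy)]
  simp only [christoffelForm_comm x _ a b]

/-- The curvature operators of the Levi-Civita connection are skew. -/
theorem metricForm_curvature_self (hy : y ∈ (extChartAt (𝓡 2) x).target) (a b c : Plane) :
    metricForm x y (curvature (christoffelForm x) y a b c) c = 0 := by
  set H : Plane → ℝ := fun z ↦ metricForm x z c c with hH
  have hHc : ContDiffAt ℝ ∞ H y :=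
    ((contDiffAt_metricForm hy).clm_apply contDiffAt_const).clm_apply contDiffAt_const
  have hs := (hHc.isSymmSndFDerivAt (by simpa using two_le_infty)).eq a b
  have hd' : HasFDerivAt (fderiv ℝ H) (fderiv ℝ (fderiv ℝ H) y) y :=
    ((hHc.fderiv_right (m := 1) (by simpa [one_add_one_eq_two] using two_le_infty)).differentiableAt
      (by simp)).hasFDerivAt
  -- Second derivatives of z ↦ g_z(c, c) for a constant vector c. The last term is symmetric in a
  -- and b, so equality of mixed derivatives leaves g(R(a, b)c, c) = 0.
  have key : ∀ a b, fderiv ℝ (fderiv ℝ H) y a b =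
      2 * (metricForm x y (fderiv ℝ (christoffelForm x) y a b c) c
        + metricForm x y (christoffelForm x y a (christoffelForm x y b c)) c
        + metricForm x y (christoffelForm x y b c) (christoffelForm x y a c)) := by
    intro a b
    have h1 : (fun z ↦ fderiv ℝ H z b) =ᶠ[𝓝 y]
        fun z ↦ 2 * metricForm x z (christoffelForm x z b c) c := by
      filter_upwards [(isOpen_extChartAt_target x).mem_nhds hy] with z hz
      rw [hH, fderiv_apply_apply (differentiableAt_metricForm hz), fderiv_metricForm hz,
        metricForm_comm x z c]
      ring
    have h2 := (hd'.clm_apply (hasFDerivAt_const b y)).fderiv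
    have h3 := ((differentiableAt_metricForm hy).hasFDerivAt.clm_apply
      (((differentiableAt_christoffelForm hy).hasFDerivAt.clm_apply
        (hasFDerivAt_const b y)).clm_apply (hasFDerivAt_const c y))).clm_apply
        (hasFDerivAt_const c y)
    have h4 := (h3.const_mul 2).fderiv
    rw [← h1.fderiv_eq, h2] at h4
    have h5 := congr($h4 a)
    simp [fderiv_metricForm hy] at h5
    rw [h5]
    ring
  rw [key, key] at hs
  simp only [curvature, map_add, map_sub, add_apply, sub_apply]
  rw [metricForm_comm x y (christoffelForm x y b c) (christoffelForm x y a c)] at hs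
  linarith

/-- Polarization of `metricForm_curvature_self`. -/
theorem metricForm_curvature_skew (hy : y ∈ (extChartAt (𝓡 2) x).target) (a b c d : Plane) :
    metricForm x y (curvature (christoffelForm x) y a b c) d
      = -metricForm x y (curvature (christoffelForm x) y a b d) c := by
  have h1 := metricForm_curvature_self hy a b (c + d)
  have h2 := metricForm_curvature_self hy a b c
  have h3 := metricForm_curvature_self hy a b d
  have h4 : curvature (christoffelForm x) y a b (c + d) = curvature (christoffelForm x) y a b c
      + curvature (christoffelForm x) y a b d := by
    simp only [curvature, map_add]
    abel
  rw [h4] at h1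
  simp only [map_add, add_apply] at h1
  linarith

theorem curvature_single (hy : y ∈ (extChartAt (𝓡 2) x).target) (i j k l : Fin 2) :
    curvature (christoffelForm x) y (EuclideanSpace.single i 1) (EuclideanSpace.single j 1)
      (EuclideanSpace.single k 1) l = curvatureCoeff x l k i j y := by
  have h0 : ∀ (z : Plane) (i j l : Fin 2), christoffelForm x z (EuclideanSpace.single i 1)
      (EuclideanSpace.single j 1) l = christoffel x l i j z := by
    intro z i j l
    rw [christoffelForm_apply]
    fin_cases i <;> fin_cases j <;> simp
  have h1 : ∀ (i j k l : Fin 2), fderiv ℝ (christoffelForm x) y (EuclideanSpace.single i 1)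
      (EuclideanSpace.single j 1) (EuclideanSpace.single k 1) l
      = pderiv i (christoffel x l j k) y := by
    intro i j k l
    rw [← fderiv_apply_apply (differentiableAt_christoffelForm hy), pderiv]
    have h2 : DifferentiableAt ℝ (fun z ↦ christoffelForm x z (EuclideanSpace.single j 1)
      (EuclideanSpace.single k 1)) y :=
      ((differentiableAt_christoffelForm hy).clm_apply (differentiableAt_const _)).clm_apply
        (differentiableAt_const _)
    have h3 := ((EuclideanSpace.proj (𝕜 := ℝ) l : Plane →L[ℝ] ℝ).hasFDerivAt.comp y
      h2.hasFDerivAt).fderiv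
    have h4 : (fun z ↦ christoffelForm x z (EuclideanSpace.single j 1)
      (EuclideanSpace.single k 1) l) = christoffel x l j k := funext fun z ↦ h0 z j k l
    rw [← h4]
    exact congr($h3 (EuclideanSpace.single i 1)).symm
  have h5 : ∀ (i j k l : Fin 2), christoffelForm x y (EuclideanSpace.single i 1)
      (christoffelForm x y (EuclideanSpace.single j 1) (EuclideanSpace.single k 1)) l
      = ∑ m, christoffel x l i m y * christoffel x m j k y := by
    intro i j k l
    rw [christoffelForm_apply]
    simp only [h0, Fin.sum_univ_two]
    fin_cases i <;> simp
  simp only [curvature, PiLp.add_apply, PiLp.sub_apply, h1, h5, curvatureCoeff,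
    Finset.sum_sub_distrib]
  ring

/-- The determinant appears squared: one factor comes from R(u, v), the other from g(R(∂₀, ∂₁)·, ·),
which is itself an alternating form on a plane. -/
theorem metricForm_curvature (hy : y ∈ (extChartAt (𝓡 2) x).target) (u v : Plane) :
    metricForm x y (curvature (christoffelForm x) y u v v) u = (u 0 * v 1 - u 1 * v 0) ^ 2 *
      ∑ l, metricCoeff x 0 l y * curvatureCoeff x l 1 0 1 y := by
  set R : Plane → Plane := curvature (christoffelForm x) y (EuclideanSpace.single 0 1)
    (EuclideanSpace.single 1 1) with hR
  have h1 : ∑ l, metricCoeff x 0 l y * curvatureCoeff x l 1 0 1 y =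
      metricForm x y (R (EuclideanSpace.single 1 1)) (EuclideanSpace.single 0 1) := by
    rw [metricForm_eq_sum]
    simp only [Fin.sum_univ_two, ← curvature_single hy, ← hR, metricCoeff_comm x 1 0]
    simp
  rw [curvature_eq_smul, ← hR, h1]
  have h2 : R v = v 0 • R (EuclideanSpace.single 0 1) + v 1 • R (EuclideanSpace.single 1 1) := by
    conv_lhs => rw [plane_eq v]
    simp only [hR, curvature, map_add, map_smul]
    module
  have h3 := metricForm_curvature_self hy (EuclideanSpace.single 0 1) (EuclideanSpace.single 1 1)
    (EuclideanSpace.single 0 1)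
  have h4 := metricForm_curvature_self hy (EuclideanSpace.single 0 1) (EuclideanSpace.single 1 1)
    (EuclideanSpace.single 1 1)
  have h5 := metricForm_curvature_skew hy (EuclideanSpace.single 0 1) (EuclideanSpace.single 1 1)
    (EuclideanSpace.single 0 1) (EuclideanSpace.single 1 1)
  rw [← hR] at h3 h4 h5
  rw [h2]
  conv_lhs => enter [2]; rw [plane_eq u]
  simp only [map_add, map_smul, add_apply, smul_apply, smul_eq_mul, h3, h4, h5]
  ring

/-- By skewness R(u, v)v is orthogonal to v and R(u, v)u to u, so each is fixed by one remaining
component. That component is ±κ, because for an orthonormal pair the Gram determinant 1 equals the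
squared coordinate determinant times det g. -/
theorem curvature_orthonormal (p : M) {u v : Plane}
    (hu : metricForm p (extChartAt (𝓡 2) p p) u u = 1)
    (hv : metricForm p (extChartAt (𝓡 2) p p) v v = 1)
    (huv : metricForm p (extChartAt (𝓡 2) p p) u v = 0) :
    (1 / 2 : ℝ) • (curvature (christoffelForm p) (extChartAt (𝓡 2) p p) u v v
      + curvature (christoffelForm p) (extChartAt (𝓡 2) p p) u v u)
      = (gaussCurvature p / 2) • (u - v) := by
  set y := extChartAt (𝓡 2) p p with hy'
  have hy : y ∈ (extChartAt (𝓡 2) p).target := mem_extChartAt_target p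
  have h := gram_det (x := p) (y := y) u v
  rw [hu, hv, huv] at h
  have hK : metricForm p y (curvature (christoffelForm p) y u v v) u = gaussCurvature p := by
    rw [metricForm_curvature hy, gaussCurvature, ← hy', eq_div_iff (det_metricMatrix_pos hy).ne']
    linear_combination (-(∑ l, metricCoeff p 0 l y * curvatureCoeff p l 1 0 1 y)) * h
  have e1 := metricForm_curvature_self hy u v u
  have e2 := metricForm_curvature_self hy u v v
  have e3 := metricForm_curvature_skew hy u v u v
  rw [hK] at e3
  have hg : metricForm p y u u * metricForm p y v v - metricForm p y u v ^ 2 ≠ 0 := by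
    simp [hu, hv, huv]
  have hvu : metricForm p y v u = 0 := by rw [metricForm_comm, huv]
  have k1 : curvature (christoffelForm p) y u v v - gaussCurvature p • u = 0 := by
    refine eq_zero_of_metricForm_eq_zero hy hg ?_ ?_
    · simp [hK, hu]
    · simp [e2, huv]
  have k2 : curvature (christoffelForm p) y u v u + gaussCurvature p • v = 0 := by
    refine eq_zero_of_metricForm_eq_zero hy hg ?_ ?_
    · simp [e1, hvu]
    · simp [e3, hv]
  rw [sub_eq_zero.1 k1, eq_neg_of_add_eq_zero_left k2]
  module

end GaussCurvature

/-! ### Existence and uniqueness of short geodesics -/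

section Geodesics

/-- The flow of Picard–Lindelöf is jointly continuous in starting point and time, which gives one δ
for all nearby starting points and confines the curves to `U`. -/
theorem exists_local_flow {N : Type*} [NormedAddCommGroup N] [NormedSpace ℝ N] [CompleteSpace N]
    {V : N → N} {z₀ : N} (hV : ContDiffAt ℝ 1 V z₀) {U : Set N} (hU : U ∈ 𝓝 z₀) :
    ∃ δ > (0 : ℝ), ∀ z ∈ Metric.ball z₀ δ, ∃ α : ℝ → N, α 0 = z ∧
      ∀ t ∈ Set.Ioo (-δ) δ, HasDerivAt α (V (α t)) t ∧ α t ∈ U := by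
  obtain ⟨ε, hε, a, r, L, K, hr, hpl⟩ := IsPicardLindelof.of_contDiffAt_one hV
  obtain ⟨α, hα, hc⟩ := (hpl 0).exists_forall_mem_closedBall_eq_hasDerivWithinAt_continuousOn
  have hr' : (0 : ℝ) < r := hr
  have h0 : ContinuousAt α (z₀, 0) := hc.continuousAt
    (prod_mem_nhds (Metric.closedBall_mem_nhds z₀ hr') (Icc_mem_nhds (by linarith) (by linarith)))
  have h1 : α ⁻¹' U ∈ 𝓝 (z₀, (0 : ℝ)) := h0.preimage_mem_nhds (by
    rwa [(hα z₀ (Metric.mem_closedBall_self hr'.le)).1])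
  obtain ⟨δ, hδ, hball⟩ := Metric.mem_nhds_iff.1 h1
  -- δ keeps the curve in `U`, ε bounds the time of existence, and r bounds the set of admissible
  -- starting points.
  refine ⟨min δ (min ε r), by positivity, fun z hz ↦ ⟨fun t ↦ α (z, t), ?_, fun t ht ↦ ⟨?_, ?_⟩⟩⟩
  · refine (hα z (Metric.ball_subset_closedBall (Metric.ball_subset_ball ?_ hz))).1
    exact (min_le_right _ _).trans (min_le_right _ _)
  · have hz' : z ∈ Metric.closedBall z₀ r := Metric.ball_subset_closedBall
      (Metric.ball_subset_ball ((min_le_right _ _).trans (min_le_right _ _)) hz)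
    have ht' : |t| < ε := (abs_lt.2 ht).trans_le ((min_le_right _ _).trans (min_le_left _ _))
    rw [abs_lt] at ht'
    exact ((hα z hz').2 t ⟨by linarith [ht'.1], by linarith [ht'.2]⟩).hasDerivAt
      (Icc_mem_nhds (by linarith [ht'.1]) (by linarith [ht'.2]))
  · refine hball ?_
    rw [Metric.mem_ball, Prod.dist_eq, max_lt_iff]
    refine ⟨(Metric.mem_ball.1 hz).trans_le (min_le_left _ _), ?_⟩
    simpa using (abs_lt.2 ht).trans_le (min_le_left _ _)

variable {M : Type*} [TopologicalSpace M] [ChartedSpace Plane M]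

theorem velocity_symm [IsManifold (𝓡 2) ∞ M] {x : M} {c : ℝ → Plane} {c' : Plane} {t : ℝ}
    (hc : HasDerivAt c c' t) (ht : c t ∈ (extChartAt (𝓡 2) x).target) :
    velocity (fun τ ↦ (extChartAt (𝓡 2) x).symm (c τ)) t = tangentPoint x (c t, c') := by
  have h1 := mdifferentiableAt_symm ht
  have h2 : MDifferentiableAt 𝓘(ℝ, ℝ) 𝓘(ℝ, Plane) c t :=
    hc.differentiableAt.mdifferentiableAt
  have h3 := mfderiv_comp t h1 h2
  have h4 : mfderiv 𝓘(ℝ, ℝ) (𝓡 2) (fun τ ↦ (extChartAt (𝓡 2) x).symm (c τ)) t (1 : ℝ)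
      = chartFrame x (c t) c' := by
    refine (congr($h3 (1 : ℝ))).trans ?_
    have h5 : mfderiv 𝓘(ℝ, ℝ) 𝓘(ℝ, Plane) c t (1 : ℝ) = c' := by
      rw [mfderiv_eq_fderiv]
      exact (fderiv_apply_one_eq_deriv (f := c)).trans hc.deriv
    exact congr(chartFrame x (c t) $h5)
  simp only [velocity, tangentPoint]
  rw [h4]

variable [RiemannianBundle (fun x : M ↦ TangentSpace (𝓡 2) x)]

/-- The geodesic spray in the chart around `x`. -/
def sprayField (x : M) (z : Plane × Plane) : Plane × Plane :=
  (z.2, -christoffelForm x z.1 z.2 z.2)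

variable [IsManifold (𝓡 2) ∞ M]

/-- A curve in the surface, with its velocity, in the chart around `x`. -/
def chartLift (x : M) (γ : ℝ → M) (t : ℝ) : Plane × Plane :=
  (extChartAt (𝓡 2) x (γ t), deriv (fun τ ↦ extChartAt (𝓡 2) x (γ τ)) t)

/-- The second-order geodesic equation, written in one chart as the first-order system of the spray.
-/
theorem IsGeodesicOn.hasDerivAt_chartLift {x : M} {γ : ℝ → M} {J : Set ℝ}
    (h : IsGeodesicOn γ J) (hJ : IsOpen J) {t : ℝ} (ht : t ∈ J)
    (hx : γ t ∈ (extChartAt (𝓡 2) x).source) :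
    HasDerivAt (chartLift x γ) (sprayField x (chartLift x γ t)) t ∧
      velocity γ t = tangentPoint x (chartLift x γ t) := by
  set c : ℝ → Plane := fun τ ↦ extChartAt (𝓡 2) x (γ τ) with hc
  have hγ : ContMDiffAt 𝓘(ℝ, ℝ) (𝓡 2) 2 γ t := h.1.contMDiffAt (hJ.mem_nhds ht)
  have hφ : ContMDiffOn (𝓡 2) 𝓘(ℝ, Plane) ∞ (extChartAt (𝓡 2) x) (chartAt Plane x).source :=
    contMDiffOn_extChartAt
  have hcc : ContDiffAt ℝ 2 c t := by
    rw [← contMDiffAt_iff_contDiffAt]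
    exact ((hφ.contMDiffAt ((chartAt Plane x).open_source.mem_nhds (by simpa using hx))).of_le
      two_le_infty).comp t hγ
  have hd : DifferentiableAt ℝ (deriv c) t := by
    have := (hcc.fderiv_right (m := 1) (by norm_num)).clm_apply
      (contDiffAt_const (c := (1 : ℝ)))
    exact this.differentiableAt (by simp)
  have hev : ∀ᶠ τ in 𝓝 t, DifferentiableAt ℝ c τ := by
    filter_upwards [hcc.eventually (by simp)] with τ hτ using hτ.differentiableAt (by simp)
  have comp : ∀ {f : ℝ → Plane} {f' : Plane} {τ : ℝ} (i : Fin 2), HasDerivAt f f' τ →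
      HasDerivAt (fun τ ↦ f τ i) (f' i) τ := fun i hf ↦
    (EuclideanSpace.proj (𝕜 := ℝ) i : Plane →L[ℝ] ℝ).hasFDerivAt.comp_hasDerivAt _ hf
  have hdd : deriv (deriv c) t = -christoffelForm x (c t) (deriv c t) (deriv c t) := by
    ext k
    have e1 := h.2 t ht x (by simpa using hx) k
    have e2 : (deriv fun τ ↦ extChartAt (𝓡 2) x (γ τ) k) =ᶠ[𝓝 t] fun τ ↦ deriv c τ k := by
      filter_upwards [hev] with τ hτ
      exact (comp k hτ.hasDerivAt).deriv
    have e3 : ∀ i, deriv (fun τ ↦ extChartAt (𝓡 2) x (γ τ) i) t = deriv c t i := fun i ↦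
      (comp i hev.self_of_nhds.hasDerivAt).deriv
    rw [e2.deriv_eq, (comp k hd.hasDerivAt).deriv] at e1
    rw [e1]
    simp only [e3, PiLp.neg_apply, christoffelForm_apply, mul_assoc, hc]
  refine ⟨?_, ?_⟩
  · have := hev.self_of_nhds.hasDerivAt.prodMk hd.hasDerivAt
    rw [hdd] at this
    exact this
  · have e1 : γ =ᶠ[𝓝 t] fun τ ↦ (extChartAt (𝓡 2) x).symm (c τ) := by
      filter_upwards [hγ.continuousAt.preimage_mem_nhds
        ((isOpen_extChartAt_source x).mem_nhds hx)] with τ hτ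
      exact ((extChartAt (𝓡 2) x).left_inv hτ).symm
    have e2 := velocity_symm (x := x) hev.self_of_nhds.hasDerivAt
      ((extChartAt (𝓡 2) x).map_source hx)
    refine Eq.trans ?_ e2
    have e3 := e1.mfderiv_eq (I := 𝓘(ℝ, ℝ)) (I' := 𝓡 2)
    have e4 := e1.eq_of_nhds
    refine TotalSpace.ext e4 ?_
    exact heq_of_eq congr($e3 (1 : ℝ))

variable
  [IsContMDiffRiemannianBundle (𝓡 2) ∞ Plane (fun x : M ↦ TangentSpace (𝓡 2) x)]

theorem contDiffAt_sprayField {x : M} {z : Plane × Plane}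
    (hz : z.1 ∈ (extChartAt (𝓡 2) x).target) : ContDiffAt ℝ ∞ (sprayField x) z := by
  have h1 : ContDiffAt ℝ ∞ (fun z : Plane × Plane ↦ christoffelForm x z.1) z :=
    (contDiffAt_christoffelForm hz).comp z contDiffAt_fst
  exact contDiffAt_snd.prodMk ((h1.clm_apply contDiffAt_snd).clm_apply contDiffAt_snd).neg

/-- `α` solves the geodesic equation in the chart around `x`, on the open set `J`. -/
def IsSprayCurveOn (x : M) (α : ℝ → Plane × Plane) (J : Set ℝ) : Prop :=
  ∀ t ∈ J, HasDerivAt α (sprayField x (α t)) t ∧ (α t).1 ∈ (extChartAt (𝓡 2) x).target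

/-- Bootstrapping: the derivative of the velocity is a continuous function of the state, so the
velocity is C¹ and the position C². -/
theorem IsSprayCurveOn.contDiffOn_fst {x : M} {α : ℝ → Plane × Plane} {J : Set ℝ}
    (h : IsSprayCurveOn x α J) (hJ : IsOpen J) : ContDiffOn ℝ 2 (fun t ↦ (α t).1) J := by
  have h1 : ∀ t ∈ J, HasDerivAt (fun t ↦ (α t).1) (α t).2 t := fun t ht ↦
    (ContinuousLinearMap.fst ℝ Plane Plane).hasFDerivAt.comp_hasDerivAt t (h t ht).1
  have h2 : ∀ t ∈ J, HasDerivAt (fun t ↦ (α t).2) (sprayField x (α t)).2 t := fun t ht ↦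
    (ContinuousLinearMap.snd ℝ Plane Plane).hasFDerivAt.comp_hasDerivAt t (h t ht).1
  have hc : ContinuousOn α J := fun t ht ↦ (h t ht).1.continuousAt.continuousWithinAt
  have h3 : ContDiffOn ℝ 1 (fun t ↦ (α t).2) J := by
    rw [show (1 : ℕ∞ω) = 0 + 1 by simp, contDiffOn_succ_iff_deriv_of_isOpen hJ]
    refine ⟨fun t ht ↦ (h2 t ht).differentiableAt.differentiableWithinAt, by simp, ?_⟩
    rw [contDiffOn_zero]
    refine ContinuousOn.congr (f := fun t ↦ (sprayField x (α t)).2) ?_ fun t ht ↦ (h2 t ht).deriv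
    intro t ht
    exact (continuousAt_snd.comp (ContinuousAt.comp
      (contDiffAt_sprayField (h t ht).2).continuousAt
      (h t ht).1.continuousAt)).continuousWithinAt
  rw [show (2 : ℕ∞ω) = 1 + 1 by norm_num, contDiffOn_succ_iff_deriv_of_isOpen hJ]
  exact ⟨fun t ht ↦ (h1 t ht).differentiableAt.differentiableWithinAt, by simp,
    h3.congr fun t ht ↦ (h1 t ht).deriv⟩

/-- The equation is solved in a single chart but is required in all charts that the curve meets. The
second derivative of the chart change produces exactly the correction term in
`christoffelForm_chartChange`. -/
theorem IsSprayCurveOn.isGeodesicOn {x : M} {α : ℝ → Plane × Plane} {J : Set ℝ}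
    (h : IsSprayCurveOn x α J) (hJ : IsOpen J) :
    IsGeodesicOn (fun t ↦ (extChartAt (𝓡 2) x).symm (α t).1) J := by
  have h1 : ∀ t ∈ J, HasDerivAt (fun t ↦ (α t).1) (α t).2 t := fun t ht ↦
    (ContinuousLinearMap.fst ℝ Plane Plane).hasFDerivAt.comp_hasDerivAt t (h t ht).1
  have h2 : ∀ t ∈ J, HasDerivAt (fun t ↦ (α t).2) (-christoffelForm x (α t).1 (α t).2 (α t).2) t :=
    fun t ht ↦ (ContinuousLinearMap.snd ℝ Plane Plane).hasFDerivAt.comp_hasDerivAt t (h t ht).1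
  refine ⟨?_, fun t ht x' hx' k ↦ ?_⟩
  · have h3 : ContMDiffOn 𝓘(ℝ, Plane) (𝓡 2) ∞ (extChartAt (𝓡 2) x).symm
      (extChartAt (𝓡 2) x).target := contMDiffOn_extChartAt_symm x
    exact (h3.of_le two_le_infty).comp (h.contDiffOn_fst hJ).contMDiffOn fun t ht ↦ (h t ht).2
  · set χ := chartChange x x' with hχ
    have hdom : (α t).1 ∈ changeDomain x x' := ⟨(h t ht).2, by simpa using hx'⟩
    have hev : ∀ᶠ τ in 𝓝 t, τ ∈ J ∧ (α τ).1 ∈ changeDomain x x' :=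
      (hJ.eventually_mem ht).and ((h1 t ht).continuousAt.preimage_mem_nhds
        ((isOpen_changeDomain x x').mem_nhds hdom))
    have hχc : ∀ y ∈ changeDomain x x', ContDiffAt ℝ ∞ χ y := fun y hy ↦
      (contDiffOn_chartChange x x').contDiffAt ((isOpen_changeDomain x x').mem_nhds hy)
    have d1 : ∀ τ, τ ∈ J → (α τ).1 ∈ changeDomain x x' →
        HasDerivAt (fun τ ↦ χ (α τ).1) (fderiv ℝ χ (α τ).1 (α τ).2) τ := by
      intro τ hτ hτ'
      have e1 : HasFDerivAt χ (fderiv ℝ χ (α τ).1) (α τ).1 :=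
        ((hχc _ hτ').differentiableAt (by simp)).hasFDerivAt
      exact e1.comp_hasDerivAt τ (h1 τ hτ)
    have d2 : HasDerivAt (fun τ ↦ fderiv ℝ χ (α τ).1 (α τ).2)
        (fderiv ℝ (fderiv ℝ χ) (α t).1 (α t).2 (α t).2
          + fderiv ℝ χ (α t).1 (-christoffelForm x (α t).1 (α t).2 (α t).2)) t := by
      have e1 : HasFDerivAt (fderiv ℝ χ) (fderiv ℝ (fderiv ℝ χ) (α t).1) (α t).1 :=
        (((hχc _ hdom).fderiv_right (m := 1)
          (by simpa [one_add_one_eq_two] using two_le_infty)).differentiableAt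
            (by simp)).hasFDerivAt
      have e2 : HasDerivAt (fun τ ↦ fderiv ℝ χ (α τ).1)
        (fderiv ℝ (fderiv ℝ χ) (α t).1 (α t).2) t := e1.comp_hasDerivAt t (h1 t ht)
      exact e2.clm_apply (h2 t ht)
    have comp : ∀ {f : ℝ → Plane} {f' : Plane} {τ : ℝ} (i : Fin 2), HasDerivAt f f' τ →
        HasDerivAt (fun τ ↦ f τ i) (f' i) τ := fun i hf ↦
      (EuclideanSpace.proj (𝕜 := ℝ) i : Plane →L[ℝ] ℝ).hasFDerivAt.comp_hasDerivAt _ hf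
    have d3 : (deriv fun τ ↦ extChartAt (𝓡 2) x' ((extChartAt (𝓡 2) x).symm (α τ).1) k)
        =ᶠ[𝓝 t] fun τ ↦ fderiv ℝ χ (α τ).1 (α τ).2 k := by
      filter_upwards [hev] with τ hτ
      exact (comp k (d1 τ hτ.1 hτ.2)).deriv
    have d4 : ∀ i, deriv (fun τ ↦ extChartAt (𝓡 2) x' ((extChartAt (𝓡 2) x).symm (α τ).1) i) t
        = fderiv ℝ χ (α t).1 (α t).2 i := fun i ↦ (comp i (d1 t ht hdom)).deriv
    rw [d3.deriv_eq, (comp k d2).deriv, map_neg, ← christoffelForm_chartChange hdom]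
    simp only [d4, ← hχ]
    simp only [PiLp.add_apply, PiLp.neg_apply, christoffelForm_apply]
    simp only [hχ, chartChange, neg_add_rev, mul_assoc]
    ring

variable [T2Space M]

/-- An arbitrary geodesic `γ` is not known to stay in the chart, so ODE uniqueness is only local.
The set of times at which the velocities agree is open by that uniqueness and closed in the
interval, so connectedness concludes. -/
theorem IsSprayCurveOn.velocity_eq {x : M} {α : ℝ → Plane × Plane} {J J' : Set ℝ}
    (h : IsSprayCurveOn x α J) (hJ : IsOpen J) {γ : ℝ → M} (hγ : IsGeodesicOn γ J')
    (hJ' : IsOpen J') {s : ℝ} (hs : Set.uIcc 0 s ⊆ J) (hs' : Set.uIcc 0 s ⊆ J')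
    (h0 : velocity γ 0 = tangentPoint x (α 0)) : velocity γ s = tangentPoint x (α s) := by
  set u : Set ℝ := {t | t ∈ J ∧ t ∈ J' ∧ velocity γ t = tangentPoint x (α t)} with hu
  have hsrc : ∀ t ∈ J, γ t = (extChartAt (𝓡 2) x).symm (α t).1 →
      γ t ∈ (extChartAt (𝓡 2) x).source := fun t ht h1 ↦ by
    rw [h1]; exact (extChartAt (𝓡 2) x).map_target (h t ht).2
  have hγc : ∀ t ∈ J', ContinuousAt γ t := fun t ht ↦
    (hγ.1.contMDiffAt (hJ'.mem_nhds ht)).continuousAt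
  have hev : ∀ t ∈ J, t ∈ J' → γ t ∈ (extChartAt (𝓡 2) x).source →
      ∀ᶠ τ in 𝓝 t, τ ∈ J ∧ τ ∈ J' ∧ γ τ ∈ (extChartAt (𝓡 2) x).source := fun t ht ht' hx ↦
    (hJ.eventually_mem ht).and ((hJ'.eventually_mem ht').and
      ((hγc t ht').preimage_mem_nhds ((isOpen_extChartAt_source x).mem_nhds hx)))
  have hlift : ∀ t ∈ J, t ∈ J' → γ t ∈ (extChartAt (𝓡 2) x).source →
      velocity γ t = tangentPoint x (α t) → chartLift x γ t = α t := fun t ht ht' hx hv ↦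
    tangentPoint_injOn (x := x) ((extChartAt (𝓡 2) x).map_source hx) (h t ht).2
      ((hγ.hasDerivAt_chartLift hJ' ht' hx).2.symm.trans hv)
  have huo : IsOpen u := by
    rw [isOpen_iff_mem_nhds]
    rintro t ⟨ht, ht', hv⟩
    have hx := hsrc t ht congr($(hv).proj)
    have heq := hlift t ht ht' hx hv
    obtain ⟨K, S, hS, hK⟩ := ((contDiffAt_sprayField (h t ht).2).of_le
      (m := 1) (by simp)).exists_lipschitzOnWith
    have hc := (hγ.hasDerivAt_chartLift hJ' ht' hx).1.continuousAt
    have e := ODE_solution_unique_of_eventually (v := fun _ ↦ sprayField x) (s := fun _ ↦ S)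
      (K := K) (t₀ := t) (f := chartLift x γ) (g := α) (Eventually.of_forall fun _ ↦ hK)
      (by
        filter_upwards [hev t ht ht' hx, hc.preimage_mem_nhds (by rwa [heq])] with τ h1 h2
        exact ⟨(hγ.hasDerivAt_chartLift hJ' h1.2.1 h1.2.2).1, h2⟩)
      (by
        filter_upwards [hev t ht ht' hx, (h t ht).1.continuousAt.preimage_mem_nhds hS] with τ h1 h2
        exact ⟨(h τ h1.1).1, h2⟩) heq
    filter_upwards [hev t ht ht' hx, e] with τ h1 h2
    exact ⟨h1.1, h1.2.1, by rw [(hγ.hasDerivAt_chartLift hJ' h1.2.1 h1.2.2).2, h2]⟩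
  have hcl : closure u ∩ Set.uIcc 0 s ⊆ u := by
    rintro t ⟨htu, hts⟩
    have ht := hs hts
    have ht' := hs' hts
    rw [mem_closure_iff_frequently] at htu
    -- Hausdorffness is needed here: a limit of times of agreement is again one, and this places `γ
    -- t` in the chart.
    have e1 : γ t = (extChartAt (𝓡 2) x).symm (α t).1 := by
      refine tendsto_nhds_unique_of_frequently_eq (hγc t ht')
        (g := fun τ ↦ (extChartAt (𝓡 2) x).symm (α τ).1)
        (ContinuousAt.comp (f := fun τ ↦ (α τ).1) (g := (extChartAt (𝓡 2) x).symm)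
          ((continuousOn_extChartAt_symm x).continuousAt ((isOpen_extChartAt_target x).mem_nhds
          (h t ht).2)) (h t ht).1.continuousAt.fst) ?_
      exact htu.mono fun τ hτ ↦ congr($(hτ.2.2).proj)
    have hx := hsrc t ht e1
    have e2 : chartLift x γ t = α t := by
      refine tendsto_nhds_unique_of_frequently_eq
        (hγ.hasDerivAt_chartLift hJ' ht' hx).1.continuousAt (h t ht).1.continuousAt ?_
      refine (htu.and_eventually (hev t ht ht' hx)).mono fun τ hτ ↦ ?_
      exact hlift τ hτ.2.1 hτ.2.2.1 hτ.2.2.2 hτ.1.2.2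
    exact ⟨ht, ht', by rw [(hγ.hasDerivAt_chartLift hJ' ht' hx).2, e2]⟩
  have hsub := isPreconnected_uIcc.subset_of_closure_inter_subset huo
    ⟨0, Set.left_mem_uIcc, hs Set.left_mem_uIcc, hs' Set.left_mem_uIcc, h0⟩ hcl
  exact (hsub Set.right_mem_uIcc).2.2

/-- Existence and uniqueness of a leg in one equivalence; such equivalences chain along a journey.
-/
theorem IsSprayCurveOn.isLeg_iff {x : M} {α : ℝ → Plane × Plane} {δ s : ℝ}
    (h : IsSprayCurveOn x α (Set.Ioo (-δ) δ)) (hs : s ∈ Set.Ioo (-δ) δ)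
    (η : TangentBundle (𝓡 2) M) :
    IsLeg s (tangentPoint x (α 0)) η ↔ η = tangentPoint x (α s) := by
  have hδ : (0 : ℝ) ∈ Set.Ioo (-δ) δ := by
    constructor <;> linarith [hs.1, hs.2]
  have hv : ∀ t ∈ Set.Ioo (-δ) δ, velocity (fun t ↦ (extChartAt (𝓡 2) x).symm (α t).1) t
      = tangentPoint x (α t) := fun t ht ↦
    velocity_symm ((ContinuousLinearMap.fst ℝ Plane Plane).hasFDerivAt.comp_hasDerivAt t
      (h t ht).1) (h t ht).2
  constructor
  · rintro ⟨γ, a, b, h0, hs', hγ, hγ0, rfl⟩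
    exact h.velocity_eq isOpen_Ioo hγ isOpen_Ioo (Set.ordConnected_Ioo.uIcc_subset hδ hs)
      (Set.ordConnected_Ioo.uIcc_subset h0 hs') hγ0
  · rintro rfl
    exact ⟨_, -δ, δ, hδ, hs, h.isGeodesicOn isOpen_Ioo, hv 0 hδ, hv s hs⟩

/-- Short geodesics exist, are unique and depend continuously on their initial velocity. -/
theorem exists_legs {x : M} {z₀ : Plane × Plane} (hz₀ : z₀.1 ∈ (extChartAt (𝓡 2) x).target)
    {U : Set (Plane × Plane)} (hU : U ∈ 𝓝 z₀) :
    ∃ δ > (0 : ℝ), ∀ z ∈ Metric.ball z₀ δ, ∃ α : ℝ → Plane × Plane, α 0 = z ∧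
      IsSprayCurveOn x α (Set.Ioo (-δ) δ) ∧ (∀ t ∈ Set.Ioo (-δ) δ, α t ∈ U) ∧
      ∀ s ∈ Set.Ioo (-δ) δ, ∀ η, IsLeg s (tangentPoint x z) η ↔ η = tangentPoint x (α s) := by
  have hT : {z : Plane × Plane | z.1 ∈ (extChartAt (𝓡 2) x).target} ∈ 𝓝 z₀ :=
    continuousAt_fst.preimage_mem_nhds ((isOpen_extChartAt_target x).mem_nhds hz₀)
  obtain ⟨δ, hδ, h⟩ := exists_local_flow ((contDiffAt_sprayField hz₀).of_le (m := 1) (by simp))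
    (inter_mem hT hU)
  refine ⟨δ, hδ, fun z hz ↦ ?_⟩
  obtain ⟨α, rfl, hα⟩ := h z hz
  have hs : IsSprayCurveOn x α (Set.Ioo (-δ) δ) := fun t ht ↦ ⟨(hα t ht).1, (hα t ht).2.1⟩
  exact ⟨α, rfl, hs, fun t ht ↦ (hα t ht).2.2, fun s hs' η ↦ hs.isLeg_iff hs' η⟩

end Geodesics

/-! ### The quarter turn in coordinates, and its parallelism -/

section Rotation

local instance : NormedAddCommGroup (Plane →L[ℝ] Plane →L[ℝ] ℝ) :=
  ContinuousLinearMap.toNormedAddCommGroup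

local instance : NormedSpace ℝ (Plane →L[ℝ] Plane →L[ℝ] ℝ) :=
  ContinuousLinearMap.toNormedSpace

variable {M : Type*} [TopologicalSpace M] [ChartedSpace Plane M]
  [RiemannianBundle (fun x : M ↦ TangentSpace (𝓡 2) x)]

/-- The rotation by a right angle in the chart around `x`, at the point with coordinates `y`; the
sign `ε` tells whether the chart preserves the orientation. -/
def rotation (ε : ℝ) (x : M) (y a : Plane) : Plane :=
  (ε / √(metricMatrix x y).det) • (metricForm x y a (EuclideanSpace.single 0 1) •
    EuclideanSpace.single 1 (1 : ℝ) - metricForm x y a (EuclideanSpace.single 1 1) •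
    EuclideanSpace.single 0 (1 : ℝ))

/-- The frame consisting of a tangent vector and of its image by the rotation. -/
def rotationFrame (ε : ℝ) (x : M) (z : Plane × Plane) : Plane × Plane × Plane :=
  (z.1, z.2, rotation ε x z.1 z.2)

variable {x : M} {y : Plane} {ε : ℝ}

theorem metricForm_rotation_self (a : Plane) : metricForm x y (rotation ε x y a) a = 0 := by
  simp only [rotation, map_smul, map_sub, smul_apply, sub_apply, smul_eq_mul]
  rw [metricForm_comm x y a, metricForm_comm x y a]
  ring

variable [IsManifold (𝓡 2) ∞ M]

/-- Lowering an index turns the rotation into ε times the area form √det g dy⁰ ∧ dy¹; from this both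
J² = -1 and the isometry property follow. -/
theorem metricForm_rotation_single (hy : y ∈ (extChartAt (𝓡 2) x).target) (a : Plane) :
    metricForm x y (rotation ε x y a) (EuclideanSpace.single 0 1)
      = -(ε * √(metricMatrix x y).det * a 1) ∧
    metricForm x y (rotation ε x y a) (EuclideanSpace.single 1 1)
      = ε * √(metricMatrix x y).det * a 0 := by
  have hd := det_metricMatrix_pos hy
  have hs := Real.sq_sqrt hd.le
  have hne := (Real.sqrt_pos.2 hd).ne'
  set r := √(metricMatrix x y).det
  rw [det_metricMatrix] at hs
  have e0 : metricForm x y a (EuclideanSpace.single 0 1)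
    = a 0 * metricCoeff x 0 0 y + a 1 * metricCoeff x 0 1 y := by
    rw [metricForm_eq_sum]; simp [Fin.sum_univ_two, metricCoeff_comm x 1 0]; ring
  have e1 : metricForm x y a (EuclideanSpace.single 1 1)
    = a 0 * metricCoeff x 0 1 y + a 1 * metricCoeff x 1 1 y := by
    rw [metricForm_eq_sum]; simp [Fin.sum_univ_two]; ring
  simp only [rotation, map_smul, map_sub, smul_apply, sub_apply, smul_eq_mul,
    ← metricCoeff_eq_metricForm, metricCoeff_comm x 1 0, e0, e1]
  constructor
  · field_simp
    linear_combination (ε * a 1) * hs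
  · field_simp
    linear_combination (-(ε * a 0)) * hs

theorem rotation_rotation (hε : ε ^ 2 = 1) (hy : y ∈ (extChartAt (𝓡 2) x).target) (a : Plane) :
    rotation ε x y (rotation ε x y a) = -a := by
  have hne := (Real.sqrt_pos.2 (det_metricMatrix_pos hy)).ne'
  have h := metricForm_rotation_single (ε := ε) hy a
  rw [rotation, h.1, h.2]
  ext i
  obtain rfl | rfl : i = 0 ∨ i = 1 := by omega
  all_goals
    simp
    field_simp
    first | linear_combination (a 0) * hε | linear_combination (a 1) * hε

theorem metricForm_rotation_rotation (hε : ε ^ 2 = 1) (hy : y ∈ (extChartAt (𝓡 2) x).target)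
    (a : Plane) :
    metricForm x y (rotation ε x y a) (rotation ε x y a) = metricForm x y a a := by
  have hne := (Real.sqrt_pos.2 (det_metricMatrix_pos hy)).ne'
  have h := metricForm_rotation_single (ε := ε) hy a
  conv_lhs => enter [2]; rw [rotation]
  simp only [map_smul, map_sub, h.1, h.2, smul_eq_mul]
  have e : metricForm x y a a = a 0 * metricForm x y a (EuclideanSpace.single 0 1)
    + a 1 * metricForm x y a (EuclideanSpace.single 1 1) := by
    conv_lhs => enter [2]; rw [plane_eq a]
    simp
  rw [e]
  field_simp
  linear_combination (metricForm x y a (EuclideanSpace.single 0 1) * a 0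
    + metricForm x y a (EuclideanSpace.single 1 1) * a 1) * hε

variable [IsContMDiffRiemannianBundle (𝓡 2) ∞ Plane (fun x : M ↦ TangentSpace (𝓡 2) x)]

theorem contDiffAt_rotation {z : Plane × Plane} (hz : z.1 ∈ (extChartAt (𝓡 2) x).target) :
    ContDiffAt ℝ ∞ (fun z : Plane × Plane ↦ rotation ε x z.1 z.2) z := by
  have hg : ContDiffAt ℝ ∞ (fun z : Plane × Plane ↦ metricForm x z.1) z :=
    (contDiffAt_metricForm hz).comp z contDiffAt_fst
  have hc : ∀ i j, ContDiffAt ℝ ∞ (fun z : Plane × Plane ↦ metricCoeff x i j z.1) z := fun i j ↦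
    ((contDiffOn_metricCoeff x i j).contDiffAt
      ((isOpen_extChartAt_target x).mem_nhds hz)).comp z contDiffAt_fst
  have hd : ContDiffAt ℝ ∞ (fun z : Plane × Plane ↦ (metricMatrix x z.1).det) z := by
    simp only [det_metricMatrix]
    exact ((hc 0 0).mul (hc 1 1)).sub ((hc 0 1).pow 2)
  have hpos := det_metricMatrix_pos hz
  have hr : ContDiffAt ℝ ∞ (fun z : Plane × Plane ↦ ε / √(metricMatrix x z.1).det) z :=
    contDiffAt_const.div (hd.sqrt hpos.ne') (Real.sqrt_pos.2 hpos).ne'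
  exact hr.smul ((((hg.clm_apply contDiffAt_snd).clm_apply contDiffAt_const).smul
    contDiffAt_const).sub (((hg.clm_apply contDiffAt_snd).clm_apply contDiffAt_const).smul
    contDiffAt_const))

theorem continuousAt_rotationFrame {z : Plane × Plane}
    (hz : z.1 ∈ (extChartAt (𝓡 2) x).target) : ContinuousAt (rotationFrame ε x) z :=
  continuousAt_fst.prodMk (continuousAt_snd.prodMk (contDiffAt_rotation hz).continuousAt)

/-- The rotation is parallel along geodesics. -/
theorem IsSprayCurveOn.hasDerivAt_rotationFrame (hε : ε ^ 2 = 1) {α : ℝ → Plane × Plane}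
    {J : Set ℝ} (h : IsSprayCurveOn x α J) (hJ : IsOpen J) {t : ℝ} (ht : t ∈ J)
    (h0 : (α t).2 ≠ 0) :
    HasDerivAt (fun τ ↦ rotationFrame ε x (α τ))
      (frameField (christoffelForm x) (rotationFrame ε x (α t))) t := by
  obtain ⟨hα, hy⟩ := h t ht
  have h1 : HasDerivAt (fun t ↦ (α t).1) (α t).2 t :=
    (ContinuousLinearMap.fst ℝ Plane Plane).hasFDerivAt.comp_hasDerivAt t hα
  have h2 : HasDerivAt (fun t ↦ (α t).2) (-christoffelForm x (α t).1 (α t).2 (α t).2) t :=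
    (ContinuousLinearMap.snd ℝ Plane Plane).hasFDerivAt.comp_hasDerivAt t hα
  set b : ℝ → Plane := fun τ ↦ rotation ε x (α τ).1 (α τ).2 with hb
  obtain ⟨b', h3⟩ : ∃ b', HasDerivAt b b' t :=
    ⟨_, ((contDiffAt_rotation (ε := ε) hy).differentiableAt
      (by simp)).hasFDerivAt.comp_hasDerivAt t hα⟩
  set g := metricForm x (α t).1 with hg
  have hgd : HasDerivAt (fun τ ↦ metricForm x (α τ).1)
      (fderiv ℝ (metricForm x) (α t).1 (α t).2) t := by
    have e : HasFDerivAt (metricForm x) (fderiv ℝ (metricForm x) (α t).1) (α t).1 :=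
      (differentiableAt_metricForm hy).hasFDerivAt
    exact e.comp_hasDerivAt t h1
  have hev : ∀ᶠ τ in 𝓝 t, (α τ).1 ∈ (extChartAt (𝓡 2) x).target := by
    filter_upwards [hJ.mem_nhds ht] with τ hτ using (h τ hτ).2
  -- `z` is the covariant derivative of J a along the curve. Differentiating g(J a, a) = 0 and g(J
  -- a, J a) = g(a, a), with a parallel, shows that it is orthogonal to a and to J a, which span the
  -- plane when a ≠ 0.
  set z := b' + christoffelForm x (α t).1 (α t).2 (b t) with hz
  have k1 : g z (α t).2 = 0 := by
    have e1 := (hgd.clm_apply h3).clm_apply h2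
    have e2 : (fun τ ↦ metricForm x (α τ).1 (b τ) (α τ).2) = fun _ ↦ 0 :=
      funext fun τ ↦ metricForm_rotation_self _
    rw [e2] at e1
    have e3 := e1.unique (hasDerivAt_const t (0 : ℝ))
    simp only [add_apply, fderiv_metricForm hy, map_neg, ← hg] at e3
    simp only [hz, map_add, add_apply]
    linarith
  have k2 : g z (b t) = 0 := by
    have e1 := (hgd.clm_apply h3).clm_apply h3
    have e1' := (hgd.clm_apply h2).clm_apply h2
    have e2 : (fun τ ↦ metricForm x (α τ).1 (b τ) (b τ))
        =ᶠ[𝓝 t] fun τ ↦ metricForm x (α τ).1 (α τ).2 (α τ).2 := by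
      filter_upwards [hev] with τ hτ using metricForm_rotation_rotation hε hτ _
    have e3 := (e1.congr_of_eventuallyEq e2.symm).unique e1'
    simp only [add_apply, fderiv_metricForm hy, map_neg, neg_apply, ← hg] at e3
    simp only [hz, map_add, add_apply]
    rw [metricForm_comm x _ (b t) b', metricForm_comm x _ (b t)] at e3
    linarith
  have hz0 : z = 0 := by
    refine eq_zero_of_metricForm_eq_zero hy (u := (α t).2) (v := b t) ?_ k1 k2
    rw [metricForm_comm x _ (α t).2 (b t), hb, metricForm_rotation_self,
      metricForm_rotation_rotation hε hy]
    simp [(metricForm_self_pos hy h0).ne']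
  have hb' : b' = -christoffelForm x (α t).1 (α t).2 (b t) := eq_neg_of_add_eq_zero_left hz0
  rw [hb'] at h3
  exact h1.prodMk (h2.prodMk h3)

theorem FlowsTo.tendsto {N : Type*} [NormedAddCommGroup N] [NormedSpace ℝ N] {V : N → N} {z₀ : N}
    {z z' : ℝ → N} (h : FlowsTo V z₀ z z') : Tendsto z' (𝓝 0) (𝓝 z₀) := by
  intro U hU
  refine Filter.mem_map.2 ?_
  filter_upwards [h U hU] with s ⟨ζ, _, h1, h2⟩
  rw [Set.mem_preimage, ← h1]
  exact (h2 s Set.right_mem_uIcc).2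

theorem FlowsTo.congr_left {N : Type*} [NormedAddCommGroup N] [NormedSpace ℝ N] {V : N → N} {z₀ : N}
    {z w z' : ℝ → N} (h : FlowsTo V z₀ z z') (hw : z =ᶠ[𝓝 0] w) : FlowsTo V z₀ w z' := by
  intro U hU
  filter_upwards [h U hU, hw] with s hs h1
  rwa [← h1]

/-- Following a leg from the tangent vectors with coordinates `y s`. -/
theorem exists_leg [T2Space M] (hε : ε ^ 2 = 1) {z₀ : Plane × Plane}
    (hz₀ : z₀.1 ∈ (extChartAt (𝓡 2) x).target) (h0 : z₀.2 ≠ 0) {z : ℝ → Plane × Plane}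
    (hz : Tendsto z (𝓝 0) (𝓝 z₀)) :
    ∃ z' : ℝ → Plane × Plane, (∀ᶠ s in 𝓝 0, ∀ η : TangentBundle (𝓡 2) M,
        IsLeg s (tangentPoint x (z s)) η ↔ η = tangentPoint x (z' s)) ∧
      FlowsTo (frameField (christoffelForm x)) (rotationFrame ε x z₀)
        (fun s ↦ rotationFrame ε x (z s)) (fun s ↦ rotationFrame ε x (z' s)) ∧
      Tendsto z' (𝓝 0) (𝓝 z₀) := by
  have key : ∀ U ∈ 𝓝 z₀, ∀ᶠ s in 𝓝 (0 : ℝ), ∃ α : ℝ → Plane × Plane, ∃ δ, α 0 = z s ∧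
      s ∈ Set.Ioo (-δ) δ ∧ IsSprayCurveOn x α (Set.Ioo (-δ) δ) ∧ (∀ t ∈ Set.Ioo (-δ) δ, α t ∈ U) ∧
      ∀ η : TangentBundle (𝓡 2) M,
        IsLeg s (tangentPoint x (z s)) η ↔ η = tangentPoint x (α s) := by
    intro U hU
    obtain ⟨δ, hδ, h⟩ := exists_legs hz₀ hU
    filter_upwards [hz (Metric.ball_mem_nhds z₀ hδ),
      Ioo_mem_nhds (neg_lt_zero.2 hδ) hδ] with s h1 h2
    obtain ⟨α, h3, h4, h5, h6⟩ := h (z s) h1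
    exact ⟨α, δ, h3, h2, h4, h5, h6 s h2⟩
  -- The curves provided by `key` depend on the neighbourhood `U`, whereas `z'` must not. The
  -- endpoint is therefore chosen by its characterization as a leg, with the default 0 where no such
  -- endpoint exists.
  have hch : ∀ s, ∃ w : Plane × Plane, (∃ w : Plane × Plane, w.1 ∈ (extChartAt (𝓡 2) x).target ∧
      ∀ η : TangentBundle (𝓡 2) M,
        IsLeg s (tangentPoint x (z s)) η ↔ η = tangentPoint x w) →
      w.1 ∈ (extChartAt (𝓡 2) x).target ∧ ∀ η : TangentBundle (𝓡 2) M,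
        IsLeg s (tangentPoint x (z s)) η ↔ η = tangentPoint x w := by
    intro s
    by_cases h : ∃ w : Plane × Plane, w.1 ∈ (extChartAt (𝓡 2) x).target ∧
      ∀ η : TangentBundle (𝓡 2) M, IsLeg s (tangentPoint x (z s)) η ↔ η = tangentPoint x w
    · exact ⟨h.choose, fun _ ↦ h.choose_spec⟩
    · exact ⟨0, fun h' ↦ absurd h' h⟩
  choose z' hz' using hch
  have hU : {w : Plane × Plane | w.2 ≠ 0} ∈ 𝓝 z₀ :=
    continuousAt_snd.preimage_mem_nhds (isOpen_ne.mem_nhds h0)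
  have hflow : FlowsTo (frameField (christoffelForm x)) (rotationFrame ε x z₀)
      (fun s ↦ rotationFrame ε x (z s)) (fun s ↦ rotationFrame ε x (z' s)) := by
    intro W hW
    filter_upwards [key _ (inter_mem hU ((continuousAt_rotationFrame hz₀).preimage_mem_nhds hW))]
      with s ⟨α, δ, h1, h2, h3, h4, h5⟩
    have h6 := hz' s ⟨α s, (h3 s h2).2, h5⟩
    -- Injectivity of the coordinates identifies the chosen endpoint with that of the curve at hand.
    have h7 : z' s = α s := tangentPoint_injOn h6.1 (h3 s h2).2 ((h5 _).1 ((h6.2 _).2 rfl))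
    have hδ : (0 : ℝ) ∈ Set.Ioo (-δ) δ := by constructor <;> linarith [h2.1, h2.2]
    refine ⟨fun t ↦ rotationFrame ε x (α t), by simp [h1], by simp [h7], fun t ht ↦ ?_⟩
    have ht' := Set.ordConnected_Ioo.uIcc_subset hδ h2 ht
    exact ⟨h3.hasDerivAt_rotationFrame hε isOpen_Ioo ht' (h4 t ht').1, (h4 t ht').2⟩
  refine ⟨z', ?_, hflow, ?_⟩
  · filter_upwards [key _ hU] with s ⟨α, δ, h1, h2, h3, h4, h5⟩
    exact (hz' s ⟨α s, (h3 s h2).2, h5⟩).2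
  · exact ((continuous_fst.prodMk (continuous_fst.comp continuous_snd)).tendsto
      (rotationFrame ε x z₀)).comp hflow.tendsto

end Rotation

/-! ### From an orientation of the surface to the sign of the coordinate rotation -/

section Orientation

variable {M : Type*} [TopologicalSpace M] [ChartedSpace Plane M]
  [RiemannianBundle (fun x : M ↦ TangentSpace (𝓡 2) x)]
  {o : ∀ x : M, Orientation ℝ (TangentSpace (𝓡 2) x) (Fin 2)} {x : M} {y : Plane} {ε : ℝ}

/-- In the chart around `x`, the rotation of the oriented tangent plane is given by `rotation`. -/
def RotatesBy (o : ∀ x : M, Orientation ℝ (TangentSpace (𝓡 2) x) (Fin 2)) (ε : ℝ) (x : M)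
    (y : Plane) : Prop :=
  ∀ a : Plane, (o ((extChartAt (𝓡 2) x).symm y)).rightAngleRotation (chartFrame x y a) =
    chartFrame x y (rotation ε x y a)

theorem RotatesBy.leftTurn (h : RotatesBy o ε x y) (a : Plane) :
    leftTurn o (tangentPoint x (y, a)) = tangentPoint x (y, rotation ε x y a) := by
  simp only [GeodesicGap.leftTurn, tangentPoint, ← h a]
  rfl

theorem RotatesBy.rightTurn (h : RotatesBy o ε x y) (a : Plane) :
    rightTurn o (tangentPoint x (y, a)) = tangentPoint x (y, -rotation ε x y a) := by
  have e : ∀ (p : M) (w : TangentSpace (𝓡 2) p),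
      (o p).rightAngleRotation.symm w = -(o p).rightAngleRotation w := fun p w ↦ by
    rw [Orientation.rightAngleRotation_symm]; rfl
  refine congr_arg (TotalSpace.mk ((extChartAt (𝓡 2) x).symm y)) ?_
  refine (e _ _).trans (Eq.trans ?_ (map_neg (chartFrame x y) _).symm)
  exact congr_arg _ (h a)

variable [IsManifold (𝓡 2) ∞ M]

/-- The intrinsic quarter turn satisfies ⟨J a, w⟩ = ω(a, w), so it is determined by the area form;
both candidates have the same inner products with the coordinate vectors. -/
theorem rotatesBy_of_areaForm (hy : y ∈ (extChartAt (𝓡 2) x).target)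
    (h : (o ((extChartAt (𝓡 2) x).symm y)).areaForm (coordVec x y 0) (coordVec x y 1)
      = ε * √(metricMatrix x y).det) : RotatesBy o ε x y := by
  intro a
  set p := (extChartAt (𝓡 2) x).symm y with hp
  obtain ⟨b, hb⟩ := chartFrame_surjective hy ((o p).rightAngleRotation (chartFrame x y a))
  rw [← hb]
  have ha : (chartFrame x y a : TangentSpace (𝓡 2) p) =
      a 0 • coordVec x y 0 + a 1 • coordVec x y 1 := by
    conv_lhs => rw [plane_eq a]
    exact (map_add _ _ _).trans (congr_arg₂ _ (map_smul _ _ _) (map_smul _ _ _))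
  have hlin : ∀ (c d : ℝ) (X Y W : TangentSpace (𝓡 2) p), (o p).areaForm (c • X + d • Y) W
      = c * (o p).areaForm X W + d * (o p).areaForm Y W := by
    intro c d X Y W
    simp
  have hi : ∀ i, metricForm x y b (EuclideanSpace.single i 1)
      = a 0 * (o p).areaForm (coordVec x y 0) (coordVec x y i)
        + a 1 * (o p).areaForm (coordVec x y 1) (coordVec x y i) := by
    intro i
    rw [metricForm_apply, hb, ← hlin]
    refine ((o p).inner_rightAngleRotation_left _ _).trans ?_
    exact congr_arg (fun A : TangentSpace (𝓡 2) p ↦ (o p).areaForm A (coordVec x y i)) ha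
  have h2 := metricForm_rotation_single (ε := ε) hy a
  have hs : (o p).areaForm (coordVec x y 1) (coordVec x y 0) = -(ε * √(metricMatrix x y).det) := by
    rw [← h, Orientation.areaForm_swap]
  have e : ∀ i, metricForm x y (b - rotation ε x y a) (EuclideanSpace.single i 1) = 0 := by
    intro i
    rw [map_sub, sub_apply, hi]
    obtain rfl | rfl : i = 0 ∨ i = 1 := by omega
    · simp [h2.1, hs]; ring
    · simp [h2.2, h]; ring
  have hb0 : b - rotation ε x y a = 0 := by
    refine eq_zero_of_metricForm_eq_zero hy ?_ (e 0) (e 1)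
    rw [← metricCoeff_eq_metricForm, ← metricCoeff_eq_metricForm, ← metricCoeff_eq_metricForm,
      ← det_metricMatrix]
    exact (det_metricMatrix_pos hy).ne'
  rw [sub_eq_zero.1 hb0]

/-- The squared area of the coordinate frame is its Gram determinant, so the area is ±√det g. An
orientation keeps the sign constant near the centre, and ε is that sign. -/
theorem exists_rotatesBy {U : Set M} (ho : IsOrientationOn o U) (hx : x ∈ U) :
    ∃ ε : ℝ, ε ^ 2 = 1 ∧ ∀ᶠ y in 𝓝 (extChartAt (𝓡 2) x x), RotatesBy o ε x y := by
  have h1 := ho.2 x hx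
  have hT : ∀ᶠ y in 𝓝 (extChartAt (𝓡 2) x x), y ∈ (extChartAt (𝓡 2) x).target :=
    extChartAt_target_mem_nhds x
  have hsq : ∀ y, (o ((extChartAt (𝓡 2) x).symm y)).areaForm (coordVec x y 0) (coordVec x y 1) ^ 2
      = (metricMatrix x y).det := by
    intro y
    have h := (o ((extChartAt (𝓡 2) x).symm y)).inner_sq_add_areaForm_sq
      (coordVec x y 0) (coordVec x y 1)
    rw [← real_inner_self_eq_norm_sq, ← real_inner_self_eq_norm_sq] at h
    rw [det_metricMatrix]
    simp only [metricCoeff]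
    linarith
  by_cases hpos : RightHanded (o ((extChartAt (𝓡 2) x).symm (extChartAt (𝓡 2) x x)))
      (coordVec x (extChartAt (𝓡 2) x x) 0) (coordVec x (extChartAt (𝓡 2) x x) 1)
  · refine ⟨1, by norm_num, ?_⟩
    filter_upwards [h1, hT] with y hy hy'
    refine rotatesBy_of_areaForm hy' ?_
    have h2 : 0 < (o ((extChartAt (𝓡 2) x).symm y)).areaForm (coordVec x y 0) (coordVec x y 1) :=
      hy.2 hpos
    rw [← hsq, Real.sqrt_sq h2.le, one_mul]
  · refine ⟨-1, by norm_num, ?_⟩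
    filter_upwards [h1, hT] with y hy hy'
    refine rotatesBy_of_areaForm hy' ?_
    have h2 : ¬ 0 < (o ((extChartAt (𝓡 2) x).symm y)).areaForm (coordVec x y 0) (coordVec x y 1) :=
      fun h ↦ hpos (hy.1 h)
    rw [← hsq, Real.sqrt_sq_eq_abs, abs_of_nonpos (not_lt.1 h2)]
    ring

end Orientation

/-! ### Comparison of the metric near a point with its value at the point -/

section Distance

local instance : NormedAddCommGroup (Plane →L[ℝ] Plane →L[ℝ] ℝ) :=
  ContinuousLinearMap.toNormedAddCommGroup

local instance : NormedSpace ℝ (Plane →L[ℝ] Plane →L[ℝ] ℝ) :=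
  ContinuousLinearMap.toNormedSpace

variable {M : Type*} [TopologicalSpace M] [ChartedSpace Plane M]
  [RiemannianBundle (fun x : M ↦ TangentSpace (𝓡 2) x)]

/-- The length of the tangent vector with coordinates `a` in the chart around `x`, at the point with
coordinates `y`. -/
def speed (x : M) (y a : Plane) : ℝ := √(metricForm x y a a)

theorem metricForm_self_nonneg (x : M) (y a : Plane) : 0 ≤ metricForm x y a a := by
  rw [metricForm_apply]
  exact real_inner_self_nonneg (F := TangentSpace (𝓡 2) ((extChartAt (𝓡 2) x).symm y))

theorem speed_nonneg (x : M) (y a : Plane) : 0 ≤ speed x y a := Real.sqrt_nonneg _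

theorem speed_sq (x : M) (y a : Plane) : speed x y a ^ 2 = metricForm x y a a :=
  Real.sq_sqrt (metricForm_self_nonneg x y a)

theorem norm_chartFrame (x : M) (y a : Plane) :
    ‖(show TangentSpace (𝓡 2) ((extChartAt (𝓡 2) x).symm y) from chartFrame x y a)‖
      = speed x y a := by
  rw [speed, metricForm_apply]
  exact norm_eq_sqrt_real_inner _

theorem abs_metricForm_le (x : M) (y a b : Plane) :
    |metricForm x y a b| ≤ speed x y a * speed x y b := by
  rw [metricForm_apply, ← norm_chartFrame, ← norm_chartFrame]
  exact abs_real_inner_le_norm (F := TangentSpace (𝓡 2) ((extChartAt (𝓡 2) x).symm y)) _ _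

theorem enorm_velocity [IsManifold (𝓡 2) ∞ M] {x : M} {γ : ℝ → M} {c : ℝ → Plane} {c' : Plane}
    {t : ℝ} (h : γ =ᶠ[𝓝 t] fun τ ↦ (extChartAt (𝓡 2) x).symm (c τ)) (hc : HasDerivAt c c' t)
    (ht : c t ∈ (extChartAt (𝓡 2) x).target) :
    ‖mfderiv 𝓘(ℝ, ℝ) (𝓡 2) γ t (1 : ℝ)‖ₑ = ENNReal.ofReal (speed x (c t) c') := by
  have h1 : velocity γ t = tangentPoint x (c t, c') := by
    rw [← velocity_symm hc ht]
    exact TotalSpace.ext h.eq_of_nhds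
      (heq_of_eq congr($(h.mfderiv_eq (I := 𝓘(ℝ, ℝ)) (I' := 𝓡 2)) (1 : ℝ)))
  have h2 : ∀ ξ η : TangentBundle (𝓡 2) M, ξ = η → ‖ξ.2‖ₑ = ‖η.2‖ₑ := by rintro ξ _ rfl; rfl
  refine (h2 _ _ h1).trans ?_
  rw [← norm_chartFrame, ofReal_norm]
  rfl

variable [IsManifold (𝓡 2) ∞ M]
  [IsContMDiffRiemannianBundle (𝓡 2) ∞ Plane (fun x : M ↦ TangentSpace (𝓡 2) x)]

/-- Near a point, the metric is comparable with the Euclidean metric of the chart and close to its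
value at the point. -/
theorem exists_speed_bounds {x : M} {y₀ : Plane} (hy₀ : y₀ ∈ (extChartAt (𝓡 2) x).target) :
    ∃ m > (0 : ℝ), ∃ B > (0 : ℝ), ∃ C ≥ (0 : ℝ), ∃ R > (0 : ℝ),
      Metric.closedBall y₀ R ⊆ (extChartAt (𝓡 2) x).target ∧
      ∀ y ∈ Metric.closedBall y₀ R, ∀ w, m * ‖w‖ ≤ speed x y w ∧ speed x y w ≤ B * ‖w‖ ∧
        |speed x y w - speed x y₀ w| ≤ C * ‖y - y₀‖ * ‖w‖ := by
  obtain ⟨K, T, hT, hK⟩ := ((contDiffAt_metricForm hy₀).of_le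
    (m := 1) (by exact_mod_cast le_top)).exists_lipschitzOnWith
  -- μ is the minimum of the positive form at `y₀` on the compact Euclidean unit sphere.
  obtain ⟨μ, hμ, hμ'⟩ : ∃ μ > (0 : ℝ), ∀ w, μ * ‖w‖ ^ 2 ≤ metricForm x y₀ w w := by
    have hc : ContinuousOn (fun w ↦ metricForm x y₀ w w) (Metric.sphere (0 : Plane) 1) := by
      fun_prop
    obtain ⟨w₀, hw₀, hmin⟩ := (isCompact_sphere (0 : Plane) 1).exists_isMinOn
      (NormedSpace.sphere_nonempty.2 zero_le_one) hc
    have h0 : w₀ ≠ 0 := by rintro rfl; simp at hw₀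
    refine ⟨_, metricForm_self_pos hy₀ h0, fun w ↦ ?_⟩
    by_cases hw : w = 0
    · simp [hw]
    have h1 : metricForm x y₀ w₀ w₀ ≤ metricForm x y₀ (‖w‖⁻¹ • w) (‖w‖⁻¹ • w) :=
      hmin (by simp [norm_smul, hw])
    simp only [map_smul, smul_apply, smul_eq_mul] at h1
    have h2 : 0 < ‖w‖ := norm_pos_iff.2 hw
    calc _ ≤ ‖w‖⁻¹ * (‖w‖⁻¹ * metricForm x y₀ w w) * ‖w‖ ^ 2 := by gcongr
      _ = _ := by field_simp
  obtain ⟨r, hr, hr'⟩ := Metric.mem_nhds_iff.1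
    (inter_mem hT ((isOpen_extChartAt_target x).mem_nhds hy₀))
  -- On this ball the form changes by at most half of μ, which leaves the lower bound μ/2; K + 1
  -- avoids a division by zero.
  set R := min (r / 2) (μ / (2 * (K + 1))) with hR
  have hK0 : (0 : ℝ) ≤ K := K.2
  have hRpos : 0 < R := by positivity
  have hsub : Metric.closedBall y₀ R ⊆ T ∩ (extChartAt (𝓡 2) x).target := fun y hy ↦
    hr' (Metric.mem_ball.2 ((Metric.mem_closedBall.1 hy).trans_lt
      ((min_le_left _ _).trans_lt (by linarith))))
  have hKR : K * R ≤ μ / 2 := by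
    have : R ≤ μ / (2 * (K + 1)) := min_le_right _ _
    rw [le_div_iff₀ (by positivity)] at this
    nlinarith
  have hdiff : ∀ y ∈ Metric.closedBall y₀ R, ∀ w,
      |metricForm x y w w - metricForm x y₀ w w| ≤ K * ‖y - y₀‖ * ‖w‖ ^ 2 := by
    intro y hy w
    have h1 := hK.norm_sub_le (hsub hy).1 (hsub (Metric.mem_closedBall_self hRpos.le)).1
    have h2 := (metricForm x y - metricForm x y₀).le_opNorm₂ w w
    rw [Real.norm_eq_abs] at h2
    calc _ ≤ ‖metricForm x y - metricForm x y₀‖ * ‖w‖ * ‖w‖ := h2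
      _ ≤ K * ‖y - y₀‖ * ‖w‖ * ‖w‖ := by gcongr
      _ = _ := by ring
  set m := √(μ / 2) with hm
  have hmpos : 0 < m := Real.sqrt_pos.2 (by positivity)
  have hlow : ∀ y ∈ Metric.closedBall y₀ R, ∀ w, m * ‖w‖ ≤ speed x y w := by
    intro y hy w
    have h1 := abs_le.1 (hdiff y hy w)
    have h2 : K * ‖y - y₀‖ * ‖w‖ ^ 2 ≤ μ / 2 * ‖w‖ ^ 2 := by
      have : ‖y - y₀‖ ≤ R := mem_closedBall_iff_norm.1 hy
      gcongr
      exact (mul_le_mul_of_nonneg_left this hK0).trans hKR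
    have h3 := hμ' w
    refine Real.le_sqrt_of_sq_le ?_
    rw [mul_pow, hm, Real.sq_sqrt (by positivity)]
    linarith [h1.1]
  refine ⟨m, hmpos, √(‖metricForm x y₀‖ + μ / 2), Real.sqrt_pos.2 (by positivity), K / (2 * m),
    by positivity, R, hRpos, fun y hy ↦ (hsub hy).2, fun y hy w ↦ ⟨hlow y hy w, ?_, ?_⟩⟩
  · have h1 := abs_le.1 (hdiff y hy w)
    have h2 : K * ‖y - y₀‖ * ‖w‖ ^ 2 ≤ μ / 2 * ‖w‖ ^ 2 := by
      have : ‖y - y₀‖ ≤ R := mem_closedBall_iff_norm.1 hy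
      gcongr
      exact (mul_le_mul_of_nonneg_left this hK0).trans hKR
    have h3 := (le_abs_self _).trans ((metricForm x y₀).le_opNorm₂ w w)
    refine Real.sqrt_le_iff.2 ⟨by positivity, ?_⟩
    rw [mul_pow, Real.sq_sqrt (by positivity)]
    linarith [h1.2]
  · have h1 := hlow y hy w
    have h2 := hlow y₀ (Metric.mem_closedBall_self hRpos.le) w
    have h3 := hdiff y hy w
    by_cases hw : w = 0
    · simp [hw, speed]
    have hw' : 0 < ‖w‖ := norm_pos_iff.2 hw
    -- A difference of squares is divided by the sum of the roots, which is at least 2m‖w‖; hence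
    -- the constant K/(2m).
    rw [← speed_sq, ← speed_sq, sq_sub_sq, abs_mul,
      abs_of_nonneg (add_nonneg (speed_nonneg _ _ _) (speed_nonneg _ _ _))] at h3
    have h4 : 2 * m * ‖w‖ * |speed x y w - speed x y₀ w| ≤ K * ‖y - y₀‖ * ‖w‖ ^ 2 :=
      (mul_le_mul_of_nonneg_right (by linarith) (abs_nonneg _)).trans h3
    rw [div_mul_eq_mul_div, div_mul_eq_mul_div, le_div_iff₀ (by positivity)]
    refine le_of_mul_le_mul_left ?_ hw'
    linarith

end Distance

/-! ### The Riemannian distance near a point -/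

section Paths

variable {M : Type*} [TopologicalSpace M] [ChartedSpace Plane M] [IsManifold (𝓡 2) ∞ M]
  {x : M} {γ : ℝ → M}

theorem contDiffAt_chart_path (hγ : ContMDiff 𝓘(ℝ, ℝ) (𝓡 2) 1 γ) {t : ℝ}
    (ht : γ t ∈ (extChartAt (𝓡 2) x).source) :
    ContDiffAt ℝ 1 (fun τ ↦ extChartAt (𝓡 2) x (γ τ)) t := by
  rw [← contMDiffAt_iff_contDiffAt]
  have hφ : ContMDiffOn (𝓡 2) 𝓘(ℝ, Plane) ∞ (extChartAt (𝓡 2) x) (chartAt Plane x).source :=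
    contMDiffOn_extChartAt
  exact ((hφ.contMDiffAt ((chartAt Plane x).open_source.mem_nhds (by simpa using ht))).of_le
    (by exact_mod_cast le_top)).comp t hγ.contMDiffAt

variable [RiemannianBundle (fun x : M ↦ TangentSpace (𝓡 2) x)]

/-- The Riemannian distance is at most the length of the segment in the chart. -/
theorem riemannianEDist_symm_le {s : Set Plane} (hs : Convex ℝ s)
    (hs' : s ⊆ (extChartAt (𝓡 2) x).target) {a b : Plane} (ha : a ∈ s) (hb : b ∈ s) {S : ℝ}
    (hS : ∀ y ∈ s, speed x y (b - a) ≤ S) :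
    riemannianEDist (𝓡 2) ((extChartAt (𝓡 2) x).symm a) ((extChartAt (𝓡 2) x).symm b)
      ≤ ENNReal.ofReal S := by
  set c : ℝ → Plane := fun t ↦ AffineMap.lineMap a b t with hc
  have hc' : ∀ t, HasDerivAt c (b - a) t := fun t ↦ AffineMap.hasDerivAt_lineMap
  have hcs : ∀ t ∈ Set.Icc (0 : ℝ) 1, c t ∈ s := fun t ht ↦ hs.lineMap_mem ha hb ht
  have h1 : ContMDiffOn 𝓘(ℝ, ℝ) (𝓡 2) 1 (fun t ↦ (extChartAt (𝓡 2) x).symm (c t))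
      (Set.Icc 0 1) := by
    have h2 : ContMDiffOn 𝓘(ℝ, Plane) (𝓡 2) ∞ (extChartAt (𝓡 2) x).symm
      (extChartAt (𝓡 2) x).target := contMDiffOn_extChartAt_symm x
    have h3 : ContDiff ℝ 1 c := by
      simp only [hc, AffineMap.lineMap_apply_module']
      fun_prop
    exact (h2.of_le (by exact_mod_cast le_top)).comp
      (contMDiffOn_iff_contDiffOn.2 h3.contDiffOn) fun t ht ↦ hs' (hcs t ht)
  refine (riemannianEDist_le_pathELength h1 (by simp [hc]) (by simp [hc]) zero_le_one).trans ?_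
  rw [pathELength_eq_lintegral_mfderiv_Icc]
  calc _ ≤ ∫⁻ _ in Set.Icc (0 : ℝ) 1, ENNReal.ofReal S := by
        refine MeasureTheory.setLIntegral_mono' measurableSet_Icc fun t ht ↦ ?_
        have h3 := enorm_velocity (x := x) EventuallyEq.rfl (hc' t) (hs' (hcs t ht))
        exact h3.trans_le (ENNReal.ofReal_le_ofReal (hS _ (hcs t ht)))
    _ = _ := by simp

/-- Where the metric dominates the seminorm `‖A ·‖`, a path is at least as long as the image under
`A` of the displacement in the chart. -/
theorem enorm_le_pathELength {N : Type*} [NormedAddCommGroup N] [NormedSpace ℝ N]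
    (A : Plane →L[ℝ] N) {s : Set Plane} (hs : s ⊆ (extChartAt (𝓡 2) x).target)
    (hA : ∀ y ∈ s, ∀ w, ‖A w‖ ≤ speed x y w) (hγ : ContMDiff 𝓘(ℝ, ℝ) (𝓡 2) 1 γ) {t : ℝ}
    (ht : 0 ≤ t) (h : Set.Icc 0 t ⊆ γ ⁻¹' ((extChartAt (𝓡 2) x).symm '' s)) :
    ‖A (extChartAt (𝓡 2) x (γ t) - extChartAt (𝓡 2) x (γ 0))‖ₑ ≤ pathELength (𝓡 2) γ 0 t := by
  set c : ℝ → Plane := fun τ ↦ extChartAt (𝓡 2) x (γ τ) with hc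
  have hcs : ∀ τ ∈ Set.Icc 0 t, γ τ ∈ (extChartAt (𝓡 2) x).source ∧ c τ ∈ s := by
    intro τ hτ
    obtain ⟨y, hy, hyγ⟩ := h hτ
    rw [hc]
    simp only [← hyγ]
    exact ⟨(extChartAt (𝓡 2) x).map_target (hs hy), by
      rwa [(extChartAt (𝓡 2) x).right_inv (hs hy)]⟩
  have hcd : ∀ τ ∈ Set.Icc 0 t, ContDiffAt ℝ 1 c τ := fun τ hτ ↦
    contDiffAt_chart_path hγ (hcs τ hτ).1
  have h1 : ContDiffOn ℝ 1 (fun τ ↦ A (c τ)) (Set.Icc 0 t) := fun τ hτ ↦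
    (A.contDiff.contDiffAt.comp τ (hcd τ hτ)).contDiffWithinAt
  have h2 := enorm_sub_le_lintegral_deriv_of_contDiffOn_Icc h1 ht
  rw [map_sub]
  refine h2.trans ?_
  rw [pathELength_eq_lintegral_mfderiv_Icc]
  refine MeasureTheory.setLIntegral_mono' measurableSet_Icc fun τ hτ ↦ ?_
  have h3 : HasDerivAt c (deriv c τ) τ := ((hcd τ hτ).differentiableAt (by simp)).hasDerivAt
  have h4 : γ =ᶠ[𝓝 τ] fun τ ↦ (extChartAt (𝓡 2) x).symm (c τ) := by
    filter_upwards [hγ.continuous.continuousAt.preimage_mem_nhds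
      ((isOpen_extChartAt_source x).mem_nhds (hcs τ hτ).1)] with σ hσ
    exact ((extChartAt (𝓡 2) x).left_inv hσ).symm
  refine le_trans ?_ (enorm_velocity h4 h3 (hs (hcs τ hτ).2)).ge
  rw [show deriv (fun τ ↦ A (c τ)) τ = A (deriv c τ) from
    (A.hasFDerivAt.comp_hasDerivAt τ h3).deriv, ← ofReal_norm]
  exact ENNReal.ofReal_le_ofReal (hA _ (hcs τ hτ).2 _)

/-- A short path starting near the centre of a ball stays in the ball. -/
theorem mapsTo_closedBall_of_pathELength_lt [T2Space M] {y₀ : Plane} {R m : ℝ} (hm : 0 < m)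
    (hR : Metric.closedBall y₀ R ⊆ (extChartAt (𝓡 2) x).target)
    (hmR : ∀ y ∈ Metric.closedBall y₀ R, ∀ w, m * ‖w‖ ≤ speed x y w)
    (hγ : ContMDiff 𝓘(ℝ, ℝ) (𝓡 2) 1 γ) {a : Plane} (ha : γ 0 = (extChartAt (𝓡 2) x).symm a)
    {L : ℝ} (hL : pathELength (𝓡 2) γ 0 1 < ENNReal.ofReal L) (haR : ‖a - y₀‖ + L / m ≤ R) :
    Set.Icc 0 1 ⊆ γ ⁻¹' ((extChartAt (𝓡 2) x).symm '' Metric.closedBall y₀ R) := by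
  have hL0 : 0 < L := by
    by_contra h
    rw [ENNReal.ofReal_of_nonpos (not_lt.1 h)] at hL
    exact not_lt_zero hL
  have haR' : a ∈ Metric.closedBall y₀ R := by
    rw [mem_closedBall_iff_norm]
    exact (le_add_of_nonneg_right (by positivity)).trans haR
  have hK : IsCompact ((extChartAt (𝓡 2) x).symm '' Metric.closedBall y₀ R) :=
    (isCompact_closedBall y₀ R).image_of_continuousOn ((continuousOn_extChartAt_symm x).mono hR)
  -- Continuous induction: the times in question form a closed set because the image of the ball is
  -- compact in a Hausdorff space. As long as the path has stayed inside, the length bound keeps it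
  -- in the open ball, so it stays a little longer.
  refine IsClosed.Icc_subset_of_forall_mem_nhdsGT_of_Icc_subset
    ((hK.isClosed.preimage hγ.continuous).inter isClosed_Icc) ⟨a, haR', ha.symm⟩
    fun t ht hsub ↦ mem_nhdsWithin_of_mem_nhds ?_
  have hlen : ‖(m • ContinuousLinearMap.id ℝ Plane)
      (extChartAt (𝓡 2) x (γ t) - extChartAt (𝓡 2) x (γ 0))‖ₑ < ENNReal.ofReal L := by
    refine (enorm_le_pathELength (m • ContinuousLinearMap.id ℝ Plane) hR (fun y hy w ↦ ?_) hγ ht.1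
      hsub).trans_lt ((pathELength_mono le_rfl ht.2.le).trans_lt hL)
    simpa [norm_smul, abs_of_pos hm] using hmR y hy w
  rw [← ofReal_norm, ENNReal.ofReal_lt_ofReal_iff hL0, ha,
    (extChartAt (𝓡 2) x).right_inv (hR haR')] at hlen
  simp only [smul_apply, ContinuousLinearMap.id_apply, norm_smul, Real.norm_eq_abs,
    abs_of_pos hm] at hlen
  obtain ⟨y, hy, hyγ⟩ := hsub ⟨ht.1, le_rfl⟩
  have hsrc : γ t ∈ (extChartAt (𝓡 2) x).source := by
    rw [← hyγ]; exact (extChartAt (𝓡 2) x).map_target (hR hy)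
  have hball : extChartAt (𝓡 2) x (γ t) ∈ Metric.ball y₀ R := by
    rw [mem_ball_iff_norm]
    calc _ ≤ ‖extChartAt (𝓡 2) x (γ t) - a‖ + ‖a - y₀‖ := norm_sub_le_norm_sub_add_norm_sub _ _ _
      _ < L / m + ‖a - y₀‖ := by gcongr; rwa [lt_div_iff₀' hm]
      _ ≤ R := by linarith
  have h5 : ContinuousAt (fun τ ↦ extChartAt (𝓡 2) x (γ τ)) t :=
    (contDiffAt_chart_path hγ hsrc).continuousAt
  filter_upwards [h5.preimage_mem_nhds (Metric.isOpen_ball.mem_nhds hball),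
    hγ.continuous.continuousAt.preimage_mem_nhds
      ((isOpen_extChartAt_source x).mem_nhds hsrc)] with τ h6 h7
  exact ⟨_, Metric.ball_subset_closedBall h6, (extChartAt (𝓡 2) x).left_inv h7⟩

variable [IsContMDiffRiemannianBundle (𝓡 2) ∞ Plane (fun x : M ↦ TangentSpace (𝓡 2) x)]

/-- The Riemannian distance, compared with the norm given by the metric at one point. -/
theorem exists_abs_riemannianEDist_sub_speed_le [T2Space M] {y₀ : Plane}
    (hy₀ : y₀ ∈ (extChartAt (𝓡 2) x).target) :
    ∃ C ≥ (0 : ℝ), ∃ r > (0 : ℝ), ∀ a ∈ Metric.ball y₀ r, ∀ b ∈ Metric.ball y₀ r,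
      riemannianEDist (𝓡 2) ((extChartAt (𝓡 2) x).symm a) ((extChartAt (𝓡 2) x).symm b) ≠ ⊤ ∧
      |(riemannianEDist (𝓡 2) ((extChartAt (𝓡 2) x).symm a)
          ((extChartAt (𝓡 2) x).symm b)).toReal - speed x y₀ (b - a)|
        ≤ C * (‖a - y₀‖ + ‖b - y₀‖) * ‖b - a‖ := by
  obtain ⟨m, hm, B, hB, C, hC, R, hR, hsub, hbd⟩ := exists_speed_bounds hy₀
  -- A path of length below (B + 1)ρ moves by at most (B + 1)ρ/m in the chart, so, starting within ρ
  -- of the centre, it stays within Kρ.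
  set K := 1 + (B + 1) / m with hK
  have hKpos : 0 < K := by positivity
  have hK1 : 1 ≤ K := by rw [hK]; linarith [show 0 < (B + 1) / m by positivity]
  refine ⟨C * K * (B / m + 1), by positivity, R / (2 * K), by positivity, fun a ha b hb ↦ ?_⟩
  set ρ := ‖a - y₀‖ + ‖b - y₀‖ with hρ
  have hρ0 : 0 ≤ ρ := by positivity
  have hρR : K * ρ ≤ R := by
    rw [mem_ball_iff_norm, lt_div_iff₀ (by positivity)] at ha hb
    rw [hρ]
    linarith
  have hab : ‖b - a‖ ≤ ρ := by
    rw [hρ, add_comm, ← norm_sub_rev y₀ a]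
    exact norm_sub_le_norm_sub_add_norm_sub _ _ _
  have hball : Metric.closedBall y₀ ρ ⊆ Metric.closedBall y₀ R :=
    Metric.closedBall_subset_closedBall (by nlinarith)
  have haρ : a ∈ Metric.closedBall y₀ ρ := by
    rw [mem_closedBall_iff_norm, hρ]; linarith [norm_nonneg (b - y₀)]
  have hbρ : b ∈ Metric.closedBall y₀ ρ := by
    rw [mem_closedBall_iff_norm, hρ]; linarith [norm_nonneg (a - y₀)]
  have hup := riemannianEDist_symm_le (convex_closedBall y₀ ρ) (hball.trans hsub) haρ hbρ
    (S := speed x y₀ (b - a) + C * ρ * ‖b - a‖) (fun y hy ↦ by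
      have h1 := (abs_le.1 (hbd y (hball hy) (b - a)).2.2).2
      have h2 : C * ‖y - y₀‖ * ‖b - a‖ ≤ C * ρ * ‖b - a‖ := by
        have := mem_closedBall_iff_norm.1 hy
        gcongr
      linarith)
  set d := riemannianEDist (𝓡 2) ((extChartAt (𝓡 2) x).symm a) ((extChartAt (𝓡 2) x).symm b)
    with hd
  have hS := speed_nonneg x y₀ (b - a)
  have hfin : d ≠ ⊤ := ne_top_of_le_ne_top ENNReal.ofReal_ne_top hup
  refine ⟨hfin, ?_⟩
  have hup' : d.toReal ≤ speed x y₀ (b - a) + C * ρ * ‖b - a‖ :=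
    ENNReal.toReal_le_of_le_ofReal (by positivity) hup
  -- For ρ = 0 both points are the centre; for ρ > 0, B + 1 in place of B gives a strict bound and
  -- leaves room for lengths slightly above the distance.
  rcases hρ0.eq_or_lt with h0 | hpos
  · have hba : b = a := by
      rw [← h0] at hab
      exact sub_eq_zero.1 (norm_le_zero_iff.1 hab)
    simp [hd, hba, riemannianEDist_self, speed]
  have hB' : ENNReal.ofReal d.toReal < ENNReal.ofReal ((B + 1) * ρ) := by
    rw [ENNReal.ofReal_toReal hfin]
    refine (riemannianEDist_symm_le (convex_closedBall y₀ ρ) (hball.trans hsub) haρ hbρ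
      (S := B * ‖b - a‖) (fun y hy ↦ (hbd y (hball hy) (b - a)).2.1)).trans_lt ?_
    rw [ENNReal.ofReal_lt_ofReal_iff (by positivity)]
    nlinarith
  rw [ENNReal.ofReal_lt_ofReal_iff (by positivity)] at hB'
  have hlow : ∀ L, d.toReal < L → L < (B + 1) * ρ →
      (1 - C * (K * ρ) / m) * speed x y₀ (b - a) ≤ L := by
    intro L hL1 hL2
    have hL0 : 0 < L := ENNReal.toReal_nonneg.trans_lt hL1
    have hdL : d < ENNReal.ofReal L := by
      rwa [ENNReal.lt_ofReal_iff_toReal_lt hfin]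
    obtain ⟨γ, hγ0, hγ1, hγ, hlen, -⟩ := exists_lt_locally_constant_of_riemannianEDist_lt hdL
      (zero_lt_one (α := ℝ))
    have hball' : Metric.closedBall y₀ (K * ρ) ⊆ Metric.closedBall y₀ R :=
      Metric.closedBall_subset_closedBall hρR
    have hstay := mapsTo_closedBall_of_pathELength_lt hm (hball'.trans hsub)
      (fun y hy w ↦ (hbd y (hball' hy) w).1) hγ hγ0 hlen (by
        have h1 : L / m ≤ (B + 1) / m * ρ := by
          rw [div_mul_eq_mul_div]; gcongr
        have h2 : ‖a - y₀‖ ≤ ρ := mem_closedBall_iff_norm.1 haρ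
        rw [hK]; linarith)
    rcases le_or_gt (1 - C * (K * ρ) / m) 0 with hneg | hpos'
    · exact (mul_nonpos_of_nonpos_of_nonneg hneg hS).trans hL0.le
    rcases hS.eq_or_lt with hS0 | hSpos
    · rw [← hS0, mul_zero]; exact hL0.le
    set k := 1 - C * (K * ρ) / m with hk
    -- A calibration: the unit covector of b - a for the metric at `y₀`, shrunk by the factor k so
    -- that it is dominated by the metric on the whole ball. Its value on b - a is k times the
    -- length to be estimated.
    set A : Plane →L[ℝ] ℝ := (k / speed x y₀ (b - a)) • metricForm x y₀ (b - a) with hA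
    have hAw : ∀ y ∈ Metric.closedBall y₀ (K * ρ), ∀ w, ‖A w‖ ≤ speed x y w := by
      intro y hy w
      have h1 := abs_metricForm_le x y₀ (b - a) w
      have h2 := hbd y (hball' hy) w
      have h3 := (abs_le.1 h2.2.2).1
      have h4 : C * ‖y - y₀‖ * ‖w‖ ≤ C * (K * ρ) / m * speed x y₀ w := by
        have h5 := (hbd y₀ (Metric.mem_closedBall_self hR.le) w).1
        have h6 := mem_closedBall_iff_norm.1 hy
        calc _ ≤ C * (K * ρ) * ‖w‖ := by gcongr
          _ = C * (K * ρ) / m * (m * ‖w‖) := by field_simp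
          _ ≤ _ := by gcongr
      calc ‖A w‖ = k / speed x y₀ (b - a) * |metricForm x y₀ (b - a) w| := by
            rw [hA, smul_apply, norm_smul, Real.norm_of_nonneg (by positivity), Real.norm_eq_abs]
        _ ≤ k / speed x y₀ (b - a) * (speed x y₀ (b - a) * speed x y₀ w) := by gcongr
        _ = k * speed x y₀ w := by field_simp
        _ ≤ _ := by rw [hk]; linarith
    have h7 := enorm_le_pathELength A (hball'.trans hsub) hAw hγ zero_le_one hstay
    rw [hγ0, hγ1, (extChartAt (𝓡 2) x).right_inv ((hball.trans hsub) haρ),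
      (extChartAt (𝓡 2) x).right_inv ((hball.trans hsub) hbρ)] at h7
    have h8 := h7.trans hlen.le
    rw [← ofReal_norm, ENNReal.ofReal_le_ofReal_iff hL0.le, hA, smul_apply, smul_eq_mul,
      ← speed_sq, pow_two, Real.norm_of_nonneg (by positivity)] at h8
    calc _ = k / speed x y₀ (b - a) * (speed x y₀ (b - a) * speed x y₀ (b - a)) := by
          field_simp
      _ ≤ L := h8
  have hlow' : (1 - C * (K * ρ) / m) * speed x y₀ (b - a) ≤ d.toReal := by
    by_contra! h
    -- The bound holds for every length just above the distance, hence for the distance itself.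
    obtain ⟨L, hL1, hL2⟩ := exists_between (lt_min h hB')
    exact absurd (hlow L hL1 (hL2.trans_le (min_le_right _ _)))
      (not_le.2 (hL2.trans_le (min_le_left _ _)))
  have hBs := (hbd y₀ (Metric.mem_closedBall_self hR.le) (b - a)).2.1
  have h9 : C * (K * ρ) / m * speed x y₀ (b - a) ≤ C * K * (B / m) * ρ * ‖b - a‖ := by
    calc _ ≤ C * (K * ρ) / m * (B * ‖b - a‖) := by gcongr
      _ = _ := by field_simp
  have h10 : 0 ≤ C * K * ρ * ‖b - a‖ := by positivity
  have h11 : 0 ≤ C * K * (B / m) * ρ * ‖b - a‖ := by positivity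
  have h12 : C * ρ * ‖b - a‖ ≤ C * K * ρ * ‖b - a‖ := by
    have : C * 1 ≤ C * K := by gcongr
    rw [mul_one] at this
    gcongr
  rw [abs_le]
  constructor <;> linarith

end Paths

/-! ### The journeys assembled in the chart around the starting point -/

section Journeys

local instance : NormedAddCommGroup (Plane →L[ℝ] Plane →L[ℝ] Plane) :=
  ContinuousLinearMap.toNormedAddCommGroup

local instance : NormedSpace ℝ (Plane →L[ℝ] Plane →L[ℝ] Plane) :=
  ContinuousLinearMap.toNormedSpace

variable {M : Type*} [TopologicalSpace M] [ChartedSpace Plane M] [T2Space M]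
  [IsManifold (𝓡 2) ∞ M] [RiemannianBundle (fun x : M ↦ TangentSpace (𝓡 2) x)]
  [IsContMDiffRiemannianBundle (𝓡 2) ∞ Plane (fun x : M ↦ TangentSpace (𝓡 2) x)]
  {o : ∀ x : M, Orientation ℝ (TangentSpace (𝓡 2) x) (Fin 2)} {x : M} {ε : ℝ} {y a b : Plane}

omit [T2Space M] [IsManifold (𝓡 2) ∞ M]
  [IsContMDiffRiemannianBundle (𝓡 2) ∞ Plane (fun x : M ↦ TangentSpace (𝓡 2) x)] in
theorem rotation_neg : rotation ε x y (-a) = -rotation ε x y a := by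
  simp only [rotation, map_neg, neg_apply, neg_smul]
  module

/-- Since J² = -1, the rotation frame of the turned velocity is `turnLeft` of the rotation frame.
The intrinsic turn thus becomes the linear turn used for the jets. -/
theorem exists_leg_turnLeft (hε : ε ^ 2 = 1) (hy : y ∈ (extChartAt (𝓡 2) x).target)
    (ho : ∀ᶠ w in 𝓝 y, RotatesBy o ε x w) (hb : rotation ε x y a = b) (hb0 : b ≠ 0)
    {z : ℝ → Plane × Plane} (hz : Tendsto z (𝓝 0) (𝓝 (y, a))) :
    ∃ z' : ℝ → Plane × Plane, (∀ᶠ s in 𝓝 0, ∀ η : TangentBundle (𝓡 2) M,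
        IsLeg s (leftTurn o (tangentPoint x (z s))) η ↔ η = tangentPoint x (z' s)) ∧
      FlowsTo (frameField (christoffelForm x)) (y, b, -a)
        (fun s ↦ turnLeft (rotationFrame ε x (z s))) (fun s ↦ rotationFrame ε x (z' s)) ∧
      Tendsto z' (𝓝 0) (𝓝 (y, b)) := by
  have h1 : Tendsto (fun s ↦ ((z s).1, rotation ε x (z s).1 (z s).2)) (𝓝 0) (𝓝 (y, b)) := by
    rw [← hb]
    exact ((continuousAt_fst.prodMk
      (contDiffAt_rotation (z := (y, a)) hy).continuousAt).tendsto).comp hz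
  obtain ⟨z', h2, h3, h4⟩ := exists_leg hε hy hb0 h1
  have h5 : Tendsto (fun s ↦ (z s).1) (𝓝 0) (𝓝 y) := (continuous_fst.tendsto _).comp hz
  refine ⟨z', ?_, ?_, h4⟩
  · filter_upwards [h2, h5.eventually ho] with s h6 h7
    rwa [show leftTurn o (tangentPoint x (z s)) = _ from h7.leftTurn _]
  · have h6 : rotationFrame ε x (y, b) = (y, b, -a) := by
      simp [rotationFrame, ← hb, rotation_rotation hε hy]
    rw [h6] at h3
    refine h3.congr_left ?_
    filter_upwards [h5 ((isOpen_extChartAt_target x).mem_nhds hy)] with s hs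
    simp [rotationFrame, rotation_rotation hε hs]

theorem exists_leg_turnRight (hε : ε ^ 2 = 1) (hy : y ∈ (extChartAt (𝓡 2) x).target)
    (ho : ∀ᶠ w in 𝓝 y, RotatesBy o ε x w) (hb : rotation ε x y a = -b) (hb0 : b ≠ 0)
    {z : ℝ → Plane × Plane} (hz : Tendsto z (𝓝 0) (𝓝 (y, a))) :
    ∃ z' : ℝ → Plane × Plane, (∀ᶠ s in 𝓝 0, ∀ η : TangentBundle (𝓡 2) M,
        IsLeg s (rightTurn o (tangentPoint x (z s))) η ↔ η = tangentPoint x (z' s)) ∧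
      FlowsTo (frameField (christoffelForm x)) (y, b, a)
        (fun s ↦ turnRight (rotationFrame ε x (z s))) (fun s ↦ rotationFrame ε x (z' s)) ∧
      Tendsto z' (𝓝 0) (𝓝 (y, b)) := by
  have h1 : Tendsto (fun s ↦ ((z s).1, -rotation ε x (z s).1 (z s).2)) (𝓝 0) (𝓝 (y, b)) := by
    rw [show b = -rotation ε x y a by rw [hb, neg_neg]]
    exact ((continuousAt_fst.prodMk
      (contDiffAt_rotation (z := (y, a)) hy).continuousAt.neg).tendsto).comp hz
  obtain ⟨z', h2, h3, h4⟩ := exists_leg hε hy hb0 h1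
  have h5 : Tendsto (fun s ↦ (z s).1) (𝓝 0) (𝓝 y) := (continuous_fst.tendsto _).comp hz
  refine ⟨z', ?_, ?_, h4⟩
  · filter_upwards [h2, h5.eventually ho] with s h6 h7
    rwa [show rightTurn o (tangentPoint x (z s)) = _ from h7.rightTurn _]
  · have h6 : rotationFrame ε x (y, b) = (y, b, a) := by
      have := rotation_rotation hε hy a
      rw [hb, rotation_neg, neg_inj] at this
      simp [rotationFrame, this]
    rw [h6] at h3
    refine h3.congr_left ?_
    filter_upwards [h5 ((isOpen_extChartAt_target x).mem_nhds hy)] with s hs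
    simp [rotationFrame, rotation_neg, rotation_rotation hε hs]

/-- The two journeys, in the chart around the starting point. -/
theorem exists_journeys (p : M) (hε : ε ^ 2 = 1)
    (ho : ∀ᶠ w in 𝓝 (extChartAt (𝓡 2) p p), RotatesBy o ε p w)
    (haa : metricForm p (extChartAt (𝓡 2) p p) a a = 1)
    (hab : rotation ε p (extChartAt (𝓡 2) p p) a = b) :
    ∃ c₁ c₂ c₃ c₄ d₁ d₂ : ℝ → Plane,
      (∀ᶠ s in 𝓝 (0 : ℝ),
        (∀ p₁ p₂ p₃ p₄ : M,
          IsLeftJourney o s (tangentPoint p (extChartAt (𝓡 2) p p, a)) p₁ p₂ p₃ p₄ ↔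
            p₁ = (extChartAt (𝓡 2) p).symm (c₁ s) ∧ p₂ = (extChartAt (𝓡 2) p).symm (c₂ s) ∧
            p₃ = (extChartAt (𝓡 2) p).symm (c₃ s) ∧ p₄ = (extChartAt (𝓡 2) p).symm (c₄ s)) ∧
        (∀ q₁ q₂ : M,
          IsRightJourney o s (tangentPoint p (extChartAt (𝓡 2) p p, b)) q₁ q₂ ↔
            q₁ = (extChartAt (𝓡 2) p).symm (d₁ s) ∧ q₂ = (extChartAt (𝓡 2) p).symm (d₂ s))) ∧
      (fun s ↦ c₄ s - extChartAt (𝓡 2) p p - s ^ 3 • (gaussCurvature p / 2) • (a - b))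
        =O[𝓝 0] (fun s ↦ s ^ 4) ∧
      (fun s ↦ d₂ s - c₂ s - s ^ 3 • (gaussCurvature p / 2) • (a - b))
        =O[𝓝 0] (fun s ↦ s ^ 4) ∧
      (fun s ↦ c₂ s - extChartAt (𝓡 2) p p) =O[𝓝 0] (fun s ↦ s) ∧
      (fun s ↦ d₂ s - extChartAt (𝓡 2) p p) =O[𝓝 0] (fun s ↦ s) := by
  set y := extChartAt (𝓡 2) p p with hy'
  have hy : y ∈ (extChartAt (𝓡 2) p).target := mem_extChartAt_target p
  have hbb : metricForm p y b b = 1 := by rw [← hab, metricForm_rotation_rotation hε hy, haa]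
  have hab' : metricForm p y a b = 0 := by
    rw [metricForm_comm, ← hab, metricForm_rotation_self]
  have hba : rotation ε p y b = -a := by rw [← hab, rotation_rotation hε hy]
  have ha0 : a ≠ 0 := by rintro rfl; simp at haa
  have hb0 : b ≠ 0 := by rintro rfl; simp at hbb
  obtain ⟨z₁, i₁, f₁, t₁⟩ := exists_leg hε (z₀ := (y, a)) hy ha0 tendsto_const_nhds
  obtain ⟨z₂, i₂, f₂, t₂⟩ := exists_leg_turnLeft hε hy ho hab hb0 t₁
  obtain ⟨z₃, i₃, f₃, t₃⟩ := exists_leg_turnLeft hε hy ho hba (neg_ne_zero.2 ha0) t₂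
  -- The limiting velocities of the four legs are a, b, -a, -b.
  obtain ⟨z₄, i₄, f₄, -⟩ := exists_leg_turnLeft hε hy ho (b := -b)
    (by rw [rotation_neg, hab]) (neg_ne_zero.2 hb0) t₃
  obtain ⟨w₁, j₁, g₁, k₁⟩ := exists_leg hε (z₀ := (y, b)) hy hb0 tendsto_const_nhds
  obtain ⟨w₂, j₂, g₂, -⟩ := exists_leg_turnRight hε hy ho hba ha0 k₁
  simp only [rotationFrame, hab, hba] at f₁ g₁
  rw [neg_neg] at f₄
  have hΓ : ContDiffAt ℝ 3 (christoffelForm p) y :=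
    (contDiffAt_christoffelForm hy).of_le (WithTop.coe_le_coe.2 le_top)
  have hs : ∀ c d, christoffelForm p y c d = christoffelForm p y d c := christoffelForm_comm p y
  have hs' := fderiv_christoffelForm_comm hy
  have hκ := curvature_orthonormal p haa hbb hab'
  have e₁ := left_journey_four hΓ hs hs' f₁ f₂ f₃ f₄
  have e₂ := two_journeys hΓ hs hs' f₁ f₂ g₁ g₂
  have e₃ := (left_journey_two hΓ hs hs' f₁ f₂).isBigO_one
  have e₄ := (right_journey_two hΓ hs hs' g₁ g₂).isBigO_one
  rw [← hy'] at hκ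
  rw [hκ] at e₁ e₂
  refine ⟨fun s ↦ (z₁ s).1, fun s ↦ (z₂ s).1, fun s ↦ (z₃ s).1, fun s ↦ (z₄ s).1,
    fun s ↦ (w₁ s).1, fun s ↦ (w₂ s).1, ?_, e₁, e₂, ?_, ?_⟩
  · filter_upwards [i₁, i₂, i₃, i₄, j₁, j₂] with s i₁ i₂ i₃ i₄ j₁ j₂
    constructor
    · intro p₁ p₂ p₃ p₄
      constructor
      · rintro ⟨η₁, η₂, η₃, η₄, h1, h2, h3, h4, rfl, rfl, rfl, rfl⟩
        obtain rfl := (i₁ _).1 h1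
        obtain rfl := (i₂ _).1 h2
        obtain rfl := (i₃ _).1 h3
        obtain rfl := (i₄ _).1 h4
        exact ⟨rfl, rfl, rfl, rfl⟩
      · rintro ⟨rfl, rfl, rfl, rfl⟩
        exact ⟨_, _, _, _, (i₁ _).2 rfl, (i₂ _).2 rfl, (i₃ _).2 rfl, (i₄ _).2 rfl,
          rfl, rfl, rfl, rfl⟩
    · intro q₁ q₂
      constructor
      · rintro ⟨η₁, η₂, h1, h2, rfl, rfl⟩
        obtain rfl := (j₁ _).1 h1
        obtain rfl := (j₂ _).1 h2
        exact ⟨rfl, rfl⟩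
      · rintro ⟨rfl, rfl⟩
        exact ⟨_, _, (j₁ _).2 rfl, (j₂ _).2 rfl, rfl, rfl⟩
  · exact ((ContinuousLinearMap.fst ℝ Plane (Plane × Plane)).isBigO_comp _ _).trans e₃
  · exact ((ContinuousLinearMap.fst ℝ Plane (Plane × Plane)).isBigO_comp _ _).trans e₄

end Journeys

/-! ### Cubic gaps: limits through smooth maps, and sizes -/

section Gap

/-- The limit of a gap of third order, read through a strictly differentiable map. -/
theorem tendsto_inv_pow_smul_sub {E F : Type*} [NormedAddCommGroup E] [NormedSpace ℝ E]
    [NormedAddCommGroup F] [NormedSpace ℝ F] {h : E → F} {D : E →L[ℝ] F} {y w : E}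
    (hD : HasStrictFDerivAt h D y) {c d : ℝ → E} (hc : Tendsto c (𝓝 0) (𝓝 y))
    (hd : Tendsto d (𝓝 0) (𝓝 y))
    (hcd : (fun s ↦ d s - c s - s ^ 3 • w) =O[𝓝 0] fun s ↦ s ^ 4) :
    Tendsto (fun s : ℝ ↦ (s ^ 3)⁻¹ • (h (d s) - h (c s))) (𝓝[≠] 0) (𝓝 (D w)) := by
  have h43 : (fun s : ℝ ↦ s ^ 4) =o[𝓝 0] fun s ↦ s ^ 3 := isLittleO_pow_pow (by norm_num)
  have h1 : (fun s ↦ d s - c s) =O[𝓝 0] fun s : ℝ ↦ s ^ 3 := by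
    simpa using (hcd.trans h43.isBigO).add (isBigO_smul_const (f := fun s : ℝ ↦ s ^ 3) w)
  -- Strict differentiability is what allows both ends of the gap to move with s, as for `P₂` and
  -- `Q₂`.
  have h2 := (hD.isLittleO.comp_tendsto (hd.prodMk_nhds hc)).trans_isBigO h1
  have h3 := ((D.isBigO_comp (fun s ↦ d s - c s - s ^ 3 • w) (𝓝 0)).trans hcd).trans_isLittleO h43
  have h4 : (fun s ↦ h (d s) - h (c s) - s ^ 3 • D w) =o[𝓝 0] fun s : ℝ ↦ s ^ 3 := by
    refine (h2.add h3).congr_left fun s ↦ ?_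
    simp only [Function.comp_apply, map_sub, map_smul]
    abel
  rw [tendsto_iff_norm_sub_tendsto_zero]
  have h5 := (h4.mono (nhdsWithin_le_nhds (s := {0}ᶜ))).norm_norm.tendsto_div_nhds_zero
  refine h5.congr' ?_
  filter_upwards [self_mem_nhdsWithin] with s hs
  have hs3 : s ^ 3 ≠ 0 := pow_ne_zero _ hs
  rw [div_eq_inv_mul, ← norm_inv, ← norm_smul, smul_sub, inv_smul_smul₀ hs3]

variable {M : Type*} [TopologicalSpace M] [ChartedSpace Plane M] [T2Space M]
  [IsManifold (𝓡 2) ∞ M] [RiemannianBundle (fun x : M ↦ TangentSpace (𝓡 2) x)]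
  [IsContMDiffRiemannianBundle (𝓡 2) ∞ Plane (fun x : M ↦ TangentSpace (𝓡 2) x)]

omit [T2Space M] [IsManifold (𝓡 2) ∞ M]
  [IsContMDiffRiemannianBundle (𝓡 2) ∞ Plane (fun x : M ↦ TangentSpace (𝓡 2) x)] in
theorem speed_smul (x : M) (y a : Plane) (r : ℝ) : speed x y (r • a) = |r| * speed x y a := by
  rw [← norm_chartFrame, ← norm_chartFrame, map_smul]
  exact norm_smul (β := TangentSpace (𝓡 2) ((extChartAt (𝓡 2) x).symm y)) r _

omit [T2Space M] [IsManifold (𝓡 2) ∞ M]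
  [IsContMDiffRiemannianBundle (𝓡 2) ∞ Plane (fun x : M ↦ TangentSpace (𝓡 2) x)] in
theorem abs_speed_sub_le (x : M) (y a b : Plane) :
    |speed x y a - speed x y b| ≤ speed x y (a - b) := by
  rw [← norm_chartFrame, ← norm_chartFrame, ← norm_chartFrame, map_sub]
  exact abs_norm_sub_norm_le (E := TangentSpace (𝓡 2) ((extChartAt (𝓡 2) x).symm y)) _ _

/-- The size of a gap of third order. -/
theorem isBigO_riemannianEDist_sub {x : M} {y w : Plane}
    (hy : y ∈ (extChartAt (𝓡 2) x).target) {c d : ℝ → Plane}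
    (hc : (fun s ↦ c s - y) =O[𝓝 0] fun s ↦ s) (hd : (fun s ↦ d s - y) =O[𝓝 0] fun s ↦ s)
    (hcd : (fun s ↦ d s - c s - s ^ 3 • w) =O[𝓝 0] fun s ↦ s ^ 4) :
    (∀ᶠ s in 𝓝 0, riemannianEDist (𝓡 2) ((extChartAt (𝓡 2) x).symm (c s))
      ((extChartAt (𝓡 2) x).symm (d s)) ≠ ⊤) ∧
    (fun s ↦ (riemannianEDist (𝓡 2) ((extChartAt (𝓡 2) x).symm (c s))
      ((extChartAt (𝓡 2) x).symm (d s))).toReal - |s| ^ 3 * speed x y w)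
        =O[𝓝 0] fun s ↦ s ^ 4 := by
  obtain ⟨C, hC, r, hr, h⟩ := exists_abs_riemannianEDist_sub_speed_le hy
  obtain ⟨m, -, B, hB, K, -, R, hR, -, hbd⟩ := exists_speed_bounds hy
  have tend : ∀ {c : ℝ → Plane}, ((fun s ↦ c s - y) =O[𝓝 0] fun s ↦ s) →
      ∀ᶠ s in 𝓝 0, c s ∈ Metric.ball y r := by
    intro c hc
    have h1 := hc.trans_tendsto tendsto_id
    exact (tendsto_sub_nhds_zero_iff.1 h1).eventually (Metric.ball_mem_nhds y hr)
  refine ⟨by filter_upwards [tend hc, tend hd] with s h1 h2 using (h _ h1 _ h2).1, ?_⟩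
  have h1 : (fun s ↦ d s - c s) =O[𝓝 0] fun s : ℝ ↦ s ^ 3 := by
    simpa using (hcd.trans (isBigO_pow_pow_zero (by norm_num))).add
      (isBigO_smul_const (f := fun s : ℝ ↦ s ^ 3) w)
  -- The comparison error is the product of the O(s) distance to the centre and the O(s³) gap.
  have h2 : (fun s ↦ C * (‖c s - y‖ + ‖d s - y‖) * ‖d s - c s‖) =O[𝓝 0] fun s : ℝ ↦ s ^ 4 := by
    refine (((hc.norm_left.add hd.norm_left).const_mul_left C).mul h1.norm_left).congr_right
      fun s ↦ by ring
  have h3 : (fun s ↦ B * ‖d s - c s - s ^ 3 • w‖) =O[𝓝 0] fun s : ℝ ↦ s ^ 4 :=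
    hcd.norm_left.const_mul_left B
  refine IsBigO.trans (IsBigO.of_bound 1 ?_) (h2.add h3)
  filter_upwards [tend hc, tend hd] with s h4 h5
  have h6 := (h _ h4 _ h5).2
  have h7 := abs_speed_sub_le x y (d s - c s) (s ^ 3 • w)
  have h8 := (hbd y (Metric.mem_closedBall_self hR.le) (d s - c s - s ^ 3 • w)).2.1
  rw [speed_smul, abs_pow] at h7
  rw [one_mul, Real.norm_eq_abs, Real.norm_of_nonneg (by positivity)]
  exact (abs_sub_le _ (speed x y (d s - c s)) _).trans (add_le_add h6 (h7.trans h8))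

end Gap

/-! ### Angles of the gaps -/

section Angles

variable {V : Type*} [NormedAddCommGroup V] [InnerProductSpace ℝ V]
  [Fact (Module.finrank ℝ V = 2)] (o : Orientation ℝ V (Fin 2)) {u v : V}

/-- The squared area of an orthonormal pair is 1, so a positive area is 1. Hence ⟨J u, v⟩ = 1 for
unit vectors, which forces equality. -/
theorem rightAngleRotation_eq_of_orthonormal (hu : ‖u‖ = 1) (hv : ‖v‖ = 1)
    (huv : inner ℝ u v = 0) (h : 0 < o.areaForm u v) : o.rightAngleRotation u = v := by
  have h1 := o.inner_sq_add_areaForm_sq u v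
  rw [huv, hu, hv] at h1
  have h2 : o.areaForm u v = 1 := by nlinarith
  rw [← inner_eq_one_iff_of_norm_eq_one (𝕜 := ℝ) (by simpa using hu) hv,
    o.inner_rightAngleRotation_left, h2]

/-- The angle of u + r J u with u is arctan r; here r = -1. -/
theorem oangle_sub_rightAngleRotation (hu : u ≠ 0) :
    o.oangle u (u - o.rightAngleRotation u) = ((-(Real.pi / 4) : ℝ) : Real.Angle) := by
  have h := o.oangle_add_right_smul_rotation_pi_div_two hu (-1)
  rwa [o.rotation_pi_div_two, neg_one_smul, ← sub_eq_add_neg, Real.arctan_neg,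
    Real.arctan_one] at h

theorem sub_rightAngleRotation_ne_zero (hu : u ≠ 0) : u - o.rightAngleRotation u ≠ 0 := by
  intro h
  have h1 := o.inner_rightAngleRotation_self u
  rw [← sub_eq_zero.1 h] at h1
  exact hu (inner_self_eq_zero.1 h1)

/-- The limiting direction of a gap of third order. -/
theorem tendsto_oangle_gap (hu : u ≠ 0) {k : ℝ} {T : ℝ → V}
    (hT : Tendsto (fun s : ℝ ↦ (s ^ 3)⁻¹ • T s) (𝓝[≠] 0)
      (𝓝 (k • (u - o.rightAngleRotation u)))) :
    (0 < k → Tendsto (fun s ↦ o.oangle u (T s)) (𝓝[>] 0)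
      (𝓝 ((-(Real.pi / 4) : ℝ) : Real.Angle))) ∧
    (k < 0 → Tendsto (fun s ↦ o.oangle u (T s)) (𝓝[>] 0)
      (𝓝 ((3 * Real.pi / 4 : ℝ) : Real.Angle))) := by
  have hne := sub_rightAngleRotation_ne_zero o hu
  have key : k ≠ 0 → Tendsto (fun s ↦ o.oangle u (T s)) (𝓝[>] 0)
      (𝓝 (o.oangle u (k • (u - o.rightAngleRotation u)))) := by
    intro hk
    have h1 : Tendsto (fun s : ℝ ↦ (u, (s ^ 3)⁻¹ • T s)) (𝓝[>] 0)
        (𝓝 (u, k • (u - o.rightAngleRotation u))) :=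
      tendsto_const_nhds.prodMk_nhds
        (hT.mono_left (nhdsWithin_mono _ fun s hs ↦ ne_of_gt (Set.mem_Ioi.1 hs)))
    have h2 := (o.continuousAt_oangle (x := (u, k • (u - o.rightAngleRotation u))) hu
      (smul_ne_zero hk hne)).tendsto.comp h1
    refine h2.congr' ?_
    filter_upwards [self_mem_nhdsWithin] with s hs
    -- For s > 0 the factor s⁻³ is positive and does not affect the angle; this is why the limit is
    -- one-sided.
    exact o.oangle_smul_right_of_pos _ _ (inv_pos.2 (pow_pos (Set.mem_Ioi.1 hs) 3))
  refine ⟨fun hk ↦ ?_, fun hk ↦ ?_⟩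
  · have h1 := key hk.ne'
    rwa [o.oangle_smul_right_of_pos _ _ hk, oangle_sub_rightAngleRotation o hu] at h1
  · have h1 := key hk.ne
    -- A negative k reverses the direction, so π is added to -π/4.
    rw [o.oangle_smul_right_of_neg _ _ hk, o.oangle_neg_right hu hne,
      oangle_sub_rightAngleRotation o hu, ← Real.Angle.coe_add] at h1
    convert h1 using 3
    ring

end Angles

/-! ### Identification of the chart data at the centre with data on the tangent plane at the point
-/

section Center

variable {M : Type*} [TopologicalSpace M] [ChartedSpace Plane M] {p : M} {a b : Plane}

/-- All tangent spaces have the model plane as underlying space, so only the base point has to be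
rewritten. -/
theorem tangentPoint_center :
    tangentPoint p (extChartAt (𝓡 2) p p, a) = ⟨p, chartFrame p (extChartAt (𝓡 2) p p) a⟩ := by
  have h : ∀ q q' : M, q = q' → ∀ w : Plane,
      (⟨q, w⟩ : TangentBundle (𝓡 2) M) = ⟨q', w⟩ := by rintro q _ rfl w; rfl
  exact h _ _ (extChartAt_to_inv p) _

theorem hasStrictFDerivAt_comp_symm [IsManifold (𝓡 2) ∞ M] {F : Type*} [NormedAddCommGroup F]
    [NormedSpace ℝ F] {f : M → F} {W : Set M} (hW : W ∈ 𝓝 p)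
    (hf : ContMDiffOn (𝓡 2) 𝓘(ℝ, F) ∞ f W) :
    ∃ D : Plane →L[ℝ] F, HasStrictFDerivAt (fun y ↦ f ((extChartAt (𝓡 2) p).symm y)) D
        (extChartAt (𝓡 2) p p) ∧
      ∀ a, D a = mfderiv (𝓡 2) 𝓘(ℝ, F) f p (chartFrame p (extChartAt (𝓡 2) p p) a) := by
  have hy : extChartAt (𝓡 2) p p ∈ (extChartAt (𝓡 2) p).target := mem_extChartAt_target p
  have h1 : ContMDiffAt (𝓡 2) 𝓘(ℝ, F) ∞ f
      ((extChartAt (𝓡 2) p).symm (extChartAt (𝓡 2) p p)) := by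
    rw [extChartAt_to_inv]; exact hf.contMDiffAt hW
  have h2 : ContMDiffAt 𝓘(ℝ, Plane) (𝓡 2) ∞ (extChartAt (𝓡 2) p).symm
      (extChartAt (𝓡 2) p p) := by
    have h : ContMDiffOn 𝓘(ℝ, Plane) (𝓡 2) ∞ (extChartAt (𝓡 2) p).symm
      (extChartAt (𝓡 2) p).target := contMDiffOn_extChartAt_symm p
    exact h.contMDiffAt ((isOpen_extChartAt_target p).mem_nhds hy)
  have h3 : ContDiffAt ℝ ∞ (fun y ↦ f ((extChartAt (𝓡 2) p).symm y)) (extChartAt (𝓡 2) p p) :=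
    contMDiffAt_iff_contDiffAt.1 (h1.comp _ h2)
  refine ⟨_, h3.hasStrictFDerivAt (by simp), fun a ↦ ?_⟩
  have h4 := mfderiv_comp _ (h1.mdifferentiableAt (by simp)) (h2.mdifferentiableAt (by simp))
  have h5 : ∀ q q' : M, q = q' → ∀ w : Plane,
      (mfderiv (𝓡 2) 𝓘(ℝ, F) f q w : F) = mfderiv (𝓡 2) 𝓘(ℝ, F) f q' w := by rintro q _ rfl w; rfl
  rw [mfderiv_eq_fderiv] at h4
  exact (congr($h4 a)).trans (h5 _ _ (extChartAt_to_inv p) _)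

variable [RiemannianBundle (fun x : M ↦ TangentSpace (𝓡 2) x)]

theorem metricForm_center : metricForm p (extChartAt (𝓡 2) p p) a b =
    fiberInner p (chartFrame p (extChartAt (𝓡 2) p p) a)
      (chartFrame p (extChartAt (𝓡 2) p p) b) := by
  rw [metricForm_apply, extChartAt_to_inv]

theorem RotatesBy.center {o : ∀ x : M, Orientation ℝ (TangentSpace (𝓡 2) x) (Fin 2)} {ε : ℝ}
    (h : RotatesBy o ε p (extChartAt (𝓡 2) p p)) (a : Plane) :
    ((o p).rightAngleRotation (chartFrame p (extChartAt (𝓡 2) p p) a) : Plane) =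
      chartFrame p (extChartAt (𝓡 2) p p) (rotation ε p (extChartAt (𝓡 2) p p) a) := by
  have h1 : ∀ q q' : M, q = q' → ∀ w : Plane,
      ((o q).rightAngleRotation w : Plane) = (o q').rightAngleRotation w := by
    rintro q _ rfl w; rfl
  exact (h1 _ _ (extChartAt_to_inv p).symm _).trans (h a)

theorem speed_gap (haa : metricForm p (extChartAt (𝓡 2) p p) a a = 1)
    (hbb : metricForm p (extChartAt (𝓡 2) p p) b b = 1)
    (hab : metricForm p (extChartAt (𝓡 2) p p) a b = 0) (κ r : ℝ) :
    |r| ^ 3 * speed p (extChartAt (𝓡 2) p p) ((κ / 2) • (a - b)) = |κ| * |r| ^ 3 / √2 := by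
  have h : speed p (extChartAt (𝓡 2) p p) (a - b) = √2 := by
    rw [speed]
    congr 1
    simp only [map_sub, sub_apply]
    rw [metricForm_comm p _ b a, haa, hbb, hab]
    norm_num
  have h2 : √2 * √2 = (2 : ℝ) := Real.mul_self_sqrt (by norm_num)
  rw [speed_smul, h, abs_div, abs_two]
  field_simp
  linear_combination (|r| ^ 3 * |κ|) * h2

end Center

end GeodesicGap

end

/-! ### The theorem on the geodesic gaps -/

open GeodesicGap in
theorem mainTheorem3 {M : Type*} [TopologicalSpace M] [T2Space M] [ChartedSpace Plane M]
    [IsManifold (𝓡 2) ∞ M]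
    [RiemannianBundle (fun x : M ↦ TangentSpace (𝓡 2) x)]
    [IsContMDiffRiemannianBundle (𝓡 2) ∞ Plane (fun x : M ↦ TangentSpace (𝓡 2) x)]
    (P₀ : M) (U : Set M) (hU : P₀ ∈ U)
    (o : ∀ x : M, Orientation ℝ (TangentSpace (𝓡 2) x) (Fin 2)) (ho : IsOrientationOn o U)
    (u v : TangentSpace (𝓡 2) P₀) (hu : ‖u‖ = 1) (hv : ‖v‖ = 1) (huv : inner ℝ u v = 0)
    (hright : RightHanded (o P₀) u v) :
    ∃ P₁ P₂ P₃ P₄ Q₁ Q₂ : ℝ → M,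
      -- for small `s` the two journeys exist, and these are the only ones
      (∀ᶠ s in 𝓝 (0 : ℝ),
        (∀ p₁ p₂ p₃ p₄ : M, IsLeftJourney o s ⟨P₀, u⟩ p₁ p₂ p₃ p₄ ↔
          p₁ = P₁ s ∧ p₂ = P₂ s ∧ p₃ = P₃ s ∧ p₄ = P₄ s) ∧
        (∀ q₁ q₂ : M, IsRightJourney o s ⟨P₀, v⟩ q₁ q₂ ↔ q₁ = Q₁ s ∧ q₂ = Q₂ s)) ∧
      -- the limits of the gaps, read through smooth maps to normed spaces
      (∀ (F : Type) [NormedAddCommGroup F] [NormedSpace ℝ F] (f : M → F) (W : Set M),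
        W ∈ 𝓝 P₀ → ContMDiffOn (𝓡 2) 𝓘(ℝ, F) ∞ f W →
        Tendsto (fun s : ℝ ↦ (s ^ 3)⁻¹ • (f (P₄ s) - f P₀)) (𝓝[≠] 0)
          (𝓝 (mfderiv (𝓡 2) 𝓘(ℝ, F) f P₀ ((gaussCurvature P₀ / 2) • (u - v)))) ∧
        Tendsto (fun s : ℝ ↦ (s ^ 3)⁻¹ • (f (Q₂ s) - f (P₂ s))) (𝓝[≠] 0)
          (𝓝 (mfderiv (𝓡 2) 𝓘(ℝ, F) f P₀ ((gaussCurvature P₀ / 2) • (u - v))))) ∧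
      -- the sizes of the gaps
      (∀ᶠ s in 𝓝 (0 : ℝ), riemannianEDist (𝓡 2) P₀ (P₄ s) ≠ ⊤ ∧
        riemannianEDist (𝓡 2) (P₂ s) (Q₂ s) ≠ ⊤) ∧
      ((fun s : ℝ ↦ (riemannianEDist (𝓡 2) P₀ (P₄ s)).toReal
          - |gaussCurvature P₀| * |s| ^ 3 / √2) =O[𝓝 0] fun s : ℝ ↦ s ^ 4) ∧
      ((fun s : ℝ ↦ (riemannianEDist (𝓡 2) (P₂ s) (Q₂ s)).toReal
          - |gaussCurvature P₀| * |s| ^ 3 / √2) =O[𝓝 0] fun s : ℝ ↦ s ^ 4) ∧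
      -- the angles of the gaps with the first leg, read through maps that are immersive at `P₀`
      (∀ (F : Type) [NormedAddCommGroup F] [NormedSpace ℝ F] (f : M → F) (W : Set M)
        (L : F →L[ℝ] TangentSpace (𝓡 2) P₀),
        W ∈ 𝓝 P₀ → ContMDiffOn (𝓡 2) 𝓘(ℝ, F) ∞ f W →
        (∀ w : TangentSpace (𝓡 2) P₀, L (mfderiv (𝓡 2) 𝓘(ℝ, F) f P₀ w) = w) →
        (0 < gaussCurvature P₀ →
          Tendsto (fun s : ℝ ↦ (o P₀).oangle u (L (f (P₄ s) - f P₀))) (𝓝[>] 0)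
            (𝓝 ((-(Real.pi / 4) : ℝ) : Real.Angle)) ∧
          Tendsto (fun s : ℝ ↦ (o P₀).oangle u (L (f (Q₂ s) - f (P₂ s)))) (𝓝[>] 0)
            (𝓝 ((-(Real.pi / 4) : ℝ) : Real.Angle))) ∧
        (gaussCurvature P₀ < 0 →
          Tendsto (fun s : ℝ ↦ (o P₀).oangle u (L (f (P₄ s) - f P₀))) (𝓝[>] 0)
            (𝓝 ((3 * Real.pi / 4 : ℝ) : Real.Angle)) ∧
          Tendsto (fun s : ℝ ↦ (o P₀).oangle u (L (f (Q₂ s) - f (P₂ s)))) (𝓝[>] 0)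
            (𝓝 ((3 * Real.pi / 4 : ℝ) : Real.Angle)))) := by
  set y := extChartAt (𝓡 2) P₀ P₀ with hy'
  have hy : y ∈ (extChartAt (𝓡 2) P₀).target := mem_extChartAt_target P₀
  obtain ⟨ε, hε, hrot⟩ := exists_rotatesBy ho hU
  obtain ⟨a, ha⟩ := chartFrame_surjective hy u
  obtain ⟨b, hb⟩ := chartFrame_surjective hy v
  have hu0 : u ≠ 0 := by
    rintro rfl
    simp at hu
  -- The chart computation knows only u and its quarter turn; right-handedness says that the latter
  -- is v.
  have hJ : (o P₀).rightAngleRotation u = v :=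
    rightAngleRotation_eq_of_orthonormal (o P₀) hu hv huv hright
  have hab : rotation ε P₀ y a = b := by
    refine chartFrame_injective hy ((hrot.self_of_nhds.center a).symm.trans ?_)
    rw [hb, ← hy', ha]
    exact hJ
  have hself : ∀ w : TangentSpace (𝓡 2) P₀, ‖w‖ = 1 → fiberInner P₀ w w = 1 := fun w hw ↦
    (real_inner_self_eq_norm_sq w).trans (by rw [hw, one_pow])
  have haa : metricForm P₀ y a a = 1 := by rw [hy', metricForm_center, ← hy', ha, hself u hu]
  have hbb : metricForm P₀ y b b = 1 := by rw [hy', metricForm_center, ← hy', hb, hself v hv]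
  have hab' : metricForm P₀ y a b = 0 := by
    rw [hy', metricForm_center, ← hy', ha, hb]; exact huv
  have hstart : ∀ {w : TangentSpace (𝓡 2) P₀} {c : Plane}, chartFrame P₀ y c = w →
      tangentPoint P₀ (y, c) = ⟨P₀, w⟩ := fun h ↦ by rw [hy', tangentPoint_center, ← hy', h]
  have hP₀ : (extChartAt (𝓡 2) P₀).symm y = P₀ := extChartAt_to_inv P₀
  obtain ⟨c₁, c₂, c₃, c₄, d₁, d₂, hj, hc₄, hd₂, hc₂, hd₂'⟩ := exists_journeys P₀ hε hrot haa hab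
  rw [← hy', hstart ha, hstart hb] at hj
  -- The gap at `P₀` is treated as a gap between two curves, one of them constant.
  have hc₀ : (fun _ ↦ y - y) =O[𝓝 0] fun s : ℝ ↦ s := by simpa using isBigO_zero _ _
  have hc₄' : (fun s ↦ c₄ s - y) =O[𝓝 0] fun s ↦ s := by
    have h1 := (hc₄.trans (isBigO_pow_pow_zero (m := 1) (by norm_num))).add
      ((isBigO_smul_const (f := fun s ↦ s ^ 3) ((gaussCurvature P₀ / 2) • (a - b))).trans
        (isBigO_pow_pow_zero (m := 1) (by norm_num)))
    simpa only [sub_add_cancel, pow_one] using h1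
  have tend : ∀ {c : ℝ → Plane}, ((fun s ↦ c s - y) =O[𝓝 0] fun s ↦ s) →
      Tendsto c (𝓝 0) (𝓝 y) := fun hc ↦
    tendsto_sub_nhds_zero_iff.1 (hc.trans_tendsto tendsto_id)
  have hdir : chartFrame P₀ y ((gaussCurvature P₀ / 2) • (a - b))
      = (gaussCurvature P₀ / 2) • (u - v) := by
    rw [map_smul, map_sub, ha, hb]
    rfl
  have hlim : ∀ (F : Type) [NormedAddCommGroup F] [NormedSpace ℝ F] (f : M → F) (W : Set M),
      W ∈ 𝓝 P₀ → ContMDiffOn (𝓡 2) 𝓘(ℝ, F) ∞ f W →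
      Tendsto (fun s : ℝ ↦ (s ^ 3)⁻¹ • (f ((extChartAt (𝓡 2) P₀).symm (c₄ s)) - f P₀)) (𝓝[≠] 0)
        (𝓝 (mfderiv (𝓡 2) 𝓘(ℝ, F) f P₀ ((gaussCurvature P₀ / 2) • (u - v)))) ∧
      Tendsto (fun s : ℝ ↦ (s ^ 3)⁻¹ • (f ((extChartAt (𝓡 2) P₀).symm (d₂ s))
          - f ((extChartAt (𝓡 2) P₀).symm (c₂ s)))) (𝓝[≠] 0)
        (𝓝 (mfderiv (𝓡 2) 𝓘(ℝ, F) f P₀ ((gaussCurvature P₀ / 2) • (u - v)))) := by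
    intro F _ _ f W hW hf
    obtain ⟨D, hD, hD'⟩ := hasStrictFDerivAt_comp_symm hW hf
    have h1 := tendsto_inv_pow_smul_sub hD tendsto_const_nhds (tend hc₄') hc₄
    have h2 := tendsto_inv_pow_smul_sub hD (tend hc₂) (tend hd₂') hd₂
    rw [hD', ← hy', hdir] at h1 h2
    rw [hP₀] at h1
    exact ⟨h1, h2⟩
  obtain ⟨hfin₄, hsize₄⟩ := isBigO_riemannianEDist_sub hy hc₀ hc₄' hc₄
  obtain ⟨hfin₂, hsize₂⟩ := isBigO_riemannianEDist_sub hy hc₂ hd₂' hd₂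
  rw [hP₀] at hfin₄ hsize₄
  have hsp := speed_gap haa hbb hab' (gaussCurvature P₀)
  refine ⟨fun s ↦ (extChartAt (𝓡 2) P₀).symm (c₁ s), fun s ↦ (extChartAt (𝓡 2) P₀).symm (c₂ s),
    fun s ↦ (extChartAt (𝓡 2) P₀).symm (c₃ s), fun s ↦ (extChartAt (𝓡 2) P₀).symm (c₄ s),
    fun s ↦ (extChartAt (𝓡 2) P₀).symm (d₁ s), fun s ↦ (extChartAt (𝓡 2) P₀).symm (d₂ s),
    hj, hlim, hfin₄.and hfin₂, hsize₄.congr_left fun s ↦ congr_arg _ (hsp s),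
    hsize₂.congr_left fun s ↦ congr_arg _ (hsp s), ?_⟩
  intro F _ _ f W L hW hf hL
  obtain ⟨h1, h2⟩ := hlim F f W hW hf
  -- Applying the left inverse `L` of the differential turns the limit in the target space into one
  -- in the tangent plane, where the angles are measured.
  have hgap : ∀ {T : ℝ → F}, Tendsto (fun s : ℝ ↦ (s ^ 3)⁻¹ • T s) (𝓝[≠] 0)
      (𝓝 (mfderiv (𝓡 2) 𝓘(ℝ, F) f P₀ ((gaussCurvature P₀ / 2) • (u - v)))) →
      Tendsto (fun s : ℝ ↦ (s ^ 3)⁻¹ • L (T s)) (𝓝[≠] 0)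
        (𝓝 ((gaussCurvature P₀ / 2) • (u - (o P₀).rightAngleRotation u))) := by
    intro T hT
    have h3 := (L.continuous.tendsto _).comp hT
    rw [hL, ← hJ] at h3
    exact h3.congr fun s ↦ map_smul L _ _
  obtain ⟨p₁, n₁⟩ := tendsto_oangle_gap (o P₀) hu0 (hgap h1)
  obtain ⟨p₂, n₂⟩ := tendsto_oangle_gap (o P₀) hu0 (hgap h2)
  exact ⟨fun hκ ↦ ⟨p₁ (half_pos hκ), p₂ (half_pos hκ)⟩,
    fun hκ ↦ ⟨n₁ (by linarith), n₂ (by linarith)⟩⟩
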